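/- **Theorem (Local law for density of states).** Let $N\ge 1$, $0<q<N^{1/2}$ and $0\le f\le q$. Let $H=(H_{ij})$ be a random real symmetric $N\times N$ matrix such that 1. the entries $(H_{ij})_{1\le i\le j\le N}$ are independent; 2. $\mathbb E H_{ij}=0$ for all $i,j$, $\mathbb E H_{ij}^2=1/N$ for $i\ne j$, and $|\mathbb E H_{ii}^2-1/N|\le K/N$ for all $i$, with some finite constant $K$; 3. $\mathbb E|H_{ij}|^k\le \dfrac{1}{Nq^{k-2}}$ for all $i,j$ and all integers $k\ge 3$. Let $A=H+f\,\mathbf e\mathbf e^*$ with $\mathbf e=N^{-1/2}(1,\dots,1)^*$, let $\lambda_1(A),\dots,\lambda_N(A)$ be the eigenvalues of $A$, let $\mu=\frac1N\sum_{i=1}^N\delta_{\lambda_i(A)}$ be its empirical eigenvalue measure, and let $\varrho(\mathrm dx)=\frac1{2\pi}\sqrt{(4-x^2)_+}\,\mathrm dx$ be the semicircle law. There is a universal constant $C_*\ge 1$ (independent of all parameters, including $K$) such that the following holds. For $D>0$ and $\delta\in(0,1)$ put $$C(\delta,D)=\Big(\frac{4C_*e^{5+D}}{\delta}\Big)^2,\qquad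 N_0(\delta,D)=\exp\Big[\Big(e^{10}\log\frac{4C_*e^{5+D}}{\delta}\Big)^2\Big].$$ Then for every (deterministic) interval $I\subset\mathbb R$ of length $|I|\ge N^{-1+(\log N)^{-1/2}}$ we have $$\mathbb P\big[\,|\mu(I)-\varrho(I)|\le\delta|I|\,\big]\ \ge\ 1-N^{-D}$$ whenever $C(\delta,D)\sqrt{\log N}\le q\le(\log N)^{10}$ and $N\ge N_0(\delta,D)$. -/

import Mathlib

open MeasureTheory ProbabilityTheory

noncomputable section

namespace SparseLocalLaw

/-- `H` is a (random) sparse matrix of size `N` with sparsity parameter `q ∈ (0, √N)`.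
The number `K` is the implied constant in `E H_ij² = (1 + O(δ_ij)) / N`, which only concerns the
diagonal entries. -/
structure IsSparseMatrix {Ω : Type*} [MeasurableSpace Ω] (P : Measure Ω) {N : ℕ} (q K : ℝ)
    (H : Ω → Matrix (Fin N) (Fin N) ℝ) : Prop where
  q_pos : 0 < q
  q_lt : q < √(N : ℝ)
  /-- Every realization is real symmetric. -/
  isHermitian : ∀ ω, (H ω).IsHermitian
  measurable_entry : ∀ i j, Measurable fun ω => H ω i j
  /-- The upper-triangular entries, diagonal included, are independent. -/
  indep : iIndepFun (fun (p : {p : Fin N × Fin N // p.1 ≤ p.2}) ω => H ω p.1.1 p.1.2) P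
  /-- All moments of the entries are finite, so that the integrals below are genuine. -/
  memLp_entry : ∀ i j, ∀ k : ℕ, MemLp (fun ω => H ω i j) k P
  mean_zero : ∀ i j, ∫ ω, H ω i j ∂P = 0
  variance_offDiag : ∀ i j, i ≠ j → ∫ ω, (H ω i j) ^ 2 ∂P = 1 / N
  variance_diag : ∀ i, |∫ ω, (H ω i i) ^ 2 ∂P - 1 / N| ≤ K / N
  moment_le : ∀ i j, ∀ k : ℕ, 3 ≤ k → ∫ ω, |H ω i j| ^ k ∂P ≤ 1 / (N * q ^ (k - 2))

/-- The unit vector `e = N^{-1/2} (1, …, 1)`. -/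
def unitVec (N : ℕ) : Fin N → ℝ := fun _ => (√(N : ℝ))⁻¹

/-- The adjacency matrix `A = H + f e e*`. -/
def adjacencyMatrix {N : ℕ} (f : ℝ) (H : Matrix (Fin N) (Fin N) ℝ) :
    Matrix (Fin N) (Fin N) ℝ :=
  H + f • Matrix.vecMulVec (unitVec N) (unitVec N)

theorem adjacencyMatrix_isHermitian {N : ℕ} (f : ℝ) {H : Matrix (Fin N) (Fin N) ℝ}
    (hH : H.IsHermitian) : (adjacencyMatrix f H).IsHermitian := by
  refine Matrix.IsHermitian.ext fun i j => ?_
  have h := hH.apply i j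
  simp only [adjacencyMatrix, Matrix.add_apply, Matrix.smul_apply, Matrix.vecMulVec_apply,
    star_trivial, smul_eq_mul] at h ⊢
  rw [h, mul_comm (unitVec N j)]

/-- The empirical eigenvalue measure `N⁻¹ ∑ᵢ δ_{λᵢ(A)}` of a symmetric matrix `A`. -/
def empiricalMeasure {N : ℕ} {A : Matrix (Fin N) (Fin N) ℝ} (hA : A.IsHermitian) : Measure ℝ :=
  (N : ENNReal)⁻¹ • ∑ i, Measure.dirac (hA.eigenvalues i)

/-- The semicircle law `ϱ(dx) = (2π)⁻¹ √((4 - x²)₊) dx`. -/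
def semicircle : Measure ℝ :=
  volume.withDensity fun x => ENNReal.ofReal (1 / (2 * Real.pi) * √(max (4 - x ^ 2) 0))

/-- The constant `C(δ, D) = (4 C⋆ e^{5+D} / δ)²`. -/
def constC (Cstar δ D : ℝ) : ℝ := (4 * Cstar * Real.exp (5 + D) / δ) ^ 2

/-- The constant `N₀(δ, D) = exp[(e^{10} log(4 C⋆ e^{5+D} / δ))²]`. -/
def constN₀ (Cstar δ D : ℝ) : ℝ :=
  Real.exp ((Real.exp 10 * Real.log (4 * Cstar * Real.exp (5 + D) / δ)) ^ 2)

end SparseLocalLaw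

end

namespace SparseLocalLaw

/-! ### Exponential moments of bounded random variables -/

/-! Let `G = (H - z)⁻¹` with `z = E + iη`, and let `m` be its normalized trace. Schur's formula
gives `1 / G_ii = H_ii - z - ⟨h, G⁽ⁱ⁾ h⟩`, where `h` is the off-diagonal part of row `i` and `G⁽ⁱ⁾`
is the resolvent of the minor, which is independent of `h`. If the quadratic form is close to `N⁻¹
Tr G⁽ⁱ⁾`, and hence to `m`, then `m (z + m) + 1` is small. So `Im m` is close to `√(4 - E²)₊ / 2`,
and integrating in `E` yields the counting measure.

The heart is the concentration of the forms in `h` for `q` as small as a large multiple of `√log N`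
(`BoundedRow.measure_deviationEvent_le`). Letting `k → ∞` in the moment bounds gives `|H_ij| ≤ 1/q`
almost surely (`IsSparseMatrix.ae_abs_le`). The off-diagonal part of a quadratic form is then twice
a predictable sum `∑ h_k b_k` with `b_k = ∑_{l<k} a_kl h_l`, and Bennett's exponential
supermartingale controls it once `∑ b_k²` is bounded. That sum is the squared norm of a sum of
independent vectors. A crude exponential bound shows that it is at most of order `q²/η`, after
normalizing the entries of `G⁽ⁱ⁾`. The lost powers of `q` are harmless: `q` is at most a power of
`log N`, whereas `Nη` is at least of order `δ² exp(√log N)`. This leaves room for a Bennett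
parameter `r` of order `q√log N`, and the tail `exp(-rε)` beats every union bound as soon as `q ≥
C√log N`.

The concentration bounds are relative to the size of `G⁽ⁱ⁾`, so an a priori bound on the entries of
`G` is needed. It is propagated from scale one downwards (`bootstrap`). Halving `η` at most doubles
the largest entry (`entryNorm_res_le_two_mul`), and the self-consistent equation recovers the factor
of two (`entryNorm_le_entryBound`). No continuity argument is needed. Only accuracy `δ` is required,
so the square-root loss in the stability estimate `abs_im_sub_sqrt_le` is affordable with `ε` of
order `δ²`.

The rank-one term `f e e*` changes `m` by at most `1/(Nη)`, whatever the size of `f`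
(`norm_sum_res_add_rank_one_sub_le`). Finally, `∫ Im m` over an interval counts eigenvalues with a
Poisson-smoothed indicator. Its error is dominated by three Poisson kernels, that is, by `Im m` at
three further points (`abs_indicator_sub_smoothIndicator_le`). -/

theorem exp_le_one_add_add_sq_mul_exp {x R : ℝ} (hR : 0 ≤ R) (hx : x ≤ R) :
    Real.exp x ≤ 1 + x + x ^ 2 * Real.exp R := by
  rcases le_or_gt (-1) x with h | h
  · have h1 : 1 - x ≤ Real.exp (-x) := by linarith [Real.add_one_le_exp (-x)]
    have h2 : (1 + x) * (1 - x) ≤ (1 + x) * Real.exp (-x) :=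
      mul_le_mul_of_nonneg_left h1 (by linarith)
    have h3 : Real.exp x * Real.exp (-x) = 1 := by rw [← Real.exp_add]; simp
    have h4 : Real.exp x * ((1 + x) * (1 - x)) ≤ Real.exp x * ((1 + x) * Real.exp (-x)) :=
      mul_le_mul_of_nonneg_left h2 (Real.exp_pos x).le
    have h5 : x ^ 2 * Real.exp x ≤ x ^ 2 * Real.exp R :=
      mul_le_mul_of_nonneg_left (Real.exp_le_exp.2 hx) (sq_nonneg x)
    have h6 : Real.exp x * ((1 + x) * Real.exp (-x)) = 1 + x := by
      rw [mul_left_comm, h3, mul_one]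
    nlinarith
  · have h1 : Real.exp x ≤ 1 := Real.exp_le_one_iff.2 (by linarith)
    have h2 : 1 ≤ Real.exp R := Real.one_le_exp hR
    nlinarith [mul_le_mul_of_nonneg_left h2 (sq_nonneg x)]

/-- Integrating the quadratic bound on `exp` and using `1 + y ≤ exp y` turns first and second
moments into an exponential moment. The mean is allowed to be nonzero because the vector-valued
increments below have a small drift. -/
theorem lintegral_exp_le {Ω : Type*} [MeasurableSpace Ω] {P : Measure Ω} [IsProbabilityMeasure P]
    {Y : Ω → ℝ} (hY : AEStronglyMeasurable Y P) {R a b : ℝ} (hR : ∀ᵐ ω ∂P, |Y ω| ≤ R)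
    (ha : ∫ ω, Y ω ∂P ≤ a) (hb : ∫ ω, Y ω ^ 2 ∂P ≤ b) :
    ∫⁻ ω, ENNReal.ofReal (Real.exp (Y ω)) ∂P ≤
      ENNReal.ofReal (Real.exp (a + Real.exp R * b)) := by
  obtain ⟨ω₀, hω₀⟩ := hR.exists
  have hR0 : 0 ≤ R := (abs_nonneg _).trans hω₀
  have hYi : Integrable Y P := Integrable.of_bound hY R hR
  have hY2 : Integrable (fun ω => Y ω ^ 2) P := by
    refine Integrable.of_bound (hY.pow 2) (R ^ 2) ?_
    filter_upwards [hR] with ω h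
    rw [Real.norm_eq_abs, abs_pow]
    exact pow_le_pow_left₀ (abs_nonneg _) h 2
  have hint : Integrable (fun ω => 1 + Y ω + Y ω ^ 2 * Real.exp R) P :=
    ((integrable_const 1).add hYi).add (hY2.mul_const _)
  have hle : ∀ᵐ ω ∂P, Real.exp (Y ω) ≤ 1 + Y ω + Y ω ^ 2 * Real.exp R := by
    filter_upwards [hR] with ω h
    exact exp_le_one_add_add_sq_mul_exp hR0 ((le_abs_self _).trans h)
  calc ∫⁻ ω, ENNReal.ofReal (Real.exp (Y ω)) ∂P
      ≤ ∫⁻ ω, ENNReal.ofReal (1 + Y ω + Y ω ^ 2 * Real.exp R) ∂P := by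
        refine lintegral_mono_ae ?_
        filter_upwards [hle] with ω h using ENNReal.ofReal_le_ofReal h
    _ = ENNReal.ofReal (∫ ω, (1 + Y ω + Y ω ^ 2 * Real.exp R) ∂P) := by
        rw [ofReal_integral_eq_lintegral_ofReal hint]
        filter_upwards [hle] with ω h using (Real.exp_pos _).le.trans h
    _ ≤ _ := by
        refine ENNReal.ofReal_le_ofReal ?_
        have h1 : ∫ ω, (1 + Y ω + Y ω ^ 2 * Real.exp R) ∂P =
            1 + ∫ ω, Y ω ∂P + (∫ ω, Y ω ^ 2 ∂P) * Real.exp R := by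
          have e1 := integral_add (μ := P) ((integrable_const (1 : ℝ)).add hYi)
            (hY2.mul_const (Real.exp R))
          have e2 := integral_add (μ := P) (integrable_const (1 : ℝ)) hYi
          simp only [Pi.add_apply] at e1
          rw [e1, e2, integral_mul_const]
          simp
        rw [h1]
        have := Real.add_one_le_exp (a + Real.exp R * b)
        have h2 := mul_le_mul_of_nonneg_right hb (Real.exp_pos R).le
        linarith

/-- A finite family of independent centred random variables bounded by `κ`, of variance at
most `v`. -/
structure BoundedRow {Ω : Type*} [MeasurableSpace Ω] (P : Measure Ω) {N : ℕ}
    (h : Fin N → Ω → ℝ) (κ v : ℝ) : Prop where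
  indep : iIndepFun h P
  meas : ∀ k, Measurable (h k)
  bdd : ∀ k, ∀ᵐ ω ∂P, |h k ω| ≤ κ
  mean : ∀ k, ∫ ω, h k ω ∂P = 0
  var : ∀ k, ∫ ω, h k ω ^ 2 ∂P ≤ v

/-! ### Revealing independent variables one at a time -/

section Recursion

variable {Ω : Type*} [MeasurableSpace Ω] {P : Measure Ω} [IsProbabilityMeasure P] {N : ℕ}
  {h : Fin N → Ω → ℝ} {κ v : ℝ}

/-- The family truncated to the indices `< k`. -/
def maskBelow (k : ℕ) (x : Fin N → ℝ) : Fin N → ℝ := fun l => if (l : ℕ) < k then x l else 0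

theorem measurable_maskBelow (k : ℕ) : Measurable (maskBelow (N := N) k) := by
  refine measurable_pi_lambda _ fun l => ?_
  unfold maskBelow
  split_ifs
  · exact measurable_pi_apply l
  · exact measurable_const

theorem maskBelow_succ (k : Fin N) (x : Fin N → ℝ) :
    maskBelow (k + 1) x = Function.update (maskBelow k x) k (x k) := by
  ext l
  by_cases hl : l = k
  · subst hl; simp [maskBelow]
  · have : (l : ℕ) ≠ k := fun e => hl (Fin.ext e)
    have h2 : ((l : ℕ) < k + 1) ↔ ((l : ℕ) < k) := by omega
    simp [maskBelow, Function.update_of_ne hl, h2]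

theorem indepFun_maskBelow (hi : iIndepFun h P) (hm : ∀ k, Measurable (h k)) (k : Fin N) :
    IndepFun (fun ω => maskBelow k fun l => h l ω) (h k) P := by
  have h1 := hi.indepFun_finset (Finset.univ.filter fun l : Fin N => l < k) {k}
    (by simp) hm
  have hφ : Measurable (fun (x : (Finset.univ.filter fun l : Fin N => l < k) → ℝ) (l : Fin N) =>
      if hl : l < k then x ⟨l, by simpa using hl⟩ else 0) := by
    refine measurable_pi_lambda _ fun l => ?_
    by_cases hl : l < k
    · simp only [hl, dif_pos]; exact measurable_pi_apply _
    · simp only [hl, dif_neg, not_false_iff]; exact measurable_const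
  have hψ : Measurable (fun y : ({k} : Finset (Fin N)) → ℝ => y ⟨k, by simp⟩) :=
    measurable_pi_apply _
  have h2 := h1.comp hφ hψ
  convert h2 using 1
  · ext ω l
    by_cases hl : l < k
    · have : (l : ℕ) < k := hl
      simp [maskBelow, hl, this]
    · have : ¬ (l : ℕ) < k := hl
      simp [maskBelow, hl, this]
  · rfl

theorem lintegral_comp_le_of_indepFun {α : Type*} [MeasurableSpace α] {X : Ω → α} {Y : Ω → ℝ}
    (hX : Measurable X) (hY : Measurable Y) (hXY : IndepFun X Y P) {F : α → ℝ → ENNReal}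
    (hF : Measurable (Function.uncurry F)) {G : α → ENNReal} (hG : Measurable G)
    (hFG : ∀ x, ∫⁻ ω, F x (Y ω) ∂P ≤ G x) :
    ∫⁻ ω, F (X ω) (Y ω) ∂P ≤ ∫⁻ ω, G (X ω) ∂P := by
  have h1 := (indepFun_iff_map_prod_eq_prod_map_map hX.aemeasurable hY.aemeasurable).1 hXY
  have : IsProbabilityMeasure (P.map Y) := Measure.isProbabilityMeasure_map hY.aemeasurable
  calc ∫⁻ ω, F (X ω) (Y ω) ∂P = ∫⁻ p, Function.uncurry F p ∂(P.map fun ω => (X ω, Y ω)) := by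
        rw [lintegral_map hF (hX.prodMk hY)]; rfl
    _ = ∫⁻ x, ∫⁻ y, F x y ∂(P.map Y) ∂(P.map X) := by
        rw [h1, lintegral_prod _ hF.aemeasurable]; rfl
    _ ≤ ∫⁻ x, G x ∂(P.map X) := by
        refine lintegral_mono fun x => ?_
        have := lintegral_map (μ := P) (hF.comp (measurable_prodMk_left (x := x))) hY
        simp only [Function.comp_apply, Function.uncurry] at this
        rw [this]
        exact hFG x
    _ = _ := lintegral_map hG hX

/-- A supermartingale inequality without conditional expectations. `Ψ k` is evaluated with the
coordinates from `k` on set to zero, and `hstep` integrates out one fresh coordinate for every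
frozen value of the others. By independence and Fubini this suffices. -/
theorem lintegral_le_of_step (hi : iIndepFun h P) (hm : ∀ k, Measurable (h k))
    (Ψ : ℕ → (Fin N → ℝ) → ENNReal) (hΨ : ∀ k, Measurable (Ψ k))
    (hstep : ∀ (k : Fin N) x, ∫⁻ ω, Ψ (k + 1) (Function.update x k (h k ω)) ∂P ≤ Ψ k x) :
    ∫⁻ ω, Ψ N (fun l => h l ω) ∂P ≤ Ψ 0 0 := by
  have hmask : ∀ k, Measurable fun ω => maskBelow k fun l => h l ω := fun k =>
    (measurable_maskBelow k).comp (measurable_pi_lambda _ hm)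
  have key : ∀ k, k ≤ N → ∫⁻ ω, Ψ k (maskBelow k fun l => h l ω) ∂P ≤ Ψ 0 0 := by
    intro k
    induction k with
    | zero =>
      intro _
      have : ∀ ω, (maskBelow 0 fun l => h l ω) = 0 := fun ω => by ext l; simp [maskBelow]
      simp [this]
    | succ k ih =>
      intro hk
      refine le_trans ?_ (ih (by omega))
      have h1 : ∀ ω, (maskBelow (k + 1) fun l => h l ω) =
          Function.update (maskBelow k fun l => h l ω) ⟨k, hk⟩ (h ⟨k, hk⟩ ω) := fun ω =>
        maskBelow_succ ⟨k, hk⟩ _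
      simp only [h1]
      refine lintegral_comp_le_of_indepFun
        (F := fun x y => Ψ (k + 1) (Function.update x ⟨k, hk⟩ y)) (hmask k) (hm _)
        (indepFun_maskBelow hi hm ⟨k, hk⟩) ?_ (hΨ k) (hstep ⟨k, hk⟩)
      refine (hΨ (k + 1)).comp ?_
      refine measurable_pi_lambda _ fun l => ?_
      by_cases hl : l = ⟨k, hk⟩
      · subst hl; simpa using measurable_snd
      · simp only [Function.update_of_ne hl]
        exact (measurable_pi_apply l).comp measurable_fst
  have h2 := key N le_rfl
  have h3 : ∀ ω, (maskBelow N fun l => h l ω) = fun l => h l ω := fun ω => by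
    ext l; simp [maskBelow]
  simpa [h3] using h2

end Recursion

end SparseLocalLaw

namespace SparseLocalLaw

/-! ### Tail bounds for predictable sums and for sums of vectors -/

theorem sum_ite_lt_succ {M : Type*} [AddCommMonoid M] {N : ℕ} (f : Fin N → M) (k : Fin N) :
    ∑ j : Fin N, (if (j : ℕ) < k + 1 then f j else 0) =
      ∑ j : Fin N, (if (j : ℕ) < k then f j else 0) + f k := by
  have h1 : ∀ j : Fin N, (if (j : ℕ) < k + 1 then f j else 0) =
      (if (j : ℕ) < k then f j else 0) + if j = k then f j else 0 := by
    intro j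
    by_cases hj : j = k
    · subst hj; simp
    · have : (j : ℕ) ≠ k := fun e => hj (Fin.ext e)
      have h2 : ((j : ℕ) < k + 1) ↔ ((j : ℕ) < k) := by omega
      simp [h2, hj]
  simp only [h1, Finset.sum_add_distrib, Finset.sum_ite_eq', Finset.mem_univ, if_true]

variable {Ω : Type*} [MeasurableSpace Ω] {P : Measure Ω} [IsProbabilityMeasure P] {N : ℕ}
  {h : Fin N → Ω → ℝ} {κ v : ℝ}

/-- The exponential supermartingale of a predictable transform `∑ h_k β_k`. -/
theorem BoundedRow.lintegral_exp_le_one (hr : BoundedRow P h κ v)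
    {β : Fin N → (Fin N → ℝ) → ℝ} (hβm : ∀ k, Measurable (β k)) (hβ1 : ∀ k x, |β k x| ≤ 1)
    (hβ : ∀ j k x t, j ≤ k → β j (Function.update x k t) = β j x) {r : ℝ} (hr0 : 0 ≤ r) :
    ∫⁻ ω, ENNReal.ofReal (Real.exp (∑ k, (r * (h k ω * β k fun l => h l ω) -
      r ^ 2 * Real.exp (r * κ) * v * (β k fun l => h l ω) ^ 2))) ∂P ≤ 1 := by
  -- The compensator: since `|β| ≤ 1`, the variable `r β h` is bounded by `rκ` and has second moment
  -- at most `r² β² v`, so its exponential moment is at most `exp(ρ β²)`.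
  set ρ := r ^ 2 * Real.exp (r * κ) * v with hρ
  let f : Fin N → (Fin N → ℝ) → ℝ := fun j x => r * (x j * β j x) - ρ * β j x ^ 2
  let Ψ : ℕ → (Fin N → ℝ) → ENNReal := fun k x =>
    ENNReal.ofReal (Real.exp (∑ j : Fin N, if (j : ℕ) < k then f j x else 0))
  have hf : ∀ j, Measurable (f j) := fun j =>
    (((measurable_pi_apply j).mul (hβm j)).const_mul r).sub (((hβm j).pow_const 2).const_mul ρ)
  have hΨ : ∀ k, Measurable (Ψ k) := by
    intro k
    refine (Real.measurable_exp.comp (Finset.measurable_sum _ fun j _ => ?_)).ennreal_ofReal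
    split_ifs
    · exact hf j
    · exact measurable_const
  have hstep : ∀ (k : Fin N) x, ∫⁻ ω, Ψ (k + 1) (Function.update x k (h k ω)) ∂P ≤ Ψ k x := by
    intro k x
    have h1 : ∀ t, Ψ (k + 1) (Function.update x k t) =
        ENNReal.ofReal (Real.exp (∑ j : Fin N, (if (j : ℕ) < k then f j x else 0) -
          ρ * β k x ^ 2)) * ENNReal.ofReal (Real.exp (r * β k x * t)) := by
      intro t
      simp only [Ψ]
      rw [sum_ite_lt_succ (fun j => f j (Function.update x k t)) k,
        ← ENNReal.ofReal_mul (Real.exp_pos _).le, ← Real.exp_add]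
      congr 2
      have h2 : ∀ j : Fin N, (if (j : ℕ) < k then f j (Function.update x k t) else 0) =
          if (j : ℕ) < k then f j x else 0 := by
        intro j
        split_ifs with hj
        · have hjk : j ≠ k := fun e => by subst e; exact lt_irrefl _ hj
          simp only [f, hβ j k x t (le_of_lt hj), Function.update_of_ne hjk]
        · rfl
      simp only [h2, f, hβ k k x t le_rfl, Function.update_self]
      ring
    simp only [h1]
    rw [lintegral_const_mul _ (by
      exact (Real.measurable_exp.comp ((hr.meas k).const_mul _)).ennreal_ofReal)]
    have h3 : ∫⁻ ω, ENNReal.ofReal (Real.exp (r * β k x * h k ω)) ∂P ≤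
        ENNReal.ofReal (Real.exp (0 + Real.exp (r * κ) * ((r * β k x) ^ 2 * v))) := by
      refine lintegral_exp_le ((hr.meas k).const_mul _).aestronglyMeasurable ?_ ?_ ?_
      · filter_upwards [hr.bdd k] with ω hω
        rw [abs_mul, abs_mul, abs_of_nonneg hr0, mul_assoc]
        refine mul_le_mul_of_nonneg_left ?_ hr0
        calc |β k x| * |h k ω| ≤ 1 * |h k ω| :=
              mul_le_mul_of_nonneg_right (hβ1 k x) (abs_nonneg _)
          _ ≤ κ := by rw [one_mul]; exact hω
      · rw [integral_const_mul, hr.mean k, mul_zero]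
      · simp only [mul_pow (r * β k x)]
        rw [integral_const_mul]
        exact mul_le_mul_of_nonneg_left (hr.var k) (sq_nonneg _)
    calc _ ≤ _ := mul_le_mul_right h3 _
      _ = Ψ k x := by
        rw [← ENNReal.ofReal_mul (Real.exp_pos _).le, ← Real.exp_add]
        simp only [Ψ]
        congr 2
        rw [hρ]; ring
  have := lintegral_le_of_step hr.indep hr.meas Ψ hΨ hstep
  simpa [Ψ, f] using this

/-- Bennett-type bound: a predictable sum exceeds `t` with small probability on the event that
its quadratic variation is at most `V`. -/
theorem BoundedRow.measure_predictable_le (hr : BoundedRow P h κ v) (hv : 0 ≤ v)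
    {β : Fin N → (Fin N → ℝ) → ℝ} (hβm : ∀ k, Measurable (β k)) (hβ1 : ∀ k x, |β k x| ≤ 1)
    (hβ : ∀ j k x t, j ≤ k → β j (Function.update x k t) = β j x) {r : ℝ} (hr0 : 0 ≤ r)
    {V R t : ℝ} (hV : r ^ 2 * Real.exp (r * κ) * v * V ≤ R) :
    P {ω | t < ∑ k, h k ω * (β k fun l => h l ω) ∧ ∑ k, (β k fun l => h l ω) ^ 2 ≤ V} ≤
      ENNReal.ofReal (Real.exp (R - r * t)) := by
  set ρ := r ^ 2 * Real.exp (r * κ) * v with hρ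
  have hρ0 : 0 ≤ ρ := mul_nonneg (mul_nonneg (sq_nonneg _) (Real.exp_pos _).le) hv
  set Z : Ω → ENNReal := fun ω => ENNReal.ofReal (Real.exp (∑ k, (r * (h k ω * β k fun l => h l ω) -
      ρ * (β k fun l => h l ω) ^ 2))) with hZ
  have hh : Measurable fun ω => fun l => h l ω := measurable_pi_lambda _ hr.meas
  have hZm : Measurable Z := by
    refine (Real.measurable_exp.comp (Finset.measurable_sum _ fun k _ => ?_)).ennreal_ofReal
    exact (((hr.meas k).mul ((hβm k).comp hh)).const_mul r).sub
      ((((hβm k).comp hh).pow_const 2).const_mul ρ)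
  have hsub : {ω | t < ∑ k, h k ω * (β k fun l => h l ω) ∧ ∑ k, (β k fun l => h l ω) ^ 2 ≤ V} ⊆
      -- On the event, the compensator totals at most `ρ V ≤ R`, so the supermartingale is at least
      -- `exp(r t - R)` and Markov's inequality applies.
      {ω | ENNReal.ofReal (Real.exp (r * t - R)) ≤ Z ω} := by
    rintro ω ⟨h1, h2⟩
    refine ENNReal.ofReal_le_ofReal (Real.exp_le_exp.2 ?_)
    rw [Finset.sum_sub_distrib, ← Finset.mul_sum, ← Finset.mul_sum]
    have h3 := mul_le_mul_of_nonneg_left h1.le hr0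
    have h4 := mul_le_mul_of_nonneg_left h2 hρ0
    linarith
  have hm := mul_meas_ge_le_lintegral (μ := P) hZm (ENNReal.ofReal (Real.exp (r * t - R)))
  have h1 := hm.trans (hr.lintegral_exp_le_one hβm hβ1 hβ hr0)
  have h2 : ENNReal.ofReal (Real.exp (R - r * t)) * ENNReal.ofReal (Real.exp (r * t - R)) = 1 := by
    rw [← ENNReal.ofReal_mul (Real.exp_pos _).le, ← Real.exp_add]; simp
  calc _ ≤ _ := measure_mono hsub
    _ = ENNReal.ofReal (Real.exp (R - r * t)) * (ENNReal.ofReal (Real.exp (r * t - R)) *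
        P {ω | ENNReal.ofReal (Real.exp (r * t - R)) ≤ Z ω}) := by rw [← mul_assoc, h2, one_mul]
    _ ≤ ENNReal.ofReal (Real.exp (R - r * t)) * 1 := mul_le_mul_right h1 _
    _ = _ := mul_one _

theorem BoundedRow.measure_abs_predictable_le (hr : BoundedRow P h κ v) (hv : 0 ≤ v)
    {β : Fin N → (Fin N → ℝ) → ℝ} (hβm : ∀ k, Measurable (β k)) (hβ1 : ∀ k x, |β k x| ≤ 1)
    (hβ : ∀ j k x t, j ≤ k → β j (Function.update x k t) = β j x) {r : ℝ} (hr0 : 0 ≤ r)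
    {V R t : ℝ} (hV : r ^ 2 * Real.exp (r * κ) * v * V ≤ R) :
    P {ω | t < |∑ k, h k ω * (β k fun l => h l ω)| ∧ ∑ k, (β k fun l => h l ω) ^ 2 ≤ V} ≤
      2 * ENNReal.ofReal (Real.exp (R - r * t)) := by
  have h1 := hr.measure_predictable_le hv hβm hβ1 hβ hr0 (t := t) hV
  have h2 := hr.measure_predictable_le hv (β := fun k x => -β k x) (fun k => (hβm k).neg)
    (fun k x => by rw [abs_neg]; exact hβ1 k x) (fun j k x t hjk => by simp only [hβ j k x t hjk])
    hr0 (t := t) hV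
  refine le_trans (le_trans (measure_mono ?_) (measure_union_le _ _))
    (le_trans (add_le_add h1 h2) (by rw [two_mul]))
  rintro ω ⟨h3, h4⟩
  rcases lt_abs.1 h3 with h5 | h5
  · exact Or.inl ⟨h5, h4⟩
  · refine Or.inr ⟨?_, by simpa using h4⟩
    simpa [Finset.sum_neg_distrib] using h5

/-- The special case of deterministic coefficients. -/
theorem BoundedRow.measure_abs_linear_le (hr : BoundedRow P h κ v) (hv : 0 ≤ v)
    {c : Fin N → ℝ} (hc : ∀ k, |c k| ≤ 1) {r : ℝ} (hr0 : 0 ≤ r)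
    {V R t : ℝ} (hV : r ^ 2 * Real.exp (r * κ) * v * V ≤ R) (hcV : ∑ k, c k ^ 2 ≤ V) :
    P {ω | t < |∑ k, h k ω * c k|} ≤ 2 * ENNReal.ofReal (Real.exp (R - r * t)) := by
  have := hr.measure_abs_predictable_le hv (β := fun k _ => c k) (fun k => measurable_const)
    (fun k _ => hc k) (fun _ _ _ _ _ => rfl) hr0 (t := t) hV
  simpa [hcV] using this

/-! ### Norms of sums of independent vectors -/

section Vector

variable {E : Type*} [NormedAddCommGroup E] [InnerProductSpace ℝ E] [MeasurableSpace E]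
  [BorelSpace E] [SecondCountableTopology E]

/-- Concavity of the square root: its graph lies below the tangent. The function `√(1 + ‖S‖²)`
serves as a smooth substitute for the norm, and its increments are bounded by this tangent. -/
theorem sqrt_one_add_le {a b : ℝ} (ha : 0 ≤ a) (hb : 0 ≤ b) :
    √(1 + b) ≤ √(1 + a) + (b - a) / (2 * √(1 + a)) := by
  have h1 : 0 < √(1 + a) := Real.sqrt_pos.2 (by linarith)
  have h2 : √(1 + a) ^ 2 = 1 + a := Real.sq_sqrt (by linarith)
  have h3 : √(1 + b) ^ 2 = 1 + b := Real.sq_sqrt (by linarith)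
  have h4 : √(1 + a) + (b - a) / (2 * √(1 + a)) = (2 * √(1 + a) ^ 2 + (b - a)) / (2 * √(1 + a)) := by
    field_simp
  rw [h4, le_div_iff₀ (by positivity)]
  nlinarith [sq_nonneg (√(1 + b) - √(1 + a))]

theorem exp_increment_le {θ t : ℝ} (hθ : 0 ≤ θ) (S w : E) :
    Real.exp (θ * √(1 + ‖S + t • w‖ ^ 2)) ≤ Real.exp (θ * √(1 + ‖S‖ ^ 2)) *
      Real.exp (θ * ((2 * t * inner ℝ S w + t ^ 2 * ‖w‖ ^ 2) / (2 * √(1 + ‖S‖ ^ 2)))) := by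
  rw [← Real.exp_add, ← mul_add]
  refine Real.exp_le_exp.2 (mul_le_mul_of_nonneg_left ?_ hθ)
  have h1 := sqrt_one_add_le (sq_nonneg ‖S‖) (sq_nonneg ‖S + t • w‖)
  rw [norm_add_sq_real S (t • w), norm_smul, inner_smul_right] at h1
  rw [norm_add_sq_real S (t • w), norm_smul, inner_smul_right]
  rw [Real.norm_eq_abs, mul_pow, sq_abs] at h1 ⊢
  refine h1.trans (le_of_eq ?_)
  ring

/-- The tangent increment has a linear term, which is centred, and a quadratic term of mean at most
of order `θ v`. With `θ = 1/(2κ)` the exponent stays bounded by one, and each new vector costs at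
most a factor `exp(2 v / κ²)`. -/
theorem BoundedRow.lintegral_exp_increment_le (hr : BoundedRow P h κ v) (hκ : 0 < κ) (hκ1 : κ ≤ 1)
    (k : Fin N) (S w : E) (hw : ‖w‖ ≤ 1) :
    ∫⁻ ω, ENNReal.ofReal (Real.exp (1 / (2 * κ) * √(1 + ‖S + h k ω • w‖ ^ 2))) ∂P ≤
      ENNReal.ofReal (Real.exp (1 / (2 * κ) * √(1 + ‖S‖ ^ 2))) *
        ENNReal.ofReal (Real.exp (2 / κ ^ 2 * v)) := by
  set θ := 1 / (2 * κ) with hθ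
  have hθ0 : 0 ≤ θ := by positivity
  have hθκ : θ * κ = 1 / 2 := by rw [hθ]; field_simp
  set F := √(1 + ‖S‖ ^ 2) with hF
  have hF1 : 1 ≤ F := Real.one_le_sqrt.2 (by nlinarith [sq_nonneg ‖S‖])
  have hSF : ‖S‖ ≤ F := Real.le_sqrt_of_sq_le (by linarith)
  have hin : |inner ℝ S w| ≤ F := (abs_real_inner_le_norm S w).trans
    (by nlinarith [norm_nonneg S, norm_nonneg w])
  set Y : ℝ → ℝ := fun t => θ * ((2 * t * inner ℝ S w + t ^ 2 * ‖w‖ ^ 2) / (2 * F)) with hY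
  have hYm : Measurable Y := by fun_prop
  have hYb : ∀ t, |t| ≤ κ → |Y t| ≤ θ * (3 / 2 * |t|) := by
    intro t ht
    rw [hY]
    simp only
    rw [abs_mul, abs_of_nonneg hθ0]
    refine mul_le_mul_of_nonneg_left ?_ hθ0
    rw [abs_div, abs_of_pos (by positivity : 0 < 2 * F), div_le_iff₀ (by positivity)]
    have h1 : |2 * t * inner ℝ S w + t ^ 2 * ‖w‖ ^ 2| ≤ 2 * |t| * F + |t| := by
      refine (abs_add_le _ _).trans (add_le_add ?_ ?_)
      · rw [abs_mul, abs_mul, abs_two]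
        exact mul_le_mul_of_nonneg_left hin (by positivity)
      · rw [abs_of_nonneg (by positivity), ← sq_abs t]
        have : ‖w‖ ^ 2 ≤ 1 := pow_le_one₀ (norm_nonneg _) hw
        nlinarith [abs_nonneg t, sq_nonneg |t|, ht.trans hκ1]
    nlinarith [abs_nonneg t]
  have hκe : ∀ᵐ ω ∂P, |Y (h k ω)| ≤ 1 := by
    filter_upwards [hr.bdd k] with ω hω
    refine (hYb _ hω).trans ?_
    nlinarith
  have hsq : Integrable (fun ω => h k ω ^ 2) P := by
    refine Integrable.of_bound ((hr.meas k).pow_const 2).aestronglyMeasurable (κ ^ 2) ?_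
    filter_upwards [hr.bdd k] with ω hω
    rw [Real.norm_eq_abs, abs_pow]
    exact pow_le_pow_left₀ (abs_nonneg _) hω 2
  have hint : Integrable (h k) P := Integrable.of_bound (hr.meas k).aestronglyMeasurable κ (by
    simpa using hr.bdd k)
  have hv0 : 0 ≤ v := (integral_nonneg fun ω => sq_nonneg _).trans (hr.var k)
  have hmean : ∫ ω, Y (h k ω) ∂P ≤ θ * (v / 2) := by
    have h1 : ∀ ω, Y (h k ω) = (θ * inner ℝ S w / F) * h k ω + (θ * ‖w‖ ^ 2 / (2 * F)) *
        h k ω ^ 2 := fun ω => by rw [hY]; field_simp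
    simp only [h1]
    rw [integral_add (hint.const_mul _) (hsq.const_mul _), integral_const_mul, integral_const_mul,
      hr.mean k, mul_zero, zero_add]
    have h2 : θ * ‖w‖ ^ 2 / (2 * F) ≤ θ / 2 := by
      rw [div_le_div_iff₀ (by positivity) (by norm_num)]
      have : ‖w‖ ^ 2 ≤ 1 := pow_le_one₀ (norm_nonneg _) hw
      nlinarith [mul_le_mul_of_nonneg_left (this.trans hF1) hθ0]
    calc _ ≤ θ / 2 * v := mul_le_mul h2 (hr.var k) (integral_nonneg fun ω => sq_nonneg _)
          (by positivity)
      _ = _ := by ring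
  have hvar : ∫ ω, Y (h k ω) ^ 2 ∂P ≤ 9 / 4 * θ ^ 2 * v := by
    calc ∫ ω, Y (h k ω) ^ 2 ∂P ≤ ∫ ω, 9 / 4 * θ ^ 2 * h k ω ^ 2 ∂P := by
          refine integral_mono_of_nonneg (Filter.Eventually.of_forall fun ω => sq_nonneg _)
            (hsq.const_mul _) ?_
          filter_upwards [hr.bdd k] with ω hω
          have := pow_le_pow_left₀ (abs_nonneg _) (hYb _ hω) 2
          rw [sq_abs] at this
          refine this.trans (le_of_eq ?_)
          rw [mul_pow, mul_pow, sq_abs]; ring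
      _ ≤ _ := by
          rw [integral_const_mul]
          exact mul_le_mul_of_nonneg_left (hr.var k) (by positivity)
  have hexp := lintegral_exp_le (hYm.comp (hr.meas k)).aestronglyMeasurable hκe hmean hvar
  calc _ ≤ ∫⁻ ω, ENNReal.ofReal (Real.exp (θ * F)) * ENNReal.ofReal (Real.exp (Y (h k ω))) ∂P := by
        refine lintegral_mono fun ω => ?_
        rw [← ENNReal.ofReal_mul (Real.exp_pos _).le]
        exact ENNReal.ofReal_le_ofReal (exp_increment_le hθ0 S w)
    _ ≤ _ := by
        rw [lintegral_const_mul _ (by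
          exact (Real.measurable_exp.comp (hYm.comp (hr.meas k))).ennreal_ofReal)]
        refine mul_le_mul_right (hexp.trans (ENNReal.ofReal_le_ofReal (Real.exp_le_exp.2 ?_))) _
        have he : Real.exp 1 ≤ 2.7183 := by have := Real.exp_one_lt_d9; linarith
        have h1 : θ = κ / (2 * κ ^ 2) := by rw [hθ]; field_simp
        have h2 : θ ^ 2 = 1 / (4 * κ ^ 2) := by rw [hθ, div_pow]; ring
        have h3 : θ ≤ 1 / (2 * κ ^ 2) := by
          rw [h1]; gcongr
        have h4 : Real.exp 1 * (9 / 4 * θ ^ 2 * v) ≤ 2.7183 * (9 / 4 * θ ^ 2 * v) :=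
          mul_le_mul_of_nonneg_right he (by positivity)
        have h5 : θ * (v / 2) ≤ 1 / (2 * κ ^ 2) * (v / 2) :=
          mul_le_mul_of_nonneg_right h3 (by positivity)
        have h6 : 1 / (2 * κ ^ 2) * (v / 2) + 2.7183 * (9 / 4 * (1 / (4 * κ ^ 2)) * v) ≤
            2 / κ ^ 2 * v := by
          have : 0 ≤ v / κ ^ 2 := by positivity
          have e1 : 1 / (2 * κ ^ 2) * (v / 2) + 2.7183 * (9 / 4 * (1 / (4 * κ ^ 2)) * v) =
            (1 / 4 + 2.7183 * 9 / 16) * (v / κ ^ 2) := by ring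
          have e2 : 2 / κ ^ 2 * v = 2 * (v / κ ^ 2) := by ring
          rw [e1, e2]; norm_num; nlinarith
        rw [h2] at h4 ⊢
        linarith

/-- A sum of independent centred vectors `h_l w_l`, where `‖w_l‖ ≤ 1` and `|h_l| ≤ κ`, has norm at
most `8 / κ` with high probability. -/
theorem BoundedRow.measure_norm_sum_le (hr : BoundedRow P h κ v) (hκ : 0 < κ) (hκ1 : κ ≤ 1)
    (hv : N * v ≤ 1) {w : Fin N → E} (hw : ∀ l, ‖w l‖ ≤ 1) :
    P {ω | 8 / κ ≤ ‖∑ l, h l ω • w l‖} ≤ ENNReal.ofReal (Real.exp (-(1 / κ ^ 2))) := by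
  set S : ℕ → (Fin N → ℝ) → E := fun k x => ∑ l : Fin N, if (l : ℕ) < k then x l • w l else 0
    with hS
  have hSm : ∀ k, Measurable (S k) := by
    intro k
    refine Finset.measurable_sum _ fun l _ => ?_
    split_ifs
    · exact (measurable_pi_apply l).smul_const _
    · exact measurable_const
  set C := 2 / κ ^ 2 * v with hC
  set Ψ : ℕ → (Fin N → ℝ) → ENNReal := fun k x =>
    ENNReal.ofReal (Real.exp (1 / (2 * κ) * √(1 + ‖S k x‖ ^ 2))) *
      ENNReal.ofReal (Real.exp (-(k * C))) with hΨ
  have hFm : ∀ k, Measurable fun x =>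
      ENNReal.ofReal (Real.exp (1 / (2 * κ) * √(1 + ‖S k x‖ ^ 2))) := fun k =>
    (Real.measurable_exp.comp ((Real.continuous_sqrt.measurable.comp
      (((hSm k).norm.pow_const 2).const_add 1)).const_mul _)).ennreal_ofReal
  have hstep : ∀ (k : Fin N) x, ∫⁻ ω, Ψ (k + 1) (Function.update x k (h k ω)) ∂P ≤ Ψ k x := by
    intro k x
    have h1 : ∀ t, S (k + 1) (Function.update x k t) = S k x + t • w k := by
      intro t
      simp only [hS]
      rw [sum_ite_lt_succ (fun j => Function.update x k t j • w j) k, Function.update_self]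
      congr 1
      refine Finset.sum_congr rfl fun j _ => ?_
      split_ifs with hj
      · have hjk : j ≠ k := fun e => by subst e; exact lt_irrefl _ hj
        rw [Function.update_of_ne hjk]
      · rfl
    simp only [hΨ, h1]
    rw [lintegral_mul_const' _ _ ENNReal.ofReal_ne_top]
    refine (mul_le_mul_left (hr.lintegral_exp_increment_le hκ hκ1 k (S k x) (w k) (hw k)) _).trans
      (le_of_eq ?_)
    rw [mul_assoc, ← ENNReal.ofReal_mul (Real.exp_pos _).le, ← Real.exp_add, ← hC]
    congr 3
    push_cast; ring
  have hmain := lintegral_le_of_step hr.indep hr.meas Ψ (fun k => (hFm k).mul_const _) hstep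
  have hS0 : S 0 0 = 0 := by simp [hS]
  have hSN : ∀ ω, S N (fun l => h l ω) = ∑ l, h l ω • w l := fun ω => by simp [hS]
  simp only [hΨ, hSN, hS0] at hmain
  rw [lintegral_mul_const' _ _ ENNReal.ofReal_ne_top] at hmain
  have hh : Measurable fun ω => fun l => h l ω := measurable_pi_lambda _ hr.meas
  have hZm : Measurable fun ω =>
      ENNReal.ofReal (Real.exp (1 / (2 * κ) * √(1 + ‖∑ l, h l ω • w l‖ ^ 2))) := by
    have := (hFm N).comp hh
    simpa only [Function.comp_def, hSN] using this
  -- Norm `8/κ` means exponent at least `4/κ²`. The start contributes `1/(2κ) ≤ 1/κ²` and all steps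
  -- together at most `2/κ²`, which leaves `-1/κ²`.
  have hM := mul_meas_ge_le_lintegral (μ := P) hZm (ENNReal.ofReal (Real.exp (4 / κ ^ 2)))
  have hsub : {ω | 8 / κ ≤ ‖∑ l, h l ω • w l‖} ⊆ {ω | ENNReal.ofReal (Real.exp (4 / κ ^ 2)) ≤
      ENNReal.ofReal (Real.exp (1 / (2 * κ) * √(1 + ‖∑ l, h l ω • w l‖ ^ 2)))} := by
    intro ω hω
    refine ENNReal.ofReal_le_ofReal (Real.exp_le_exp.2 ?_)
    have h1 : 8 / κ ≤ √(1 + ‖∑ l, h l ω • w l‖ ^ 2) :=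
      le_trans hω (Real.le_sqrt_of_sq_le (by linarith))
    calc 4 / κ ^ 2 = 1 / (2 * κ) * (8 / κ) := by field_simp; norm_num
      _ ≤ _ := mul_le_mul_of_nonneg_left h1 (by positivity)
  have hNC : (N : ℝ) * C ≤ 2 / κ ^ 2 := by
    rw [hC]
    calc (N : ℝ) * (2 / κ ^ 2 * v) = 2 / κ ^ 2 * (N * v) := by ring
      _ ≤ 2 / κ ^ 2 * 1 := mul_le_mul_of_nonneg_left hv (by positivity)
      _ = _ := mul_one _
  have hinv : ∀ y : ℝ, ENNReal.ofReal (Real.exp (-y)) * ENNReal.ofReal (Real.exp y) = 1 := by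
    intro y
    rw [← ENNReal.ofReal_mul (Real.exp_pos _).le, ← Real.exp_add]; simp
  calc _ ≤ _ := measure_mono hsub
    _ = ENNReal.ofReal (Real.exp (-(4 / κ ^ 2))) * (ENNReal.ofReal (Real.exp (4 / κ ^ 2)) *
        P {ω | ENNReal.ofReal (Real.exp (4 / κ ^ 2)) ≤
      ENNReal.ofReal (Real.exp (1 / (2 * κ) * √(1 + ‖∑ l, h l ω • w l‖ ^ 2)))}) := by
        rw [← mul_assoc, hinv, one_mul]
    _ ≤ ENNReal.ofReal (Real.exp (-(4 / κ ^ 2))) * ∫⁻ ω,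
        ENNReal.ofReal (Real.exp (1 / (2 * κ) * √(1 + ‖∑ l, h l ω • w l‖ ^ 2))) ∂P :=
        mul_le_mul_right hM _
    _ = ENNReal.ofReal (Real.exp (-(4 / κ ^ 2))) * ((∫⁻ ω,
        ENNReal.ofReal (Real.exp (1 / (2 * κ) * √(1 + ‖∑ l, h l ω • w l‖ ^ 2))) ∂P) *
        ENNReal.ofReal (Real.exp (-(N * C)))) * ENNReal.ofReal (Real.exp (N * C)) := by
        rw [mul_assoc, mul_assoc, hinv, mul_one]
    _ ≤ ENNReal.ofReal (Real.exp (-(4 / κ ^ 2))) * ENNReal.ofReal (Real.exp (1 / (2 * κ))) *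
        ENNReal.ofReal (Real.exp (N * C)) := by
        refine mul_le_mul_left (mul_le_mul_right (hmain.trans (le_of_eq ?_)) _) _
        simp
    _ ≤ _ := by
        rw [← ENNReal.ofReal_mul (Real.exp_pos _).le, ← ENNReal.ofReal_mul (by positivity),
          ← Real.exp_add, ← Real.exp_add]
        refine ENNReal.ofReal_le_ofReal (Real.exp_le_exp.2 ?_)
        have h1 : 1 / (2 * κ) ≤ 1 / κ ^ 2 := by
          rw [div_le_div_iff₀ (by positivity) (by positivity)]
          nlinarith
        have e1 : 4 / κ ^ 2 = 4 * (1 / κ ^ 2) := by ring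
        have e2 : 2 / κ ^ 2 = 2 * (1 / κ ^ 2) := by ring
        rw [e1]; rw [e2] at hNC
        linarith

end Vector

end SparseLocalLaw

namespace SparseLocalLaw

/-! ### Large deviations of quadratic forms -/

variable {Ω : Type*} [MeasurableSpace Ω] {P : Measure Ω} [IsProbabilityMeasure P] {N : ℕ}
  {h : Fin N → Ω → ℝ} {κ v : ℝ}

/-- The centred squares of a bounded row again form a bounded row. -/
theorem BoundedRow.sq_sub (hr : BoundedRow P h κ v) :
    BoundedRow P (fun k ω => h k ω ^ 2 - ∫ ω, h k ω ^ 2 ∂P) (κ ^ 2) (κ ^ 2 * v) where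
  indep := hr.indep.comp (fun k x => x ^ 2 - ∫ ω, h k ω ^ 2 ∂P)
    fun k => (measurable_id.pow_const 2).sub_const _
  meas k := ((hr.meas k).pow_const 2).sub_const _
  bdd k := by
    have h1 : ∫ ω, h k ω ^ 2 ∂P ≤ κ ^ 2 := by
      have := norm_integral_le_of_norm_le_const (μ := P) (f := fun ω => h k ω ^ 2) (C := κ ^ 2) (by
        filter_upwards [hr.bdd k] with ω hω
        rw [Real.norm_eq_abs, abs_pow]
        exact pow_le_pow_left₀ (abs_nonneg _) hω 2)
      rw [probReal_univ, mul_one] at this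
      exact (le_abs_self _).trans this
    have h2 : 0 ≤ ∫ ω, h k ω ^ 2 ∂P := integral_nonneg fun ω => sq_nonneg _
    filter_upwards [hr.bdd k] with ω hω
    have h3 : h k ω ^ 2 ≤ κ ^ 2 := by
      rw [← sq_abs]; exact pow_le_pow_left₀ (abs_nonneg _) hω 2
    rw [abs_le]
    constructor <;> nlinarith [sq_nonneg (h k ω)]
  mean k := by
    have hsq : Integrable (fun ω => h k ω ^ 2) P := by
      refine Integrable.of_bound ((hr.meas k).pow_const 2).aestronglyMeasurable (κ ^ 2) ?_
      filter_upwards [hr.bdd k] with ω hω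
      rw [Real.norm_eq_abs, abs_pow]
      exact pow_le_pow_left₀ (abs_nonneg _) hω 2
    rw [integral_sub hsq (integrable_const _)]
    simp
  var k := by
    set vk := ∫ ω, h k ω ^ 2 ∂P with hvk
    have hsq : Integrable (fun ω => h k ω ^ 2) P := by
      refine Integrable.of_bound ((hr.meas k).pow_const 2).aestronglyMeasurable (κ ^ 2) ?_
      filter_upwards [hr.bdd k] with ω hω
      rw [Real.norm_eq_abs, abs_pow]
      exact pow_le_pow_left₀ (abs_nonneg _) hω 2
    calc ∫ ω, (h k ω ^ 2 - vk) ^ 2 ∂P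
        ≤ ∫ ω, (κ ^ 2 * h k ω ^ 2 - 2 * vk * h k ω ^ 2 + vk ^ 2) ∂P := by
          refine integral_mono_of_nonneg (Filter.Eventually.of_forall fun ω => sq_nonneg _)
            (((hsq.const_mul _).sub (hsq.const_mul _)).add (integrable_const _)) ?_
          filter_upwards [hr.bdd k] with ω hω
          have h3 : h k ω ^ 2 ≤ κ ^ 2 := by
            rw [← sq_abs]; exact pow_le_pow_left₀ (abs_nonneg _) hω 2
          nlinarith [sq_nonneg (h k ω)]
      _ = κ ^ 2 * vk - 2 * vk * vk + vk ^ 2 := by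
          have e1 := integral_add (μ := P) ((hsq.const_mul (κ ^ 2)).sub (hsq.const_mul (2 * vk)))
            (integrable_const (vk ^ 2))
          have e2 := integral_sub (μ := P) (hsq.const_mul (κ ^ 2)) (hsq.const_mul (2 * vk))
          simp only [Pi.sub_apply] at e1
          rw [e1, e2, integral_const_mul, integral_const_mul]
          simp [hvk]
      _ ≤ κ ^ 2 * v := by
          have := mul_le_mul_of_nonneg_left (hr.var k) (sq_nonneg κ)
          nlinarith [sq_nonneg vk]

/-- A symmetric double sum in terms of its diagonal and its strictly lower triangular part. -/
theorem sum_sum_eq_diag_add_two_mul {R : Type*} [CommRing R] (f : Fin N → Fin N → R)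
    (hf : ∀ k l, f k l = f l k) :
    ∑ k, ∑ l, f k l = ∑ k, f k k + 2 * ∑ k, ∑ l, if l < k then f k l else 0 := by
  have h1 : ∀ k l, f k l = ((if l < k then f k l else 0) + if k < l then f l k else 0) +
      if l = k then f k l else 0 := by
    intro k l
    rcases lt_trichotomy l k with hlk | hlk | hlk
    · simp [hlk, hlk.not_gt, hlk.ne]
    · subst hlk; simp
    · simp [hlk, hlk.not_gt, hlk.ne', hf k l]
  have h2 : ∑ k, ∑ l, (if k < l then f l k else 0) = ∑ k, ∑ l, if l < k then f k l else 0 :=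
    Finset.sum_comm
  calc ∑ k, ∑ l, f k l = ∑ k, ∑ l, (((if l < k then f k l else 0) + if k < l then f l k else 0) +
      if l = k then f k l else 0) := Finset.sum_congr rfl fun k _ => Finset.sum_congr rfl fun l _ =>
        h1 k l
    _ = _ := by
      simp only [Finset.sum_add_distrib, h2, Finset.sum_ite_eq', Finset.mem_univ, if_true]
      ring

/-- Truncation at level one. -/
noncomputable def truncOne (x : ℝ) : ℝ := if |x| ≤ 1 then x else 0

theorem measurable_truncOne : Measurable truncOne :=
  Measurable.ite (measurableSet_le measurable_norm measurable_const) measurable_id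
    measurable_const

theorem abs_truncOne_le (x : ℝ) : |truncOne x| ≤ 1 := by
  unfold truncOne; split_ifs with hx
  · exact hx
  · simp

/-- The event that a linear or the quadratic form in `h` with coefficients `a` deviates from its
mean by more than `t`, respectively `3 t`. -/
def deviationEvent (P : Measure Ω) (h : Fin N → Ω → ℝ) (a : Fin N → Fin N → ℝ) (t : ℝ) : Set Ω :=
  {ω | (∃ k, t < |∑ l, h l ω * a k l|) ∨
    3 * t < |∑ k, ∑ l, h k ω * a k l * h l ω - ∑ k, (∫ ω, h k ω ^ 2 ∂P) * a k k|}

theorem BoundedRow.measure_deviationEvent_le (hr : BoundedRow P h κ v) (hκ : 0 < κ) (hκ1 : κ ≤ 1)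
    (hv0 : 0 ≤ v) (hv : N * v ≤ 1) {a : Fin N → Fin N → ℝ} (ha : ∀ k l, a k l = a l k)
    (ha1 : ∀ k l, |a k l| ≤ 1) {V : ℝ} (hV0 : 0 < V) (haV : ∀ k, ∑ l, a k l ^ 2 ≤ V)
    {r t : ℝ} (hr0 : 0 ≤ r) (ht0 : 0 < t) (ht1 : t ≤ 1)
    (hV : r ^ 2 * Real.exp (r * κ) * v * (64 * V / κ ^ 2) ≤ 1) :
    P (deviationEvent P h a t) ≤ ENNReal.ofReal ((4 * N + 2) * Real.exp (1 - r * t) +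
      Real.exp (-(1 / κ ^ 2)) + 2 * Real.exp (-(t ^ 2 / (8 * κ ^ 2)))) := by
  have hVle : V ≤ 64 * V / κ ^ 2 := by
    rw [le_div_iff₀ (by positivity)]
    nlinarith [pow_le_one₀ hκ.le hκ1 (n := 2)]
  have hρ0 : 0 ≤ r ^ 2 * Real.exp (r * κ) * v := by positivity
  have hV' : r ^ 2 * Real.exp (r * κ) * v * V ≤ 1 :=
    (mul_le_mul_of_nonneg_left hVle hρ0).trans hV
  -- The predictable coefficients: `b k` depends only on the coordinates before `k`, and the
  -- off-diagonal part of the quadratic form is `2 ∑ h_k b_k`.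
  set b : Fin N → (Fin N → ℝ) → ℝ := fun k x => ∑ l, if l < k then x l * a k l else 0 with hb
  have hbm : ∀ k, Measurable (b k) := by
    intro k
    refine Finset.measurable_sum _ fun l _ => ?_
    split_ifs
    · exact (measurable_pi_apply l).mul_const _
    · exact measurable_const
  set A : Fin N → Set Ω := fun k => {ω | t < |∑ l, h l ω * a k l|} with hA
  set B : Fin N → Set Ω := fun k => {ω | 1 < |b k fun l => h l ω|} with hB
  -- Normalized columns of the strictly lower triangle, chosen so that `‖∑ h_l w_l‖² = (∑ b_k²) /
  -- V`. By symmetry of `a` the bound on row sums makes each `w l` have norm at most one.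
  set w : Fin N → EuclideanSpace ℝ (Fin N) := fun l =>
    WithLp.toLp 2 fun k => if l < k then a k l / √V else 0 with hw
  set C : Set Ω := {ω | 8 / κ ≤ ‖∑ l, h l ω • w l‖} with hC
  -- Truncation makes the Bennett bound applicable everywhere. It is inactive outside the events `B
  -- k`.
  set β : Fin N → (Fin N → ℝ) → ℝ := fun k x => truncOne (b k x) with hβ
  set D : Set Ω := {ω | t < |∑ k, h k ω * (β k fun l => h l ω)| ∧
    ∑ k, (β k fun l => h l ω) ^ 2 ≤ 64 * V / κ ^ 2} with hD
  set E : Set Ω := {ω | t < |∑ k, (h k ω ^ 2 - ∫ ω, h k ω ^ 2 ∂P) * a k k|} with hE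
  have hPA : ∀ k, P (A k) ≤ 2 * ENNReal.ofReal (Real.exp (1 - r * t)) := fun k =>
    hr.measure_abs_linear_le hv0 (ha1 k) hr0 hV' (haV k)
  have hPB : ∀ k, P (B k) ≤ 2 * ENNReal.ofReal (Real.exp (1 - r * t)) := by
    intro k
    have h1 := hr.measure_abs_linear_le hv0 (c := fun l => if l < k then a k l else 0)
      (fun l => by split_ifs; exacts [ha1 k l, by simp]) hr0 (t := 1) hV' (by
        refine (Finset.sum_le_sum fun l _ => ?_).trans (haV k)
        split_ifs
        · exact le_rfl
        · simpa using sq_nonneg _)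
    have h2 : Real.exp (1 - r * 1) ≤ Real.exp (1 - r * t) := Real.exp_le_exp.2 (by nlinarith)
    refine le_trans (le_of_eq ?_) (h1.trans (mul_le_mul_right (ENNReal.ofReal_le_ofReal h2) _))
    simp only [hB, hb, mul_ite, mul_zero]
  have hw1 : ∀ l, ‖w l‖ ≤ 1 := by
    intro l
    have : ‖w l‖ ^ 2 ≤ 1 := by
      rw [EuclideanSpace.real_norm_sq_eq]
      calc ∑ k, (w l).ofLp k ^ 2 ≤ ∑ k, a l k ^ 2 / V := by
            refine Finset.sum_le_sum fun k _ => ?_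
            simp only [hw]
            split_ifs
            · rw [div_pow, Real.sq_sqrt hV0.le, ha l k]
            · rw [zero_pow two_ne_zero]; positivity
        _ ≤ 1 := by
            rw [← Finset.sum_div, div_le_one hV0]
            exact haV l
    nlinarith [norm_nonneg (w l)]
  have hPC : P C ≤ ENNReal.ofReal (Real.exp (-(1 / κ ^ 2))) :=
    hr.measure_norm_sum_le hκ hκ1 hv hw1
  have hPD : P D ≤ 2 * ENNReal.ofReal (Real.exp (1 - r * t)) := by
    refine hr.measure_abs_predictable_le hv0 (fun k => measurable_truncOne.comp (hbm k))
      (fun k x => abs_truncOne_le _) ?_ hr0 hV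
    intro j k x s hjk
    have h1 : b j (Function.update x k s) = b j x := by
      refine Finset.sum_congr rfl fun l _ => ?_
      split_ifs with hl
      · rw [Function.update_of_ne (hl.trans_le hjk).ne]
      · rfl
    change truncOne (b j _) = truncOne (b j x)
    rw [h1]
  have hPE : P E ≤ 2 * ENNReal.ofReal (Real.exp (-(t ^ 2 / (8 * κ ^ 2)))) := by
    -- The diagonal part is linear in the centred squares. The value `r = t/(4κ²)` minimizes the
    -- exponent `2 r² κ² - r t`, giving `-t²/(8κ²)`; the 2 bounds `exp(t/4)`.
    have h1 := hr.sq_sub.measure_abs_linear_le (mul_nonneg (sq_nonneg κ) hv0) (c := fun k => a k k)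
      (fun k => ha1 k k) (r := t / (4 * κ ^ 2)) (by positivity) (V := N) (t := t)
      (R := t ^ 2 / (8 * κ ^ 2)) (by
        have e1 : t / (4 * κ ^ 2) * κ ^ 2 = t / 4 := by field_simp
        have e2 : Real.exp (t / 4) ≤ 2 := by
          have h2 : Real.exp (t / 4) ≤ 1 + t / 4 + (t / 4) ^ 2 * Real.exp 1 :=
            exp_le_one_add_add_sq_mul_exp zero_le_one (by linarith)
          have h3 := Real.exp_one_lt_d9
          nlinarith [Real.exp_pos 1]
        rw [e1]
        calc (t / (4 * κ ^ 2)) ^ 2 * Real.exp (t / 4) * (κ ^ 2 * v) * N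
            = t ^ 2 / (16 * κ ^ 2) * (Real.exp (t / 4) * (N * v)) := by field_simp; ring
          _ ≤ t ^ 2 / (16 * κ ^ 2) * (2 * 1) := by
              refine mul_le_mul_of_nonneg_left ?_ (by positivity)
              exact mul_le_mul e2 hv (mul_nonneg (Nat.cast_nonneg N) hv0) (by norm_num)
          _ = _ := by field_simp; norm_num) (by
        calc ∑ k, a k k ^ 2 ≤ ∑ _k : Fin N, (1 : ℝ) := Finset.sum_le_sum fun k _ => by
              rw [← sq_abs]; exact pow_le_one₀ (abs_nonneg _) (ha1 k k)
          _ = N := by simp)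
    refine h1.trans (mul_le_mul_right (ENNReal.ofReal_le_ofReal (Real.exp_le_exp.2 ?_)) _)
    refine le_of_eq ?_
    field_simp
    ring
  have hsub : deviationEvent P h a t ⊆ ((⋃ k, A k) ∪ (⋃ k, B k)) ∪ C ∪ D ∪ E := by
    intro ω hω
    by_contra hcon
    simp only [Set.mem_union, Set.mem_iUnion, not_or, not_exists] at hcon
    obtain ⟨⟨⟨⟨h1, h2⟩, h3⟩, h4⟩, h5⟩ := hcon
    rcases hω with ⟨k, hk⟩ | hq
    · exact h1 k hk
    · have hβb : ∀ k, (β k fun l => h l ω) = b k fun l => h l ω := by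
        intro k
        simp only [hβ, truncOne]
        rw [if_pos (not_lt.1 (h2 k))]
      have hS : ∑ k, (β k fun l => h l ω) ^ 2 ≤ 64 * V / κ ^ 2 := by
        have h6 : ‖∑ l, h l ω • w l‖ ^ 2 ≤ (8 / κ) ^ 2 :=
          pow_le_pow_left₀ (norm_nonneg _) (not_le.1 h3).le 2
        have h7 : ‖∑ l, h l ω • w l‖ ^ 2 = (∑ k, (b k fun l => h l ω) ^ 2) / V := by
          rw [EuclideanSpace.real_norm_sq_eq, Finset.sum_div]
          refine Finset.sum_congr rfl fun k _ => ?_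
          have h8 : (∑ l, h l ω • w l).ofLp k = (b k fun l => h l ω) / √V := by
            simp only [WithLp.ofLp_sum, WithLp.ofLp_smul, Finset.sum_apply, Pi.smul_apply, hw, hb,
              smul_eq_mul, Finset.sum_div]
            refine Finset.sum_congr rfl fun l _ => ?_
            split_ifs <;> ring
          rw [h8, div_pow, Real.sq_sqrt hV0.le]
        simp only [hβb]
        rw [h7, div_le_iff₀ hV0] at h6
        refine h6.trans (le_of_eq ?_)
        field_simp; norm_num
      have h6 : |∑ k, h k ω * b k fun l => h l ω| ≤ t := by
        by_contra hcon
        refine h4 ⟨?_, hS⟩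
        simp only [hβb]
        exact not_le.1 hcon
      have h7 : |∑ k, (h k ω ^ 2 - ∫ ω, h k ω ^ 2 ∂P) * a k k| ≤ t := not_lt.1 h5
      have h8 : ∑ k, ∑ l, h k ω * a k l * h l ω - ∑ k, (∫ ω, h k ω ^ 2 ∂P) * a k k =
          ∑ k, (h k ω ^ 2 - ∫ ω, h k ω ^ 2 ∂P) * a k k + 2 * ∑ k, h k ω * b k fun l => h l ω := by
        rw [sum_sum_eq_diag_add_two_mul _ fun k l => by rw [ha k l]; ring]
        have e1 : ∀ k, h k ω * (b k fun l => h l ω) =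
            ∑ l, if l < k then h k ω * a k l * h l ω else 0 := by
          intro k
          simp only [hb]
          rw [Finset.mul_sum]
          refine Finset.sum_congr rfl fun l _ => ?_
          split_ifs <;> ring
        simp only [e1, sub_mul, Finset.sum_sub_distrib]
        have e2 : ∀ k, h k ω * a k k * h k ω = h k ω ^ 2 * a k k := fun k => by ring
        simp only [e2]
        ring
      rw [h8] at hq
      have := abs_add_le (∑ k, (h k ω ^ 2 - ∫ ω, h k ω ^ 2 ∂P) * a k k)
        (2 * ∑ k, h k ω * b k fun l => h l ω)
      rw [abs_mul, abs_two] at this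
      linarith
  have hU : ∀ A : Fin N → Set Ω, (∀ k, P (A k) ≤ 2 * ENNReal.ofReal (Real.exp (1 - r * t))) →
      P (⋃ k, A k) ≤ N * (2 * ENNReal.ofReal (Real.exp (1 - r * t))) := by
    intro A hA
    refine (measure_iUnion_fintype_le _ _).trans ((Finset.sum_le_sum fun k _ => hA k).trans ?_)
    simp
  calc P (deviationEvent P h a t) ≤ P (((⋃ k, A k) ∪ (⋃ k, B k)) ∪ C ∪ D ∪ E) := measure_mono hsub
    _ ≤ P (⋃ k, A k) + P (⋃ k, B k) + P C + P D + P E := by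
        refine (measure_union_le _ _).trans (add_le_add ?_ le_rfl)
        refine (measure_union_le _ _).trans (add_le_add ?_ le_rfl)
        refine (measure_union_le _ _).trans (add_le_add ?_ le_rfl)
        exact measure_union_le _ _
    _ ≤ N * (2 * ENNReal.ofReal (Real.exp (1 - r * t))) +
        N * (2 * ENNReal.ofReal (Real.exp (1 - r * t))) +
        ENNReal.ofReal (Real.exp (-(1 / κ ^ 2))) + 2 * ENNReal.ofReal (Real.exp (1 - r * t)) +
        2 * ENNReal.ofReal (Real.exp (-(t ^ 2 / (8 * κ ^ 2)))) := by
        gcongr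
        · exact hU A hPA
        · exact hU B hPB
    _ = _ := by
        have h2 : (2 : ENNReal) = ENNReal.ofReal 2 := by simp
        have hN : (N : ENNReal) = ENNReal.ofReal N := by simp
        rw [h2, hN, ← ENNReal.ofReal_mul (by norm_num), ← ENNReal.ofReal_mul (by positivity),
          ← ENNReal.ofReal_add (by positivity) (by positivity),
          ← ENNReal.ofReal_add (by positivity) (by positivity),
          ← ENNReal.ofReal_add (by positivity) (by positivity), ← ENNReal.ofReal_mul (by positivity),
          ← ENNReal.ofReal_add (by positivity) (by positivity)]
        congr 1
        ring

end SparseLocalLaw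

namespace SparseLocalLaw

/-! ### Resolvents of real symmetric matrices -/

open Matrix ComplexConjugate

variable {N : ℕ}

/-- The matrix `A - z`. -/
def shift (A : Matrix (Fin N) (Fin N) ℝ) (z : ℂ) : Matrix (Fin N) (Fin N) ℂ :=
  A.map Complex.ofReal - z • 1

/-- The resolvent `(A - z)⁻¹`. -/
noncomputable def res (A : Matrix (Fin N) (Fin N) ℝ) (z : ℂ) : Matrix (Fin N) (Fin N) ℂ :=
  (shift A z)⁻¹

/-- The maximal absolute value of the entries of a matrix. -/
noncomputable def entryNorm (M : Matrix (Fin N) (Fin N) ℂ) : ℝ :=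
  ‖(fun k l => M k l : Fin N → Fin N → ℂ)‖

theorem entryNorm_nonneg (M : Matrix (Fin N) (Fin N) ℂ) : 0 ≤ entryNorm M := norm_nonneg _

theorem norm_le_entryNorm (M : Matrix (Fin N) (Fin N) ℂ) (k l : Fin N) :
    ‖M k l‖ ≤ entryNorm M :=
  (norm_le_pi_norm (M k) l).trans (norm_le_pi_norm (fun k l => M k l : Fin N → Fin N → ℂ) k)

theorem entryNorm_le {M : Matrix (Fin N) (Fin N) ℂ} {r : ℝ} (hr : 0 ≤ r)
    (h : ∀ k l, ‖M k l‖ ≤ r) : entryNorm M ≤ r :=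
  (pi_norm_le_iff_of_nonneg hr).2 fun k => (pi_norm_le_iff_of_nonneg hr).2 fun l => h k l

section Resolvent

variable {A B : Matrix (Fin N) (Fin N) ℝ} {z w : ℂ}

theorem shift_apply (A : Matrix (Fin N) (Fin N) ℝ) (z : ℂ) (k l : Fin N) :
    shift A z k l = A k l - if k = l then z else 0 := by
  simp [shift, Matrix.one_apply]

theorem isHermitian_map_ofReal (hA : A.IsHermitian) : (A.map Complex.ofReal).IsHermitian := by
  refine Matrix.IsHermitian.ext fun k l => ?_
  have := hA.apply k l
  simp only [star_trivial] at this
  simp [this]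

theorem isUnit_det_shift (hA : A.IsHermitian) (hz : z.im ≠ 0) : IsUnit (shift A z).det := by
  rw [isUnit_iff_ne_zero]
  intro hdet
  obtain ⟨v, hv0, hv⟩ := Matrix.exists_mulVec_eq_zero_iff.2 hdet
  have h1 : (A.map Complex.ofReal) *ᵥ v = z • v := by
    have h2 : shift A z *ᵥ v = (A.map Complex.ofReal) *ᵥ v - z • v := by
      rw [shift, Matrix.sub_mulVec, Matrix.smul_mulVec, Matrix.one_mulVec]
    rw [h2] at hv
    exact sub_eq_zero.1 hv
  have h3 := (isHermitian_map_ofReal hA).im_star_dotProduct_mulVec_self v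
  have h4 : star v ⬝ᵥ v = ((∑ k, ‖v k‖ ^ 2 : ℝ) : ℂ) := by
    simp only [dotProduct, Pi.star_apply, Complex.ofReal_sum]
    refine Finset.sum_congr rfl fun k _ => ?_
    rw [Complex.star_def, Complex.conj_mul']
    push_cast; rfl
  rw [h1, dotProduct_smul, h4, smul_eq_mul] at h3
  have h5 : z.im * ∑ k, ‖v k‖ ^ 2 = 0 := by
    have : RCLike.im (z * ((∑ k, ‖v k‖ ^ 2 : ℝ) : ℂ)) = z.im * ∑ k, ‖v k‖ ^ 2 :=
      Complex.im_mul_ofReal _ _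
    rw [← this]; exact h3
  have h6 := (mul_eq_zero.1 h5).resolve_left hz
  rw [Finset.sum_eq_zero_iff_of_nonneg fun k _ => sq_nonneg _] at h6
  exact hv0 (funext fun k => by simpa using h6 k (Finset.mem_univ k))

theorem res_mul_shift (hA : A.IsHermitian) (hz : z.im ≠ 0) : res A z * shift A z = 1 :=
  Matrix.nonsing_inv_mul _ (isUnit_det_shift hA hz)

theorem shift_mul_res (hA : A.IsHermitian) (hz : z.im ≠ 0) : shift A z * res A z = 1 :=
  Matrix.mul_nonsing_inv _ (isUnit_det_shift hA hz)

theorem res_sub_res (hA : A.IsHermitian) (hB : B.IsHermitian) (hz : z.im ≠ 0) (hw : w.im ≠ 0) :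
    res A z - res B w = res A z * (shift B w - shift A z) * res B w := by
  rw [Matrix.mul_sub, Matrix.sub_mul, Matrix.mul_assoc, shift_mul_res hB hw, Matrix.mul_one,
    res_mul_shift hA hz, Matrix.one_mul]

theorem shift_transpose (hA : A.IsHermitian) : (shift A z)ᵀ = shift A z := by
  ext k l
  have := hA.apply k l
  simp only [star_trivial] at this
  simp only [transpose_apply, shift_apply, this, eq_comm]

theorem res_symm (hA : A.IsHermitian) (k l : Fin N) : res A z k l = res A z l k := by
  have : (res A z)ᵀ = res A z := by
    rw [res, transpose_nonsing_inv, shift_transpose hA]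
  conv_lhs => rw [← this]
  rfl

theorem shift_conjTranspose (hA : A.IsHermitian) : (shift A z)ᴴ = shift A (conj z) := by
  ext k l
  have := hA.apply k l
  simp only [star_trivial] at this
  simp only [conjTranspose_apply, shift_apply, this, star_sub]
  by_cases hkl : k = l
  · simp [hkl]
  · simp [hkl, Ne.symm hkl]

theorem res_conj (hA : A.IsHermitian) : res A (conj z) = (res A z)ᴴ := by
  rw [res, res, conjTranspose_nonsing_inv, shift_conjTranspose hA]

theorem res_sub_res_self (hA : A.IsHermitian) (hz : z.im ≠ 0) (hw : w.im ≠ 0) :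
    res A z - res A w = (z - w) • (res A z * res A w) := by
  rw [res_sub_res hA hA hz hw]
  have : shift A w - shift A z = (z - w) • 1 := by
    simp only [shift, sub_smul]; abel
  rw [this, Matrix.mul_smul, Matrix.mul_one, Matrix.smul_mul]

/-- Ward's identity. -/
theorem sum_norm_sq_res (hA : A.IsHermitian) (hz : z.im ≠ 0) (k : Fin N) :
    ∑ l, ‖res A z k l‖ ^ 2 = (res A z k k).im / z.im := by
  have hzc : (conj z).im ≠ 0 := by simpa using hz
  have h1 := congrFun (congrFun (res_sub_res_self hA hz hzc) k) k
  rw [res_conj hA] at h1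
  simp only [Matrix.sub_apply, Matrix.smul_apply, Matrix.mul_apply, conjTranspose_apply,
    smul_eq_mul] at h1
  have h2 : ∑ l, res A z k l * star (res A z k l) = ((∑ l, ‖res A z k l‖ ^ 2 : ℝ) : ℂ) := by
    rw [Complex.ofReal_sum]
    refine Finset.sum_congr rfl fun l _ => ?_
    rw [Complex.star_def, Complex.mul_conj']
    push_cast; rfl
  rw [h2] at h1
  have h3 := congrArg Complex.im h1
  rw [Complex.im_mul_ofReal] at h3
  simp at h3
  rw [eq_div_iff hz]
  linarith

theorem im_res_nonneg (hA : A.IsHermitian) (hz : 0 < z.im) (k : Fin N) : 0 ≤ (res A z k k).im := by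
  have h1 := sum_norm_sq_res hA hz.ne' k
  have h2 : 0 ≤ ∑ l, ‖res A z k l‖ ^ 2 := Finset.sum_nonneg fun l _ => sq_nonneg _
  rw [h1] at h2
  by_contra hcon
  exact absurd h2 (not_le.2 (div_neg_of_neg_of_pos (not_le.1 hcon) hz))

theorem im_res_le (hA : A.IsHermitian) (hz : 0 < z.im) (k : Fin N) :
    (res A z k k).im ≤ 1 / z.im := by
  have h1 := sum_norm_sq_res hA hz.ne' k
  have h2 : ‖res A z k k‖ ^ 2 ≤ ∑ l, ‖res A z k l‖ ^ 2 :=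
    Finset.single_le_sum (f := fun l => ‖res A z k l‖ ^ 2) (fun l _ => sq_nonneg _)
      (Finset.mem_univ k)
  have h3 : (res A z k k).im ≤ ‖res A z k k‖ := (le_abs_self _).trans (Complex.abs_im_le_norm _)
  have h0 := im_res_nonneg hA hz k
  rw [h1] at h2
  have h4 : (res A z k k).im * (res A z k k).im ≤ (res A z k k).im * (1 / z.im) := by
    calc _ ≤ ‖res A z k k‖ ^ 2 := by nlinarith
      _ ≤ _ := h2
      _ = _ := by ring
  rcases h0.eq_or_lt with h | h
  · rw [← h]; positivity
  · exact le_of_mul_le_mul_left h4 h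

theorem norm_res_le (hA : A.IsHermitian) (hz : 0 < z.im) (k l : Fin N) :
    ‖res A z k l‖ ≤ 1 / z.im := by
  have h1 := sum_norm_sq_res hA hz.ne' k
  have h2 : ‖res A z k l‖ ^ 2 ≤ ∑ l, ‖res A z k l‖ ^ 2 :=
    Finset.single_le_sum (f := fun l => ‖res A z k l‖ ^ 2) (fun l _ => sq_nonneg _)
      (Finset.mem_univ l)
  have h3 : (res A z k k).im / z.im ≤ (1 / z.im) / z.im := by
    have := im_res_le hA hz k; gcongr
  refine abs_le_of_sq_le_sq' (a := ‖res A z k l‖) ?_ (by positivity) |>.2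
  calc _ ≤ _ := h2
    _ = _ := h1
    _ ≤ _ := h3
    _ = _ := by field_simp

/-- Moving the spectral parameter towards the real axis by a factor of two at most doubles the
entries of the resolvent. -/
theorem entryNorm_res_le_two_mul (hA : A.IsHermitian) (hz : 0 < z.im) (hre : w.re = z.re)
    (him : w.im = 2 * z.im) : entryNorm (res A z) ≤ 2 * entryNorm (res A w) := by
  have hΓ := entryNorm_nonneg (res A z)
  have hΓ' := entryNorm_nonneg (res A w)
  have hΓk := norm_le_entryNorm (res A z)
  have hΓk' := norm_le_entryNorm (res A w)
  have hmain : (∀ k l, ‖res A z k l‖ ≤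
      entryNorm (res A w) + √(entryNorm (res A z) * entryNorm (res A w) / 2)) →
      entryNorm (res A z) ≤
        entryNorm (res A w) + √(entryNorm (res A z) * entryNorm (res A w) / 2) :=
    entryNorm_le (by positivity)
  generalize entryNorm (res A z) = Γ at *
  generalize entryNorm (res A w) = Γ' at *
  have hw : 0 < w.im := by rw [him]; positivity
  have hzw : ‖z - w‖ = z.im := by
    -- In the resolvent identity `G(z) = G(w) + (z - w) G(z) G(w)`, the product is bounded by
    -- Cauchy–Schwarz and Ward's identity at both points. This yields `Γ ≤ Γ' + √(Γ Γ'/2)`, which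
    -- forces `Γ ≤ 2 Γ'`.
    have : z - w = ((-z.im : ℝ) : ℂ) * Complex.I := by
      apply Complex.ext <;> simp [hre, him]; ring
    rw [this, norm_mul, Complex.norm_I, mul_one, Complex.norm_real, norm_neg,
      Real.norm_of_nonneg hz.le]
  have hent : ∀ k l, ‖res A z k l‖ ≤ Γ' + √(Γ * Γ' / 2) := by
    intro k l
    have h1 := congrFun (congrFun (res_sub_res_self hA hz.ne' hw.ne') k) l
    simp only [Matrix.sub_apply, Matrix.smul_apply, Matrix.mul_apply, smul_eq_mul] at h1
    have h2 : ‖∑ j, res A z k j * res A w j l‖ ≤ √(Γ / z.im) * √(Γ' / w.im) := by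
      calc ‖∑ j, res A z k j * res A w j l‖ ≤ ∑ j, ‖res A z k j‖ * ‖res A w j l‖ :=
            (norm_sum_le _ _).trans (Finset.sum_le_sum fun j _ => (norm_mul_le _ _))
        _ ≤ √(∑ j, ‖res A z k j‖ ^ 2) * √(∑ j, ‖res A w j l‖ ^ 2) :=
            Real.sum_mul_le_sqrt_mul_sqrt _ _ _
        _ ≤ _ := by
            have e1 : ∑ j, ‖res A w j l‖ ^ 2 = (res A w l l).im / w.im := by
              rw [← sum_norm_sq_res hA hw.ne' l]
              exact Finset.sum_congr rfl fun j _ => by rw [res_symm hA]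
            rw [e1, sum_norm_sq_res hA hz.ne' k]
            have e2 : (res A z k k).im ≤ Γ :=
              ((le_abs_self _).trans (Complex.abs_im_le_norm _)).trans (hΓk k k)
            have e3 : (res A w l l).im ≤ Γ' :=
              ((le_abs_self _).trans (Complex.abs_im_le_norm _)).trans (hΓk' l l)
            gcongr
    have h3 : z.im * (√(Γ / z.im) * √(Γ' / w.im)) = √(Γ * Γ' / 2) := by
      rw [← Real.sqrt_mul (by positivity)]
      have : Γ / z.im * (Γ' / w.im) = (Γ * Γ' / 2) / z.im ^ 2 := by
        rw [him]; field_simp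
      rw [this, Real.sqrt_div (by positivity), Real.sqrt_sq hz.le]
      field_simp
    calc ‖res A z k l‖ = ‖res A w k l + (z - w) * ∑ j, res A z k j * res A w j l‖ := by
          rw [← h1]; congr 1; ring
      _ ≤ ‖res A w k l‖ + ‖z - w‖ * ‖∑ j, res A z k j * res A w j l‖ :=
          (norm_add_le _ _).trans (by rw [norm_mul])
      _ ≤ Γ' + z.im * (√(Γ / z.im) * √(Γ' / w.im)) := by
          rw [hzw]
          exact add_le_add (hΓk' k l) (mul_le_mul_of_nonneg_left h2 hz.le)
      _ = _ := by rw [h3]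
  replace hmain := hmain hent
  by_contra hcon
  rw [not_le] at hcon
  have h4 : √(Γ * Γ' / 2) < Γ / 2 := by
    rw [Real.sqrt_lt' (by linarith)]
    nlinarith
  linarith

end Resolvent

/-! ### Minors and Schur complements -/

section Minor

variable {A : Matrix (Fin N) (Fin N) ℝ} {z : ℂ}

/-- The matrix `A` with its `i`-th row and column set to zero. -/
def minor (A : Matrix (Fin N) (Fin N) ℝ) (i : Fin N) : Matrix (Fin N) (Fin N) ℝ :=
  fun k l => if k = i ∨ l = i then 0 else A k l

/-- The `i`-th row of `A`, without its diagonal entry. -/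
def offRow (A : Matrix (Fin N) (Fin N) ℝ) (i : Fin N) : Fin N → ℝ :=
  fun k => if k = i then 0 else A i k

theorem minor_isHermitian (hA : A.IsHermitian) (i : Fin N) : (minor A i).IsHermitian := by
  refine Matrix.IsHermitian.ext fun k l => ?_
  have := hA.apply k l
  simp only [star_trivial] at this
  simp only [star_trivial, minor, this, or_comm]

/-- Zeroing a row and column, instead of deleting them, keeps the dimension `N`. The shifted minor
then decouples, with the single entry `-z` in column `i`. -/
theorem res_minor_of_ne (hA : A.IsHermitian) (hz : z.im ≠ 0) {i k : Fin N} (hk : k ≠ i) :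
    res (minor A i) z k i = 0 := by
  have h1 := congrFun (congrFun (res_mul_shift (minor_isHermitian hA i) hz) k) i
  rw [Matrix.mul_apply, Matrix.one_apply_ne hk] at h1
  have h2 : ∀ j, shift (minor A i) z j i = if j = i then -z else 0 := by
    intro j
    rw [shift_apply]
    by_cases hj : j = i <;> simp [minor, hj]
  simp only [h2, mul_ite, mul_zero, Finset.sum_ite_eq', Finset.mem_univ, if_true] at h1
  have hz0 : z ≠ 0 := fun e => hz (by simp [e])
  rcases mul_eq_zero.1 h1 with h | h
  · exact h
  · exact absurd (neg_eq_zero.1 h) hz0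

/-- Schur complement formula off the removed index. -/
theorem res_eq_res_minor_sub (hA : A.IsHermitian) (hz : z.im ≠ 0) {i k : Fin N} (hk : k ≠ i)
    (l : Fin N) : res A z k l = res (minor A i) z k l -
      (∑ j, res (minor A i) z k j * offRow A i j) * res A z i l := by
  have h1 := congrFun (congrFun (res_sub_res (minor_isHermitian hA i) hA hz hz) k) l
  rw [Matrix.mul_assoc, Matrix.sub_apply, Matrix.mul_apply] at h1
  have h2 : ∀ j, res (minor A i) z k j * ((shift A z - shift (minor A i) z) * res A z) j l =
      res (minor A i) z k j * offRow A i j * res A z i l := by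
    intro j
    by_cases hj : j = i
    · subst hj
      rw [res_minor_of_ne hA hz hk]; simp
    · have h3 : ∀ p, (shift A z - shift (minor A i) z) j p = if p = i then (offRow A i j : ℂ) else 0 := by
        intro p
        rw [Matrix.sub_apply, shift_apply, shift_apply]
        have := hA.apply i j
        simp only [star_trivial] at this
        by_cases hp : p = i
        · simp [minor, offRow, hj, hp, this]
        · simp [minor, hj, hp]
      rw [Matrix.mul_apply]
      simp only [h3, ite_mul, zero_mul, Finset.sum_ite_eq', Finset.mem_univ, if_true]
      ring
  simp only [h2] at h1
  rw [← Finset.sum_mul] at h1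
  rw [← h1]; ring

/-- Schur complement formula for the removed diagonal entry. -/
theorem res_diag_mul (hA : A.IsHermitian) (hz : z.im ≠ 0) (i : Fin N) :
    res A z i i * (A i i - z - ∑ k, ∑ l, offRow A i k * res (minor A i) z k l * offRow A i l) =
      1 := by
  have h1 := congrFun (congrFun (shift_mul_res hA hz) i) i
  rw [Matrix.mul_apply, Matrix.one_apply_eq] at h1
  have h2 : ∀ k, shift A z i k * res A z k i = (if k = i then (A i i - z) * res A z i i else 0) -
      (∑ l, offRow A i k * res (minor A i) z k l * offRow A i l) * res A z i i := by
    intro k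
    by_cases hk : k = i
    · subst hk; simp [shift_apply, offRow]
    · rw [res_eq_res_minor_sub hA hz hk i, res_minor_of_ne hA hz hk, shift_apply]
      simp only [hk, Ne.symm hk, if_false, sub_zero, zero_sub, mul_neg, Finset.sum_mul]
      rw [Finset.mul_sum]
      congr 1
      refine Finset.sum_congr rfl fun l _ => ?_
      have : offRow A i k = A i k := by simp [offRow, hk]
      rw [this]; ring
  simp only [h2, Finset.sum_sub_distrib, Finset.sum_ite_eq', Finset.mem_univ, if_true] at h1
  rw [← Finset.sum_mul] at h1
  rw [← h1]; ring

end Minor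

end SparseLocalLaw

namespace SparseLocalLaw

/-! ### The Stieltjes transform of the empirical eigenvalue measure -/

open Matrix ComplexConjugate

variable {N : ℕ}

/-- The normalized trace of the resolvent. -/
noncomputable def stieltjes (A : Matrix (Fin N) (Fin N) ℝ) (z : ℂ) : ℂ :=
  (N : ℂ)⁻¹ * ∑ k, res A z k k

/-! ### Rank-one perturbations -/

section Rank

variable {A B : Matrix (Fin N) (Fin N) ℝ} {z : ℂ}

/-- Ward's identity for the vector `y = G u`: pair `(A - z) y = u` with `y` and take imaginary
parts, where the Hermitian form of `A` drops out. -/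
theorem sum_norm_sq_res_mulVec (hA : A.IsHermitian) (hz : z.im ≠ 0) (u : Fin N → ℝ) :
    ∑ k, ‖∑ j, res A z k j * u j‖ ^ 2 = (∑ k, u k * ∑ j, res A z k j * u j).im / z.im := by
  set uc : Fin N → ℂ := fun k => u k with huc
  set y : Fin N → ℂ := res A z *ᵥ uc with hy
  have hyk : ∀ k, y k = ∑ j, res A z k j * u j := fun k => rfl
  have h1 : (A.map Complex.ofReal) *ᵥ y - z • y = uc := by
    have h2 : shift A z *ᵥ y = uc := by
      rw [hy, Matrix.mulVec_mulVec, shift_mul_res hA hz, Matrix.one_mulVec]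
    rwa [shift, Matrix.sub_mulVec, Matrix.smul_mulVec, Matrix.one_mulVec] at h2
  have h3 : ((star y) ⬝ᵥ ((A.map Complex.ofReal) *ᵥ y)).im = 0 :=
    (isHermitian_map_ofReal hA).im_star_dotProduct_mulVec_self y
  have h4 : star y ⬝ᵥ y = ((∑ k, ‖y k‖ ^ 2 : ℝ) : ℂ) := by
    simp only [dotProduct, Pi.star_apply, Complex.ofReal_sum]
    refine Finset.sum_congr rfl fun k _ => ?_
    rw [Complex.star_def, Complex.conj_mul']
    push_cast; rfl
  have h5 : star y ⬝ᵥ uc = conj (∑ k, u k * y k) := by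
    simp only [dotProduct, Pi.star_apply, map_sum, map_mul, Complex.conj_ofReal, huc,
      Complex.star_def]
    exact Finset.sum_congr rfl fun k _ => mul_comm _ _
  have h6 := congrArg Complex.im (congrArg (fun v => star y ⬝ᵥ v) h1)
  simp only [dotProduct_sub, dotProduct_smul, h4, h5, smul_eq_mul, Complex.sub_im, h3,
    Complex.im_mul_ofReal, Complex.conj_im] at h6
  simp only [← hyk]
  rw [eq_div_iff hz]
  linarith

/-- The hypothesis says `(1 - f β)(1 + f α) = 1`. The two factors are at least `f Im β` and `f Im α`
in absolute value. -/
theorem sq_mul_im_mul_im_le_one {α β : ℂ} {f : ℝ} (hf : 0 ≤ f) (hα : 0 ≤ α.im) (hβ : 0 ≤ β.im)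
    (h : β - α = -(f * β * α)) : f ^ 2 * (α.im * β.im) ≤ 1 := by
  have h1 : α * (1 - f * β) = β := by linear_combination -h
  have h2 : β * (1 + f * α) = α := by linear_combination h
  have h3 : f * β.im ≤ ‖1 - f * β‖ := by
    refine le_trans ?_ (Complex.abs_im_le_norm _)
    simp [abs_of_nonneg (mul_nonneg hf hβ)]
  have h4 : f * α.im ≤ ‖1 + f * α‖ := by
    refine le_trans ?_ (Complex.abs_im_le_norm _)
    simp [abs_of_nonneg (mul_nonneg hf hα)]
  have h5 : ‖α‖ * ‖1 - f * β‖ = ‖β‖ := by rw [← norm_mul, h1]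
  have h6 : ‖β‖ * ‖1 + f * α‖ = ‖α‖ := by rw [← norm_mul, h2]
  by_cases h0 : α = 0
  · simp [h0]
  · have hα0 : 0 < ‖α‖ := norm_pos_iff.2 h0
    have h7 : ‖1 - f * β‖ * ‖1 + f * α‖ = 1 := by
      have : ‖α‖ * (‖1 - f * β‖ * ‖1 + f * α‖) = ‖α‖ * 1 := by
        rw [← mul_assoc, h5, h6, mul_one]
      exact mul_left_cancel₀ hα0.ne' this
    calc f ^ 2 * (α.im * β.im) = (f * β.im) * (f * α.im) := by ring
      _ ≤ ‖1 - f * β‖ * ‖1 + f * α‖ :=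
        mul_le_mul h3 h4 (mul_nonneg hf hα) (norm_nonneg _)
      _ = 1 := h7

/-- A nonnegative rank-one perturbation changes the trace of the resolvent by at most `1 / η`. -/
theorem norm_sum_res_add_rank_one_sub_le (hA : A.IsHermitian) (hB : B.IsHermitian)
    (hz : 0 < z.im) {f : ℝ} (hf : 0 ≤ f) (u : Fin N → ℝ) (hBA : ∀ k l, B k l = A k l + f * (u k * u l)) :
    ‖∑ k, res B z k k - ∑ k, res A z k k‖ ≤ 1 / z.im := by
  set x : Fin N → ℂ := fun k => ∑ j, res B z k j * u j with hx
  set y : Fin N → ℂ := fun k => ∑ j, res A z k j * u j with hy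
  have hent : ∀ k l, res B z k l - res A z k l = -(f * x k * y l) := by
    intro k l
    have h1 := congrFun (congrFun (res_sub_res hB hA hz.ne' hz.ne') k) l
    rw [Matrix.mul_assoc, Matrix.sub_apply, Matrix.mul_apply] at h1
    have h2 : ∀ j, ((shift A z - shift B z) * res A z) j l = -(f * u j * y l) := by
      intro j
      rw [Matrix.mul_apply, hy]
      simp only
      rw [Finset.mul_sum, ← Finset.sum_neg_distrib]
      refine Finset.sum_congr rfl fun p _ => ?_
      rw [Matrix.sub_apply, shift_apply, shift_apply, hBA, res_symm hA l p]
      push_cast; ring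
    have h3 : x k = ∑ j, res B z k j * u j := rfl
    generalize y l = c at h2 ⊢
    rw [h1, h3, Finset.mul_sum, Finset.sum_mul, ← Finset.sum_neg_distrib]
    refine Finset.sum_congr rfl fun j _ => ?_
    rw [h2]; ring
  set α : ℂ := ∑ k, u k * y k with hα
  set β : ℂ := ∑ k, u k * x k with hβ
  have hαβ : β - α = -(f * β * α) := by
    have h1 : ∀ k, x k - y k = -(f * x k * α) := by
      intro k
      have : x k - y k = ∑ j, (res B z k j - res A z k j) * u j := by
        simp only [hx, hy, sub_mul, Finset.sum_sub_distrib]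
      rw [this, hα, Finset.mul_sum, ← Finset.sum_neg_distrib]
      refine Finset.sum_congr rfl fun j _ => ?_
      rw [hent]; ring
    calc β - α = ∑ k, u k * (x k - y k) := by
          simp only [hβ, hα, mul_sub, Finset.sum_sub_distrib]
      _ = -(f * β * α) := by
          generalize α = c at h1 ⊢
          rw [hβ, Finset.mul_sum, Finset.sum_mul, ← Finset.sum_neg_distrib]
          refine Finset.sum_congr rfl fun k _ => ?_
          rw [h1]; ring
  have hyα : ∑ k, ‖y k‖ ^ 2 = α.im / z.im := sum_norm_sq_res_mulVec hA hz.ne' u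
  have hxβ : ∑ k, ‖x k‖ ^ 2 = β.im / z.im := sum_norm_sq_res_mulVec hB hz.ne' u
  have hnn : ∀ {w : Fin N → ℂ} {γ : ℂ}, ∑ k, ‖w k‖ ^ 2 = γ.im / z.im → 0 ≤ γ.im := by
    intro w γ h
    have h2 : 0 ≤ ∑ k, ‖w k‖ ^ 2 := Finset.sum_nonneg fun l _ => sq_nonneg _
    rw [h] at h2
    by_contra hcon
    exact absurd h2 (not_le.2 (div_neg_of_neg_of_pos (not_le.1 hcon) hz))
  have hα0 := hnn hyα
  have hβ0 := hnn hxβ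
  have h1 := sq_mul_im_mul_im_le_one hf hα0 hβ0 hαβ
  -- The trace difference is `-f ∑ x_k y_k`. Cauchy–Schwarz and Ward's identity bound it by `√(f² Im
  -- α Im β) / η`, which does not grow with `f`.
  rw [← Finset.sum_sub_distrib]
  simp only [hent]
  have h2 : ∑ k, -(f * x k * y k) = -(f * ∑ k, x k * y k) := by
    rw [Finset.mul_sum, ← Finset.sum_neg_distrib]
    exact Finset.sum_congr rfl fun k _ => by ring
  rw [h2, norm_neg, norm_mul, Complex.norm_real, Real.norm_of_nonneg hf]
  calc f * ‖∑ k, x k * y k‖ ≤ f * (√(∑ k, ‖x k‖ ^ 2) * √(∑ k, ‖y k‖ ^ 2)) := by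
        refine mul_le_mul_of_nonneg_left ?_ hf
        calc ‖∑ k, x k * y k‖ ≤ ∑ k, ‖x k‖ * ‖y k‖ :=
              (norm_sum_le _ _).trans (Finset.sum_le_sum fun j _ => (norm_mul_le _ _))
          _ ≤ _ := Real.sum_mul_le_sqrt_mul_sqrt _ _ _
    _ = √(f ^ 2 * (α.im * β.im)) / z.im := by
        rw [hxβ, hyα, ← Real.sqrt_mul (by positivity)]
        have e1 : β.im / z.im * (α.im / z.im) = (α.im * β.im) / z.im ^ 2 := by field_simp
        rw [e1, Real.sqrt_div (by positivity), Real.sqrt_sq hz.le, Real.sqrt_mul (sq_nonneg f),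
          Real.sqrt_sq hf]
        ring
    _ ≤ 1 / z.im := by
        gcongr
        exact Real.sqrt_le_one.2 h1

end Rank

/-! ### The trace in terms of eigenvalues -/

section Trace

variable {A : Matrix (Fin N) (Fin N) ℝ} {z : ℂ}

theorem sum_res_diag_eq (hA : A.IsHermitian) (hz : z.im ≠ 0) :
    ∑ k, res A z k k = ∑ i, ((hA.eigenvalues i : ℂ) - z)⁻¹ := by
  set U : Matrix (Fin N) (Fin N) ℝ := (hA.eigenvectorUnitary : Matrix (Fin N) (Fin N) ℝ) with hU
  set V : Matrix (Fin N) (Fin N) ℂ := U.map Complex.ofReal with hV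
  set W : Matrix (Fin N) (Fin N) ℂ := (star U).map Complex.ofReal with hW
  have hmul : ∀ M M' : Matrix (Fin N) (Fin N) ℝ,
      (M * M').map Complex.ofReal = M.map Complex.ofReal * M'.map Complex.ofReal := fun M M' =>
    Matrix.map_mul (f := Complex.ofRealHom)
  have hone : (1 : Matrix (Fin N) (Fin N) ℝ).map Complex.ofReal = 1 :=
    Matrix.map_one _ Complex.ofReal_zero Complex.ofReal_one
  have hVW : V * W = 1 := by
    rw [hV, hW, ← hmul, hU, Unitary.mul_star_self_of_mem hA.eigenvectorUnitary.2, hone]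
  have hWV : W * V = 1 := by
    rw [hV, hW, ← hmul, hU, Unitary.star_mul_self_of_mem hA.eigenvectorUnitary.2, hone]
  set d : Fin N → ℂ := fun i => (hA.eigenvalues i : ℂ) - z with hd
  have hd0 : ∀ i, d i ≠ 0 := by
    intro i h0
    have := congrArg Complex.im h0
    simp [hd] at this
    exact hz this
  have hsh : shift A z = V * diagonal d * W := by
    have h1 : A.map Complex.ofReal = V * diagonal (fun i => (hA.eigenvalues i : ℂ)) * W := by
      have h2 := congrArg (fun M => M.map Complex.ofReal) hA.spectral_theorem
      simp only [Unitary.conjStarAlgAut_apply] at h2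
      rw [hmul, hmul] at h2
      rw [h2]
      congr 2
      ext i j
      by_cases hij : i = j <;> simp [hij]
    have h3 : z • (1 : Matrix (Fin N) (Fin N) ℂ) = V * (z • 1) * W := by
      rw [Matrix.mul_smul, Matrix.mul_one, Matrix.smul_mul, hVW]
    rw [shift, h1, h3, ← Matrix.sub_mul, ← Matrix.mul_sub]
    congr 2
    ext i j
    by_cases hij : i = j <;> simp [hd, hij]
  have hres : res A z = V * diagonal (fun i => (d i)⁻¹) * W := by
    refine Matrix.inv_eq_right_inv ?_
    rw [hsh]
    calc V * diagonal d * W * (V * diagonal (fun i => (d i)⁻¹) * W)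
        = V * diagonal d * (W * V) * diagonal (fun i => (d i)⁻¹) * W := by
          simp only [Matrix.mul_assoc]
      _ = V * (diagonal d * diagonal (fun i => (d i)⁻¹)) * W := by
          rw [hWV, Matrix.mul_one, Matrix.mul_assoc V]
      _ = 1 := by
          rw [diagonal_mul_diagonal]
          simp only [mul_inv_cancel₀ (hd0 _), diagonal_one, Matrix.mul_one, hVW]
  have htr : (res A z).trace = (diagonal fun i => (d i)⁻¹).trace := by
    rw [hres, Matrix.trace_mul_comm, ← Matrix.mul_assoc, hWV, Matrix.one_mul]
  simpa [Matrix.trace, hd] using htr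

theorem im_inv_ofReal_sub (x E η : ℝ) :
    (((x : ℂ) - (E + η * Complex.I))⁻¹).im = η / ((x - E) ^ 2 + η ^ 2) := by
  rw [Complex.inv_im, Complex.normSq_apply]
  simp
  congr 1
  ring

theorem im_stieltjes_eq (hA : A.IsHermitian) (E : ℝ) {η : ℝ} (hη : η ≠ 0) :
    (stieltjes A (E + η * Complex.I)).im =
      (N : ℝ)⁻¹ * ∑ i, η / ((hA.eigenvalues i - E) ^ 2 + η ^ 2) := by
  rw [stieltjes, sum_res_diag_eq hA (by simpa using hη)]
  have : ((N : ℂ)⁻¹) = (((N : ℝ)⁻¹ : ℝ) : ℂ) := by push_cast; rfl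
  rw [this, Complex.im_ofReal_mul, Complex.im_sum]
  simp only [im_inv_ofReal_sub]

theorem im_stieltjes_nonneg (hA : A.IsHermitian) (hz : 0 < z.im) : 0 ≤ (stieltjes A z).im := by
  have : ((N : ℂ)⁻¹) = (((N : ℝ)⁻¹ : ℝ) : ℂ) := by push_cast; rfl
  rw [stieltjes, this, Complex.im_ofReal_mul, Complex.im_sum]
  exact mul_nonneg (by positivity) (Finset.sum_nonneg fun k _ => im_res_nonneg hA hz k)

theorem norm_stieltjes_le_entryNorm : ‖stieltjes A z‖ ≤ entryNorm (res A z) := by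
  rw [stieltjes, norm_mul, norm_inv, Complex.norm_natCast]
  rcases Nat.eq_zero_or_pos N with h0 | h0
  · subst h0; simpa using entryNorm_nonneg _
  · rw [inv_mul_le_iff₀ (by positivity)]
    refine (norm_sum_le _ _).trans ((Finset.sum_le_sum fun k _ =>
      norm_le_entryNorm (res A z) k k).trans ?_)
    simp

end Trace

end SparseLocalLaw

namespace SparseLocalLaw

/-! ### Self-consistent equation and bootstrap in the spectral scale -/

open Matrix ComplexConjugate

variable {N : ℕ} {A : Matrix (Fin N) (Fin N) ℝ} {z : ℂ} {ε : ℝ}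

/-- The resolvent of the `i`-th minor, with its `i`-th row and column set to zero. -/
noncomputable def minorRes (A : Matrix (Fin N) (Fin N) ℝ) (z : ℂ) (i : Fin N) :
    Matrix (Fin N) (Fin N) ℂ :=
  fun k l => if k = i ∨ l = i then 0 else res (minor A i) z k l

/-- The linear and quadratic forms of the `i`-th row of `A` in the resolvent of the `i`-th minor are
`ε`-close to their means, relative to the size of that resolvent. -/
structure RowConcentrated (A : Matrix (Fin N) (Fin N) ℝ) (z : ℂ) (ε : ℝ) (i : Fin N) : Prop where
  diag : |A i i| ≤ ε
  linear : ∀ k, ‖∑ l, minorRes A z i k l * offRow A i l‖ ≤ ε * max 1 (entryNorm (minorRes A z i))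
  quadratic : ‖∑ k, ∑ l, offRow A i k * minorRes A z i k l * offRow A i l -
    (N : ℂ)⁻¹ * ∑ k, minorRes A z i k k‖ ≤ ε * max 1 (entryNorm (minorRes A z i))

theorem sum_res_minor_mul_offRow {i k : Fin N} (hk : k ≠ i) :
    ∑ l, res (minor A i) z k l * offRow A i l = ∑ l, minorRes A z i k l * offRow A i l := by
  refine Finset.sum_congr rfl fun l _ => ?_
  by_cases hl : l = i
  · simp [offRow, hl]
  · simp [minorRes, hk, hl]

theorem sum_sum_res_minor_mul_offRow {i : Fin N} :
    ∑ k, ∑ l, offRow A i k * res (minor A i) z k l * offRow A i l =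
      ∑ k, ∑ l, offRow A i k * minorRes A z i k l * offRow A i l := by
  refine Finset.sum_congr rfl fun k _ => Finset.sum_congr rfl fun l _ => ?_
  by_cases hk : k = i
  · simp [offRow, hk]
  by_cases hl : l = i
  · simp [offRow, hl]
  · simp [minorRes, hk, hl]

theorem RowConcentrated.entryNorm_le (hA : A.IsHermitian) (hz : z.im ≠ 0) {i : Fin N}
    (h : RowConcentrated A z ε i) {B : ℝ} (hB1 : 1 ≤ B) (hBε : B * ε ≤ 1 / 2)
    (hB : entryNorm (res A z) ≤ B) : max 1 (entryNorm (minorRes A z i)) ≤ 2 * B := by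
  set M := max 1 (entryNorm (minorRes A z i)) with hM
  have hM1 : 1 ≤ M := le_max_left _ _
  have hε : 0 ≤ ε := (abs_nonneg _).trans h.diag
  have h1 : entryNorm (minorRes A z i) ≤ B + ε * M * B := by
    refine SparseLocalLaw.entryNorm_le (by positivity) fun k l => ?_
    -- By Schur, `G⁽ⁱ⁾` exceeds `G` by at most `ε M B ≤ M/2`, where `M` is its own size. This term
    -- is absorbed on the left.
    by_cases hkl : k = i ∨ l = i
    · simp only [minorRes, hkl, if_true, norm_zero]; positivity
    · have h2 := res_eq_res_minor_sub hA hz (fun e => hkl (Or.inl e)) l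
      rw [sum_res_minor_mul_offRow (fun e => hkl (Or.inl e))] at h2
      simp only [minorRes, hkl, if_false]
      rw [eq_comm, sub_eq_iff_eq_add] at h2
      rw [h2]
      refine (norm_add_le _ _).trans (add_le_add ((norm_le_entryNorm _ k l).trans hB) ?_)
      rw [norm_mul]
      exact mul_le_mul (h.linear k) ((norm_le_entryNorm _ i l).trans hB) (norm_nonneg _)
        (by positivity)
  rcases le_total (entryNorm (minorRes A z i)) 1 with h2 | h2
  · rw [hM, max_eq_left h2]; linarith
  · have h3 : M = entryNorm (minorRes A z i) := max_eq_right h2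
    rw [← h3] at h1
    nlinarith

theorem RowConcentrated.norm_res_le (hA : A.IsHermitian) (hz : z.im ≠ 0) {i : Fin N}
    (h : RowConcentrated A z ε i) {B : ℝ} (hB1 : 1 ≤ B) (hBε : B * ε ≤ 1 / 2)
    (hB : entryNorm (res A z) ≤ B) {k : Fin N} (hk : k ≠ i) : ‖res A z k i‖ ≤ ‖res A z i i‖ := by
  have h1 := res_eq_res_minor_sub hA hz hk i
  rw [res_minor_of_ne hA hz hk, zero_sub, sum_res_minor_mul_offRow hk] at h1
  have hε : 0 ≤ ε := (abs_nonneg _).trans h.diag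
  rw [h1, norm_neg, norm_mul]
  refine mul_le_of_le_one_left (norm_nonneg _) ((h.linear k).trans ?_)
  calc _ ≤ ε * (2 * B) := mul_le_mul_of_nonneg_left (h.entryNorm_le hA hz hB1 hBε hB) hε
    _ ≤ 1 := by linarith

/-- Approximate self-consistent equation for the diagonal entries of the resolvent. -/
theorem RowConcentrated.exists_error (hA : A.IsHermitian) (hz : z.im ≠ 0) {i : Fin N}
    (h : RowConcentrated A z ε i) {B : ℝ} (hB1 : 1 ≤ B) (hBε : B * ε ≤ 1 / 2)
    (hB : entryNorm (res A z) ≤ B) (hNε : (N : ℝ)⁻¹ ≤ ε) :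
    ∃ e : ℂ, ‖e‖ ≤ 6 * B ^ 2 * ε ∧ res A z i i * (z + stieltjes A z + e) = -1 := by
  have hM := h.entryNorm_le hA hz hB1 hBε hB
  have hε : 0 ≤ ε := (abs_nonneg _).trans h.diag
  have hN : 0 < (N : ℝ) := by
    have := i.pos
    positivity
  set M := max 1 (entryNorm (minorRes A z i)) with hMdef
  have hM0 : 0 ≤ M := zero_le_one.trans (le_max_left _ _)
  set Q := ∑ k, ∑ l, offRow A i k * minorRes A z i k l * offRow A i l with hQ
  -- The six units of `B² ε` are: two from the quadratic form, three from replacing the minor's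
  -- trace by that of `A` (including the missing index `i`), and one from the diagonal entry.
  refine ⟨Q - A i i - stieltjes A z, ?_, ?_⟩
  · have htr : ‖(N : ℂ)⁻¹ * ∑ k, minorRes A z i k k - stieltjes A z‖ ≤ ε * M * B + ε * B := by
      rw [stieltjes, ← mul_sub, ← Finset.sum_sub_distrib, norm_mul, norm_inv,
        Complex.norm_natCast]
      have hterm : ∀ k, ‖minorRes A z i k k - res A z k k‖ ≤ ε * M * B + if k = i then B else 0 := by
        intro k
        by_cases hk : k = i
        · subst hk
          simp only [minorRes, true_or, if_true, zero_sub, norm_neg]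
          have := (norm_le_entryNorm (res A z) k k).trans hB
          have : 0 ≤ ε * M * B := by positivity
          linarith
        · simp only [minorRes, hk, or_self, if_false, add_zero]
          rw [res_eq_res_minor_sub hA hz hk k, sub_sub_cancel, sum_res_minor_mul_offRow hk, norm_mul]
          exact mul_le_mul (h.linear k) ((norm_le_entryNorm _ i k).trans hB) (norm_nonneg _)
            (by positivity)
      have hsum : ‖∑ k, (minorRes A z i k k - res A z k k)‖ ≤ N * (ε * M * B) + B := by
        refine (norm_sum_le _ _).trans ((Finset.sum_le_sum fun k _ => hterm k).trans (le_of_eq ?_))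
        rw [Finset.sum_add_distrib]; simp
      calc (N : ℝ)⁻¹ * ‖∑ k, (minorRes A z i k k - res A z k k)‖
          ≤ (N : ℝ)⁻¹ * (N * (ε * M * B) + B) := mul_le_mul_of_nonneg_left hsum (by positivity)
        _ = ε * M * B + (N : ℝ)⁻¹ * B := by field_simp
        _ ≤ _ := by gcongr
    have h1 : Q - A i i - stieltjes A z = (Q - (N : ℂ)⁻¹ * ∑ k, minorRes A z i k k) +
        ((N : ℂ)⁻¹ * ∑ k, minorRes A z i k k - stieltjes A z) + -(A i i : ℂ) := by ring
    rw [h1]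
    have h2 : ‖-(A i i : ℂ)‖ ≤ ε := by
      rw [norm_neg, Complex.norm_real]; exact h.diag
    have h3 := h.quadratic
    have h4 : ε * M ≤ ε * (2 * B) := mul_le_mul_of_nonneg_left hM hε
    have h5 : ε * M * B ≤ ε * (2 * B) * B := mul_le_mul_of_nonneg_right h4 (by linarith)
    have h6 : ε ≤ ε * B ^ 2 := le_mul_of_one_le_right hε (one_le_pow₀ hB1)
    have h7 : ε * B ≤ ε * B ^ 2 := mul_le_mul_of_nonneg_left (by nlinarith) hε
    have h8 := norm_add₃_le (a := Q - (N : ℂ)⁻¹ * ∑ k, minorRes A z i k k)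
      (b := (N : ℂ)⁻¹ * ∑ k, minorRes A z i k k - stieltjes A z) (c := -(A i i : ℂ))
    linarith
  · have h1 := res_diag_mul hA hz i
    rw [sum_sum_res_minor_mul_offRow] at h1
    linear_combination -h1

end SparseLocalLaw

/-! ### Bootstrap across scales and stability of the semicircle equation -/

namespace SparseLocalLaw

open Matrix ComplexConjugate

variable {N : ℕ} {A : Matrix (Fin N) (Fin N) ℝ} {z : ℂ} {ε : ℝ}

/-- The bound on the entries of the resolvent that is propagated in the bootstrap. -/
noncomputable def entryBound (E : ℝ) : ℝ := if |E| < 4 then 8 else 1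

theorem one_le_entryBound (E : ℝ) : 1 ≤ entryBound E := by
  unfold entryBound; split_ifs <;> norm_num

theorem entryBound_le (E : ℝ) : entryBound E ≤ 8 := by
  unfold entryBound; split_ifs <;> norm_num

/-- Averaging `G_ii (z + m) + 1 = -e_i G_ii` over `i` closes the equation in `m` alone. -/
theorem norm_stieltjes_mul_add_one_le {e : Fin N → ℂ} {B b : ℝ} (hN : 0 < N)
    (hB : entryNorm (res A z) ≤ B) (hb : 0 ≤ b) (he : ∀ i, ‖e i‖ ≤ b)
    (h : ∀ i, res A z i i * (z + stieltjes A z + e i) = -1) :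
    ‖stieltjes A z * (z + stieltjes A z) + 1‖ ≤ b * B := by
  have hN' : (N : ℂ) ≠ 0 := by exact_mod_cast hN.ne'
  have h1 : stieltjes A z * (z + stieltjes A z) + 1 =
      (N : ℂ)⁻¹ * ∑ i, -(e i * res A z i i) := by
    have h2 : ∀ i, -(e i * res A z i i) = res A z i i * (z + stieltjes A z) + 1 := fun i => by
      linear_combination -(h i)
    simp only [h2, Finset.sum_add_distrib, ← Finset.sum_mul]
    have h3 : (N : ℂ)⁻¹ * ∑ i, res A z i i = stieltjes A z := rfl
    rw [mul_add (N : ℂ)⁻¹, ← mul_assoc (N : ℂ)⁻¹, h3]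
    simp [hN']
  have hN0 : (0 : ℝ) < N := by exact_mod_cast hN
  rw [h1, norm_mul, norm_inv, Complex.norm_natCast, inv_mul_le_iff₀ hN0]
  refine (norm_sum_le _ _).trans ((Finset.sum_le_sum (g := fun _ => b * B) fun i _ => ?_).trans ?_)
  · rw [norm_neg, norm_mul]
    exact mul_le_mul (he i) ((norm_le_entryNorm _ i i).trans hB) (norm_nonneg _) hb
  · simp

/-- One step of the bootstrap: an a priori bound on the entries of the resolvent improves by a
factor of two. -/
theorem entryNorm_le_entryBound (hA : A.IsHermitian) (hz : 0 < z.im) (hz1 : z.im ≤ 1)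
    (hε : ε ≤ 1 / 10 ^ 7) (hN0 : 0 < N) (hNε : (N : ℝ)⁻¹ ≤ ε)
    (h : ∀ i, RowConcentrated A z ε i) (hB : entryNorm (res A z) ≤ 2 * entryBound z.re) :
    entryNorm (res A z) ≤ entryBound z.re ∧
      ‖stieltjes A z * (z + stieltjes A z) + 1‖ ≤ 24576 * ε := by
  have hε0 : 0 ≤ ε := (by positivity : (0 : ℝ) ≤ (N : ℝ)⁻¹).trans hNε
  set m := stieltjes A z with hm
  set B := 2 * entryBound z.re with hBdef
  have hb1 := one_le_entryBound z.re
  have hb8 := entryBound_le z.re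
  have hBε : B * ε ≤ 1 / 2 := by
    have : B ≤ 16 := by linarith
    nlinarith
  have hB1 : 1 ≤ B := by linarith
  choose e he heq using fun i => (h i).exists_error hA hz.ne' hB1 hBε hB hNε
  have hζ : ‖m * (z + m) + 1‖ ≤ 6 * B ^ 2 * ε * B :=
    norm_stieltjes_mul_add_one_le hN0 hB (by positivity) he heq
  have hB3 : B ^ 3 ≤ 16 ^ 3 := pow_le_pow_left₀ (by linarith) (by linarith) 3
  have hB2 : B ^ 2 ≤ 16 ^ 2 := pow_le_pow_left₀ (by linarith) (by linarith) 2
  -- The constant is `6 · 16³`, as `B ≤ 16`.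
  have hζ' : ‖m * (z + m) + 1‖ ≤ 24576 * ε := hζ.trans (by nlinarith)
  have he' : ∀ i, ‖e i‖ ≤ 1 / 1000 := fun i => (he i).trans (by nlinarith)
  have hmB : ‖m‖ ≤ B := norm_stieltjes_le_entryNorm.trans hB
  have hdiag : ∀ i, ‖res A z i i‖ ≤ entryBound z.re := by
    intro i
    have h1 : ‖res A z i i‖ * ‖z + m + e i‖ = 1 := by
      rw [← norm_mul, heq i, norm_neg, norm_one]
    have h2 : ‖z + m‖ ≤ ‖z + m + e i‖ + 1 / 1000 := by
      have := norm_sub_le (z + m + e i) (e i)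
      rw [add_sub_cancel_right] at this
      linarith [he' i]
    have h3 : ‖z‖ - ‖m‖ ≤ ‖z + m‖ := by
      have := norm_sub_le (z + m) m
      rw [add_sub_cancel_right] at this
      linarith
    -- For `|E| < 4`, `|z| ≤ 5` and the equation exclude `|m| > 7`, so `|z + m| ≥ 0.99/7` and the
    -- diagonal entries are below 8. For `|E| ≥ 4` the a priori bound `|m| ≤ 2` keeps `m` away from
    -- the root near `-z`, so `|z + m| ≥ 2`, uniformly in `E`.
    by_cases hE : |z.re| < 4
    · have hE8 : entryBound z.re = 8 := if_pos hE
      rw [hE8]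
      have hz5 : ‖z‖ ≤ 5 := by
        have := Complex.norm_le_abs_re_add_abs_im z
        rw [abs_of_pos hz] at this
        linarith
      have h4 : ‖m‖ * ‖z + m‖ ≤ 1.01 := by
        rw [← norm_mul]
        have := norm_sub_le (m * (z + m) + 1) 1
        rw [add_sub_cancel_right, norm_one] at this
        linarith
      have h5 : 0.99 ≤ ‖m‖ * ‖z + m‖ := by
        rw [← norm_mul]
        have := norm_sub_le (m * (z + m) + 1) (m * (z + m))
        rw [add_sub_cancel_left, norm_one] at this
        linarith
      have h6 : ‖m‖ ≤ 7 := by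
        by_contra hcon
        rw [not_le] at hcon
        have h7 : ‖m‖ - ‖z‖ ≤ ‖z + m‖ := by
          have := norm_sub_le (z + m) z
          rw [add_sub_cancel_left] at this
          linarith
        nlinarith
      have h7 : 0.141 ≤ ‖z + m‖ := by nlinarith [norm_nonneg (z + m), norm_nonneg m]
      have h8 : 0.14 ≤ ‖z + m + e i‖ := by linarith
      nlinarith [norm_nonneg (res A z i i)]
    · have hE1 : entryBound z.re = 1 := if_neg hE
      rw [hE1] at hBdef ⊢
      have hz4 : 4 ≤ ‖z‖ := (not_lt.1 hE).trans (Complex.abs_re_le_norm z)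
      have h8 : 1 ≤ ‖z + m + e i‖ := by linarith
      nlinarith [norm_nonneg (res A z i i)]
  -- Off-diagonal entries need no equation: `G_ki` is `-G_ii` times a linear form in the row of
  -- absolute value at most one.
  refine ⟨entryNorm_le (by linarith) fun k i => ?_, hζ'⟩
  by_cases hk : k = i
  · rw [hk]; exact hdiag i
  · exact ((h i).norm_res_le hA hz.ne' hB1 hBε hB hk).trans (hdiag i)

/-- Bootstrap in the spectral scale, from scale at least one down to `η`. -/
theorem bootstrap (hA : A.IsHermitian) (hε : ε ≤ 1 / 10 ^ 7) (hN0 : 0 < N)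
    (hNε : (N : ℝ)⁻¹ ≤ ε) {E η : ℝ} (hη : 0 < η) {J : ℕ} (hJ : 1 ≤ 2 ^ J * η)
    (h : ∀ j ≤ J, ∀ i, RowConcentrated A (E + (2 ^ j * η : ℝ) * Complex.I) ε i) :
    entryNorm (res A (E + η * Complex.I)) ≤ entryBound E ∧ (η < 1 →
      ‖stieltjes A (E + η * Complex.I) * (E + η * Complex.I + stieltjes A (E + η * Complex.I)) + 1‖ ≤
        24576 * ε) := by
  set Z : ℕ → ℂ := fun j => E + (2 ^ j * η : ℝ) * Complex.I with hZ
  have hre : ∀ j, (Z j).re = E := fun j => by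
    simp only [hZ, Complex.add_re, Complex.ofReal_re, Complex.re_ofReal_mul, Complex.I_re]; ring
  have him : ∀ j, (Z j).im = 2 ^ j * η := fun j => by
    simp only [hZ, Complex.add_im, Complex.ofReal_im, Complex.im_ofReal_mul, Complex.I_im]; ring
  have hpos : ∀ j, 0 < (Z j).im := fun j => by rw [him]; positivity
  have htriv : ∀ j, 1 ≤ 2 ^ j * η → entryNorm (res A (Z j)) ≤ entryBound E := by
    intro j hj
    refine le_trans (entryNorm_le (r := 1) zero_le_one fun k l =>
      (norm_res_le hA (hpos j) k l).trans ?_) (one_le_entryBound E)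
    rw [him, div_le_one (by positivity)]
    exact hj
  have hdouble : ∀ j, entryNorm (res A (Z (j + 1))) ≤ entryBound E →
      entryNorm (res A (Z j)) ≤ 2 * entryBound E := by
    intro j hj
    have := entryNorm_res_le_two_mul hA (z := Z j) (w := Z (j + 1)) (hpos j) (by rw [hre, hre])
      (by rw [him, him, pow_succ]; ring)
    linarith
  have hstep : ∀ j ≤ J, 2 ^ j * η ≤ 1 → entryNorm (res A (Z (j + 1))) ≤ entryBound E →
      entryNorm (res A (Z j)) ≤ entryBound E ∧
        ‖stieltjes A (Z j) * (Z j + stieltjes A (Z j)) + 1‖ ≤ 24576 * ε := by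
    intro j hjJ hj1 hj
    have := entryNorm_le_entryBound hA (hpos j) (by rw [him]; exact hj1) hε hN0 hNε (h j hjJ)
      (by rw [hre]; exact hdouble j hj)
    rwa [hre] at this
  have hall : ∀ d ≤ J, entryNorm (res A (Z (J - d))) ≤ entryBound E := by
    intro d
    induction d with
    | zero => intro _; exact htriv J hJ
    | succ d ih =>
      intro hd
      rcases le_total 1 (2 ^ (J - (d + 1)) * η) with h1 | h1
      · exact htriv _ h1
      · refine (hstep (J - (d + 1)) (by omega) h1 ?_).1
        have : J - (d + 1) + 1 = J - d := by omega
        rw [this]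
        exact ih (by omega)
  have hZ0 : Z 0 = E + η * Complex.I := by simp [hZ]
  rw [← hZ0]
  refine ⟨by simpa using hall J le_rfl, fun hη1 => ?_⟩
  -- With `η < 1` the top scale lies strictly above `η`, so the last step of the induction is
  -- available at `j = 0` and supplies the equation as well as the bound.
  have hJ1 : 1 ≤ J := by
    by_contra hcon
    have : J = 0 := by omega
    subst this
    simp at hJ
    linarith
  refine (hstep 0 (Nat.zero_le _) (by simpa using hη1.le) ?_).2
  have := hall (J - 1) (by omega)
  rwa [show J - (J - 1) = 0 + 1 by omega] at this

/-- Stability of the quadratic equation of the semicircle law on the real axis. -/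
theorem abs_im_sub_sqrt_le {m : ℂ} {E ζ : ℝ} (hm : 0 ≤ m.im) (h : ‖m ^ 2 + E * m + 1‖ ≤ ζ) :
    |m.im - √(max (4 - E ^ 2) 0) / 2| ≤ √ζ := by
  have hζ : 0 ≤ ζ := (norm_nonneg _).trans h
  have hs := Real.sq_sqrt hζ
  have hs0 := Real.sqrt_nonneg ζ
  -- If a product of two numbers is at most `4ζ` in absolute value, one factor is at most `2√ζ`. It
  -- is applied to the factorization of `(2m + E)² - (E² - 4)`.
  have hmin : ∀ a b : ℂ, a * b = 4 * (m ^ 2 + E * m + 1) → ‖a‖ ≤ 2 * √ζ ∨ ‖b‖ ≤ 2 * √ζ := by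
    intro a b hab
    by_contra hcon
    rw [not_or, not_le, not_le] at hcon
    have h1 : ‖a‖ * ‖b‖ ≤ 4 * ζ := by
      rw [← norm_mul, hab, norm_mul]
      have : ‖(4 : ℂ)‖ = 4 := by norm_num
      rw [this]; linarith
    have h2 : (2 * √ζ) * (2 * √ζ) < ‖a‖ * ‖b‖ :=
      mul_lt_mul'' hcon.1 hcon.2 (by positivity) (by positivity)
    nlinarith
  rcases le_total 0 (4 - E ^ 2) with hE | hE
  · rw [max_eq_left hE]
    set t := √(4 - E ^ 2) with ht
    have ht2 : t ^ 2 = 4 - E ^ 2 := Real.sq_sqrt hE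
    have ht0 : 0 ≤ t := Real.sqrt_nonneg _
    have htc : (t : ℂ) ^ 2 = 4 - (E : ℂ) ^ 2 := by exact_mod_cast congrArg Complex.ofReal ht2
    have hprod : (2 * m + E - t * Complex.I) * (2 * m + E + t * Complex.I) =
        4 * (m ^ 2 + E * m + 1) := by
      linear_combination (-(t : ℂ) ^ 2) * Complex.I_sq + htc
    have i1 : (2 * m + E - t * Complex.I).im = 2 * m.im - t := by simp
    have i2 : (2 * m + E + t * Complex.I).im = 2 * m.im + t := by simp
    rcases hmin _ _ hprod with h1 | h1
    · have h2 := (Complex.abs_im_le_norm _).trans h1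
      rw [i1, abs_le] at h2
      rw [abs_le]; constructor <;> linarith
    -- Even if `m` is near the wrong root, `Im m ≥ 0` gives `|2 Im m - t| ≤ 2 Im m + t`, and the
    -- latter is small.
    · have h2 := (Complex.abs_im_le_norm _).trans h1
      rw [i2, abs_le] at h2
      rw [abs_le]; constructor <;> linarith
  · rw [max_eq_right hE, Real.sqrt_zero, zero_div, sub_zero]
    set t := √(E ^ 2 - 4) with ht
    have ht2 : t ^ 2 = E ^ 2 - 4 := Real.sq_sqrt (by linarith)
    have htc : (t : ℂ) ^ 2 = (E : ℂ) ^ 2 - 4 := by exact_mod_cast congrArg Complex.ofReal ht2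
    have hprod : (2 * m + E - t) * (2 * m + E + t) = 4 * (m ^ 2 + E * m + 1) := by
      linear_combination -htc
    have i1 : (2 * m + E - t).im = 2 * m.im := by simp
    have i2 : (2 * m + E + t).im = 2 * m.im := by simp
    have h2 : |2 * m.im| ≤ 2 * √ζ := by
      rcases hmin _ _ hprod with h1 | h1
      · rw [← i1]; exact (Complex.abs_im_le_norm _).trans h1
      · rw [← i2]; exact (Complex.abs_im_le_norm _).trans h1
    rw [abs_mul, abs_two] at h2
    linarith

/-- Consequences of the bootstrap for the imaginary part of the Stieltjes transform. -/
theorem im_stieltjes_bounds (hA : A.IsHermitian) (hε : ε ≤ 1 / 10 ^ 7) (hN0 : 0 < N)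
    (hNε : (N : ℝ)⁻¹ ≤ ε) {E η : ℝ} (hη : 0 < η) {J : ℕ} (hJ : 1 ≤ 2 ^ J * η)
    (h : ∀ j ≤ J, ∀ i, RowConcentrated A (E + (2 ^ j * η : ℝ) * Complex.I) ε i) :
    (stieltjes A (E + η * Complex.I)).im ≤ 8 ∧ (η < 1 →
      |(stieltjes A (E + η * Complex.I)).im - √(max (4 - E ^ 2) 0) / 2| ≤
        √(24576 * ε + 8 * η)) := by
  obtain ⟨h1, h2⟩ := bootstrap hA hε hN0 hNε hη hJ h
  have hm8 : ‖stieltjes A (E + η * Complex.I)‖ ≤ 8 :=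
    norm_stieltjes_le_entryNorm.trans (h1.trans (entryBound_le E))
  refine ⟨((le_abs_self _).trans (Complex.abs_im_le_norm _)).trans hm8, fun hη1 => ?_⟩
  refine abs_im_sub_sqrt_le (im_stieltjes_nonneg hA (by simpa using hη)) ?_
  set m := stieltjes A (E + η * Complex.I)
  have h3 : m ^ 2 + E * m + 1 = (m * (E + η * Complex.I + m) + 1) - η * Complex.I * m := by ring
  rw [h3]
  refine (norm_sub_le _ _).trans (add_le_add (h2 hη1) ?_)
  rw [norm_mul, norm_mul, Complex.norm_I, mul_one, Complex.norm_real, Real.norm_of_nonneg hη.le,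
    mul_comm]
  exact mul_le_mul_of_nonneg_right hm8 hη.le

end SparseLocalLaw

namespace SparseLocalLaw

/-! ### Concentration of the rows of a sparse random matrix -/

open Matrix

theorem measurable_det {α : Type*} [MeasurableSpace α] {N : ℕ} {f : α → Matrix (Fin N) (Fin N) ℂ}
    (hf : ∀ k l, Measurable fun x => f x k l) : Measurable fun x => (f x).det := by
  simp only [Matrix.det_apply]
  refine Finset.measurable_sum _ fun σ _ => ?_
  exact (Finset.measurable_prod _ fun k _ => hf (σ k) k).const_smul (Equiv.Perm.sign σ)

/-- Via the adjugate formula, entries of the resolvent are quotients of determinants, so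
measurability needs no invertibility. -/
theorem measurable_res {α : Type*} [MeasurableSpace α] {N : ℕ} {f : α → Matrix (Fin N) (Fin N) ℝ}
    (hf : ∀ k l, Measurable fun x => f x k l) (z : ℂ) (k l : Fin N) :
    Measurable fun x => res (f x) z k l := by
  have hs : ∀ k l, Measurable fun x => shift (f x) z k l := by
    intro k l
    simp only [shift_apply]
    exact (Complex.measurable_ofReal.comp (hf k l)).sub_const _
  simp only [res, Matrix.inv_def, Ring.inverse_eq_inv', Matrix.smul_apply, smul_eq_mul,
    Matrix.adjugate_apply]
  refine (measurable_det hs).inv.mul (measurable_det fun p s => ?_)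
  by_cases hp : p = l
  · subst hp; simp only [Matrix.updateRow_self]; exact measurable_const
  · simp only [Matrix.updateRow_ne hp]; exact hs p s

variable {Ω : Type*} [MeasurableSpace Ω] {P : Measure Ω} [IsProbabilityMeasure P] {N : ℕ}
  {q K : ℝ} {H : Ω → Matrix (Fin N) (Fin N) ℝ}

/-- Fubini for independent variables: a bound uniform in the frozen value of `Y` survives
integration over `Y`. It is used with `X` a row and `Y` the resolvent of its minor. -/
theorem measure_le_of_indepFun {α β : Type*} [MeasurableSpace α] [MeasurableSpace β]
    {X : Ω → α} {Y : Ω → β} (hX : Measurable X) (hY : Measurable Y) (hXY : IndepFun X Y P)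
    {S : Set (α × β)} (hS : MeasurableSet S) {p : ENNReal}
    (h : ∀ ω', P {ω | (X ω, Y ω') ∈ S} ≤ p) : P {ω | (X ω, Y ω) ∈ S} ≤ p := by
  have h1 := (indepFun_iff_map_prod_eq_prod_map_map hX.aemeasurable hY.aemeasurable).1 hXY
  have : IsProbabilityMeasure (P.map X) := Measure.isProbabilityMeasure_map hX.aemeasurable
  have : IsProbabilityMeasure (P.map Y) := Measure.isProbabilityMeasure_map hY.aemeasurable
  calc P {ω | (X ω, Y ω) ∈ S} = (P.map fun ω => (X ω, Y ω)) S :=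
        (Measure.map_apply (hX.prodMk hY) hS).symm
    _ = ∫⁻ y, (P.map X) ((fun x => (x, y)) ⁻¹' S) ∂(P.map Y) := by
        rw [h1, Measure.prod_apply_symm hS]
    _ = ∫⁻ ω', (P.map X) ((fun x => (x, Y ω')) ⁻¹' S) ∂P :=
        lintegral_map (measurable_measure_prodMk_right hS) hY
    _ ≤ ∫⁻ _ω', p ∂P := by
        refine lintegral_mono fun ω' => ?_
        rw [Measure.map_apply hX (measurable_prodMk_right hS)]
        exact h ω'
    _ = p := by simp

/-- The moment bounds force the entries to be bounded by `1 / q`. -/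
theorem IsSparseMatrix.ae_abs_le (hH : IsSparseMatrix P q K H) (i j : Fin N) :
    ∀ᵐ ω ∂P, |H ω i j| ≤ 1 / q := by
  have hq := hH.q_pos
  have hN : (0 : ℝ) < N := by
    have := i.pos
    positivity
  have key : ∀ c : ℝ, 1 / q < c → P {ω | c ≤ |H ω i j|} = 0 := by
    intro c hc
    have hc0 : 0 < c := (by positivity : (0 : ℝ) < 1 / q).trans hc
    have hcq : 1 < c * q := by rwa [div_lt_iff₀ hq] at hc
    by_contra hne
    have hp : 0 < P.real {ω | c ≤ |H ω i j|} :=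
      ENNReal.toReal_pos hne (measure_ne_top _ _)
    set p := P.real {ω | c ≤ |H ω i j|} with hpdef
    -- If `|H_ij| ≥ c` has probability `p > 0`, Markov gives `(c q)^k ≤ q²/(N p)` for all `k ≥ 3`.
    -- This is impossible for large `k` when `c q > 1`.
    obtain ⟨k, hk⟩ := pow_unbounded_of_one_lt (q ^ 2 / N / p) hcq
    have hk3 : q ^ 2 / N / p < (c * q) ^ (k + 3) :=
      hk.trans_le (pow_le_pow_right₀ hcq.le (by omega))
    have hint : Integrable (fun ω => |H ω i j| ^ (k + 3)) P := by
      have := (hH.memLp_entry i j (k + 3)).integrable_norm_pow (by omega)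
      simpa using this
    have h1 := mul_meas_ge_le_integral_of_nonneg (μ := P) (f := fun ω => |H ω i j| ^ (k + 3))
      (Filter.Eventually.of_forall fun ω => by positivity) hint (c ^ (k + 3))
    have h2 : {ω | c ^ (k + 3) ≤ |H ω i j| ^ (k + 3)} = {ω | c ≤ |H ω i j|} := by
      ext ω
      exact pow_le_pow_iff_left₀ hc0.le (abs_nonneg _) (by omega)
    rw [h2] at h1
    have h3 := h1.trans (hH.moment_le i j (k + 3) (by omega))
    rw [show k + 3 - 2 = k + 1 by omega, le_div_iff₀ (by positivity)] at h3
    rw [div_div, div_lt_iff₀ (by positivity)] at hk3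
    have h4 : (c * q) ^ (k + 3) * (N * p) = (c ^ (k + 3) * p * (N * q ^ (k + 1))) * q ^ 2 := by
      rw [mul_pow]; ring
    rw [h4] at hk3
    have h5 := mul_le_mul_of_nonneg_right h3 (sq_nonneg q)
    linarith
  have h1 : ∀ n : ℕ, ∀ᵐ ω ∂P, |H ω i j| < 1 / q + 1 / (n + 1) := by
    intro n
    rw [ae_iff]
    simp only [not_lt]
    exact key _ (lt_add_of_pos_right _ (by positivity))
  filter_upwards [ae_all_iff.2 h1] with ω hω
  refine le_of_forall_pos_lt_add fun δ hδ => ?_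
  obtain ⟨n, hn⟩ := exists_nat_one_div_lt hδ
  exact (hω n).trans (by linarith)

theorem IsSparseMatrix.symm (hH : IsSparseMatrix P q K H) (ω : Ω) (i j : Fin N) :
    H ω i j = H ω j i := by
  have := (hH.isHermitian ω).apply i j
  simpa using this.symm

theorem IsSparseMatrix.min_max (hH : IsSparseMatrix P q K H) (ω : Ω) (i j : Fin N) :
    H ω (min i j) (max i j) = H ω i j := by
  rcases le_total i j with h | h
  · rw [min_eq_left h, max_eq_right h]
  · rw [min_eq_right h, max_eq_left h, hH.symm]

theorem IsSparseMatrix.integral_offRow_sq (hH : IsSparseMatrix P q K H) (i k : Fin N) :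
    ∫ ω, offRow (H ω) i k ^ 2 ∂P = if k = i then 0 else 1 / (N : ℝ) := by
  by_cases hk : k = i
  · simp [offRow, hk]
  · simp only [offRow, hk, if_false]
    exact hH.variance_offDiag i k (Ne.symm hk)

/-- The off-diagonal part of a row of a sparse matrix. -/
theorem IsSparseMatrix.boundedRow (hH : IsSparseMatrix P q K H) (i : Fin N) :
    BoundedRow P (fun k ω => offRow (H ω) i k) (1 / q) (1 / N) where
  indep := by
    -- The pairs `(min i k, max i k)` index row `i` within the upper triangle. They are distinct
    -- because the sum of the two components determines `k`.
    have hinj : Function.Injective fun k : Fin N =>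
        (⟨(min i k, max i k), min_le_max⟩ : {p : Fin N × Fin N // p.1 ≤ p.2}) := by
      intro k l hkl
      simp only [Subtype.mk.injEq, Prod.mk.injEq] at hkl
      obtain ⟨h1, h2⟩ := hkl
      have h3 := min_add_max (i : ℕ) k
      have h4 := min_add_max (i : ℕ) l
      have h5 : min (i : ℕ) k = min (i : ℕ) l := by
        simpa using congrArg Fin.val h1
      have h6 : max (i : ℕ) k = max (i : ℕ) l := by
        simpa using congrArg Fin.val h2
      exact Fin.ext (by omega)
    have h1 := (hH.indep.precomp hinj).comp (fun k x => if k = i then (0 : ℝ) else x) (by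
      intro k
      by_cases hk : k = i
      · simp only [hk, if_true]; exact measurable_const
      · simp only [hk, if_false]; exact measurable_id)
    convert h1 using 2 with k
    ext ω
    simp only [offRow, Function.comp_apply, hH.min_max]
  meas k := by
    by_cases hk : k = i
    · simp only [offRow, hk, if_true]; exact measurable_const
    · simp only [offRow, hk, if_false]; exact hH.measurable_entry i k
  bdd k := by
    have hq := hH.q_pos
    filter_upwards [hH.ae_abs_le i k] with ω hω
    by_cases hk : k = i
    · simp only [offRow, hk, if_true, abs_zero]; positivity
    · simpa only [offRow, hk, if_false] using hω
  mean k := by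
    by_cases hk : k = i
    · simp [offRow, hk]
    · simp only [offRow, hk, if_false]
      exact hH.mean_zero i k
  var k := by
    rw [hH.integral_offRow_sq]
    split_ifs
    · positivity
    · exact le_rfl

theorem IsSparseMatrix.measurable_minorRes (hH : IsSparseMatrix P q K H) (z : ℂ) (i : Fin N) :
    Measurable fun ω => (fun k l => minorRes (H ω) z i k l : Fin N → Fin N → ℂ) := by
  refine measurable_pi_lambda _ fun k => measurable_pi_lambda _ fun l => ?_
  unfold minorRes
  split_ifs
  · exact measurable_const
  · refine measurable_res (fun p s => ?_) z k l
    unfold minor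
    split_ifs
    · exact measurable_const
    · exact hH.measurable_entry p s

/-- A row is independent of the resolvent of the corresponding minor. -/
theorem IsSparseMatrix.indepFun_minorRes (hH : IsSparseMatrix P q K H) (z : ℂ) (i : Fin N) :
    IndepFun (fun ω => (fun k => offRow (H ω) i k : Fin N → ℝ))
      (fun ω => (fun k l => minorRes (H ω) z i k l : Fin N → Fin N → ℂ)) P := by
  -- The positions in row or column `i`. The row is a function of the entries in `S`, the minor of
  -- those in the complement.
  set S : Finset {p : Fin N × Fin N // p.1 ≤ p.2} :=
    Finset.univ.filter fun p => p.1.1 = i ∨ p.1.2 = i with hS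
  have h1 := hH.indep.indepFun_finset S Sᶜ disjoint_compl_right
    (fun p => hH.measurable_entry p.1.1 p.1.2)
  have hmemS : ∀ k, (⟨(min i k, max i k), min_le_max⟩ : {p : Fin N × Fin N // p.1 ≤ p.2}) ∈ S := by
    intro k
    rcases le_total i k with h | h
    · simp [hS, h]
    · simp [hS, h]
  have hmemT : ∀ k l, ¬ (k = i ∨ l = i) →
      (⟨(min k l, max k l), min_le_max⟩ : {p : Fin N × Fin N // p.1 ≤ p.2}) ∈ Sᶜ := by
    intro k l hkl
    rw [not_or] at hkl
    rcases le_total k l with h | h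
    · simp [hS, h, hkl.1, hkl.2]
    · simp [hS, h, hkl.1, hkl.2]
  set φ : (S → ℝ) → Fin N → ℝ := fun x k => if k = i then 0 else x ⟨_, hmemS k⟩ with hφ
  set B : ((Sᶜ : Finset _) → ℝ) → Matrix (Fin N) (Fin N) ℝ := fun x k l =>
    if h : k = i ∨ l = i then 0 else x ⟨_, hmemT k l h⟩ with hB
  set ψ : ((Sᶜ : Finset _) → ℝ) → Fin N → Fin N → ℂ := fun x k l =>
    if k = i ∨ l = i then 0 else res (B x) z k l with hψ
  have hφm : Measurable φ := by
    refine measurable_pi_lambda _ fun k => ?_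
    simp only [hφ]
    split_ifs
    · exact measurable_const
    · exact measurable_pi_apply _
  have hψm : Measurable ψ := by
    refine measurable_pi_lambda _ fun k => measurable_pi_lambda _ fun l => ?_
    simp only [hψ]
    split_ifs
    · exact measurable_const
    · refine measurable_res (fun p s => ?_) z k l
      simp only [hB]
      split_ifs
      · exact measurable_const
      · exact measurable_pi_apply _
  have h2 := h1.comp hφm hψm
  convert h2 using 1
  · ext ω k
    simp only [hφ, Function.comp_apply, offRow, hH.min_max]
  · ext ω k l
    have h3 : minor (H ω) i = B (fun p => H ω p.1.1.1 p.1.1.2) := by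
      ext p s
      simp only [minor, hB, hH.min_max, dite_eq_ite]
    simp only [hψ, Function.comp_apply, minorRes, h3]

/-- The bound on the probability of a deviation of a linear or quadratic form. -/
noncomputable def deviationBound (N : ℕ) (q r t : ℝ) : ℝ :=
  (4 * N + 2) * Real.exp (1 - r * t) + Real.exp (-q ^ 2) + 2 * Real.exp (-(t ^ 2 * q ^ 2 / 8))

/-- Ward's identity for the minor. After division by `M = max 1 ‖G⁽ⁱ⁾‖` this supplies the row bound
`V = 1/η` in the large deviation estimate. -/
theorem sum_norm_sq_minorRes_le {A : Matrix (Fin N) (Fin N) ℝ} (hA : A.IsHermitian) {z : ℂ}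
    (hz : 0 < z.im) (i k : Fin N) :
    ∑ l, ‖minorRes A z i k l‖ ^ 2 ≤ max 1 (entryNorm (minorRes A z i)) / z.im := by
  by_cases hk : k = i
  · simp only [minorRes, hk, true_or, if_true, norm_zero]
    rw [zero_pow two_ne_zero, Finset.sum_const_zero]
    positivity
  · calc ∑ l, ‖minorRes A z i k l‖ ^ 2 ≤ ∑ l, ‖res (minor A i) z k l‖ ^ 2 := by
          refine Finset.sum_le_sum fun l _ => ?_
          unfold minorRes
          split_ifs
          · simp
          · exact le_rfl
      _ = (minorRes A z i k k).im / z.im := by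
          rw [sum_norm_sq_res (minor_isHermitian hA i) hz.ne']
          simp [minorRes, hk]
      _ ≤ _ := by
          gcongr
          exact ((le_abs_self _).trans (Complex.abs_im_le_norm _)).trans
            ((norm_le_entryNorm _ k k).trans (le_max_right _ _))

/-- The set of pairs (row, minor resolvent) violating the concentration bounds. -/
def deviationSet (N : ℕ) (ε : ℝ) : Set ((Fin N → ℝ) × (Fin N → Fin N → ℂ)) :=
  (⋃ k, {p | ε * max 1 ‖p.2‖ < ‖∑ l, p.2 k l * p.1 l‖}) ∪
    {p | ε * max 1 ‖p.2‖ < ‖∑ k, ∑ l, p.1 k * p.2 k l * p.1 l - (N : ℂ)⁻¹ * ∑ k, p.2 k k‖}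

theorem measurableSet_deviationSet (ε : ℝ) : MeasurableSet (deviationSet N ε) := by
  refine IsOpen.measurableSet (IsOpen.union ?_ ?_)
  · refine isOpen_iUnion fun k => isOpen_lt (by fun_prop) ?_
    refine (continuous_finsetSum _ fun l _ => Continuous.mul ?_ ?_).norm
    · fun_prop
    · fun_prop
  · refine isOpen_lt (by fun_prop) (Continuous.norm (Continuous.sub ?_ ?_))
    · refine continuous_finsetSum _ fun k _ => continuous_finsetSum _ fun l _ => ?_
      fun_prop
    · fun_prop

/-- With the minor's resolvent frozen at `ω'`, its real and imaginary parts divided by `M` are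
admissible coefficients. The deviation bound is used at `t = ε/8`: a linear form is then off by at
most `2 t M` and the quadratic form by at most `6 t M`, both below `ε M`. -/
theorem IsSparseMatrix.measure_deviationSet_le (hH : IsSparseMatrix P q K H) (hq : 1 ≤ q) {z : ℂ}
    (hz : 0 < z.im) (i : Fin N) {ε r : ℝ} (hε : 0 < ε) (hε1 : ε ≤ 1) (hr : 0 ≤ r)
    (hV : r ^ 2 * Real.exp (r * (1 / q)) * (1 / N) * (64 * (1 / z.im) / (1 / q) ^ 2) ≤ 1) (ω' : Ω) :
    P {ω | ((fun k => offRow (H ω) i k : Fin N → ℝ),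
      (fun k l => minorRes (H ω') z i k l : Fin N → Fin N → ℂ)) ∈ deviationSet N ε} ≤
      2 * ENNReal.ofReal (deviationBound N q r (ε / 8)) := by
  have hA := hH.isHermitian ω'
  set X := minorRes (H ω') z i with hX
  set M := max 1 (entryNorm X) with hM
  have hM1 : 1 ≤ M := le_max_left _ _
  have hM0 : 0 < M := by linarith
  have hXM : ∀ k l, ‖X k l‖ ≤ M := fun k l => (norm_le_entryNorm X k l).trans (le_max_right _ _)
  have hXs : ∀ k l, X k l = X l k := by
    intro k l
    simp only [hX, minorRes, or_comm, res_symm (minor_isHermitian hA i) k l]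
  have hXV : ∀ k, ∑ l, ‖X k l‖ ^ 2 ≤ M / z.im := fun k => sum_norm_sq_minorRes_le hA hz i k
  have hN : (0 : ℝ) < N := by
    have := i.pos
    positivity
  have hbound : ∀ a : Fin N → Fin N → ℝ, (∀ k l, a k l = a l k) →
      (∀ k l, |a k l| ≤ ‖X k l‖ / M) →
      P (deviationEvent P (fun k ω => offRow (H ω) i k) a (ε / 8)) ≤
        ENNReal.ofReal (deviationBound N q r (ε / 8)) := by
    intro a ha haX
    have h1 := (hH.boundedRow i).measure_deviationEvent_le (by positivity)
      (by rw [div_le_one (by linarith)]; exact hq) (by positivity)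
      (by rw [mul_one_div_cancel hN.ne']) ha
      (fun k l => (haX k l).trans (by rw [div_le_one hM0]; exact hXM k l)) (V := 1 / z.im)
      (by positivity) (fun k => ?_) hr (t := ε / 8) (by positivity) (by linarith) hV
    · refine h1.trans (le_of_eq ?_)
      rw [deviationBound]
      congr 2
      · congr 2
        field_simp
      · congr 3
        field_simp
    · calc ∑ l, a k l ^ 2 ≤ ∑ l, ‖X k l‖ ^ 2 / M ^ 2 := by
            refine Finset.sum_le_sum fun l _ => ?_
            rw [← sq_abs, ← div_pow]
            exact pow_le_pow_left₀ (abs_nonneg _) (haX k l) 2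
        _ ≤ (M / z.im) / M ^ 2 := by
            rw [← Finset.sum_div]
            exact div_le_div_of_nonneg_right (hXV k) (by positivity)
        _ = (1 / z.im) / M := by field_simp
        _ ≤ 1 / z.im := div_le_self (by positivity) hM1
  set a : Fin N → Fin N → ℝ := fun k l => (X k l).re / M with ha
  set b : Fin N → Fin N → ℝ := fun k l => (X k l).im / M with hb
  have hPa := hbound a (fun k l => by simp only [ha, hXs k l]) (fun k l => by
    rw [ha, abs_div, abs_of_pos hM0]
    exact div_le_div_of_nonneg_right (Complex.abs_re_le_norm _) hM0.le)
  have hPb := hbound b (fun k l => by simp only [hb, hXs k l]) (fun k l => by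
    rw [hb, abs_div, abs_of_pos hM0]
    exact div_le_div_of_nonneg_right (Complex.abs_im_le_norm _) hM0.le)
  rw [two_mul]
  refine le_trans (measure_mono ?_) ((measure_union_le _ _).trans (add_le_add hPa hPb))
  intro ω hω
  by_contra hcon
  simp only [Set.mem_union, deviationEvent, Set.mem_ofPred_eq, not_or, not_exists, not_lt] at hcon
  obtain ⟨⟨ha1, ha2⟩, hb1, hb2⟩ := hcon
  have hre : ∀ k l, (X k l).re = M * a k l := fun k l => by rw [ha]; field_simp
  have him : ∀ k l, (X k l).im = M * b k l := fun k l => by rw [hb]; field_simp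
  have hscale : ∀ {s t : ℝ}, |s| ≤ t → |M * s| ≤ M * t := fun h => by
    rw [abs_mul, abs_of_pos hM0]; exact mul_le_mul_of_nonneg_left h hM0.le
  -- The diagonal position of the row is set to zero and has no variance. This does not disturb the
  -- mean, since the coefficient there also vanishes.
  have hvar : ∀ c : Fin N → Fin N → ℝ, c i i = 0 →
      ∑ k, (∫ ω, offRow (H ω) i k ^ 2 ∂P) * c k k = (N : ℝ)⁻¹ * ∑ k, c k k := by
    intro c hc
    rw [Finset.mul_sum]
    refine Finset.sum_congr rfl fun k _ => ?_
    rw [hH.integral_offRow_sq]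
    by_cases hk : k = i
    · rw [hk, hc]; simp
    · simp [hk]
  have hXi : X i i = 0 := by simp [hX, minorRes]
  rw [hvar a (by simp [ha, hXi])] at ha2
  rw [hvar b (by simp [hb, hXi])] at hb2
  have hNc : ((N : ℂ)⁻¹) = (((N : ℝ)⁻¹ : ℝ) : ℂ) := by push_cast; rfl
  rcases hω with hk | hq
  · obtain ⟨k, hk⟩ := Set.mem_iUnion.1 hk
    change ε * M < ‖∑ l, X k l * offRow (H ω) i l‖ at hk
    have e1 : (∑ l, X k l * offRow (H ω) i l).re = M * ∑ l, offRow (H ω) i l * a k l := by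
      rw [Complex.re_sum, Finset.mul_sum]
      refine Finset.sum_congr rfl fun l _ => ?_
      rw [Complex.re_mul_ofReal, hre]; ring
    have e2 : (∑ l, X k l * offRow (H ω) i l).im = M * ∑ l, offRow (H ω) i l * b k l := by
      rw [Complex.im_sum, Finset.mul_sum]
      refine Finset.sum_congr rfl fun l _ => ?_
      rw [Complex.im_mul_ofReal, him]; ring
    have h1 := Complex.norm_le_abs_re_add_abs_im (∑ l, X k l * offRow (H ω) i l)
    rw [e1, e2] at h1
    have h2 := hscale (ha1 k)
    have h3 := hscale (hb1 k)
    nlinarith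
  · change ε * M < ‖∑ k, ∑ l, offRow (H ω) i k * X k l * offRow (H ω) i l -
      (N : ℂ)⁻¹ * ∑ k, X k k‖ at hq
    have e1 : (∑ k, ∑ l, offRow (H ω) i k * X k l * offRow (H ω) i l -
        (N : ℂ)⁻¹ * ∑ k, X k k).re = M * (∑ k, ∑ l, offRow (H ω) i k * a k l * offRow (H ω) i l -
          (N : ℝ)⁻¹ * ∑ k, a k k) := by
      rw [hNc, Complex.sub_re, Complex.re_ofReal_mul, Complex.re_sum, Complex.re_sum]
      simp only [Complex.re_sum, Complex.re_mul_ofReal, Complex.re_ofReal_mul, hre, mul_sub,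
        Finset.mul_sum]
      congr 1
      · exact Finset.sum_congr rfl fun k _ => Finset.sum_congr rfl fun l _ => by ring
      · exact Finset.sum_congr rfl fun k _ => by ring
    have e2 : (∑ k, ∑ l, offRow (H ω) i k * X k l * offRow (H ω) i l -
        (N : ℂ)⁻¹ * ∑ k, X k k).im = M * (∑ k, ∑ l, offRow (H ω) i k * b k l * offRow (H ω) i l -
          (N : ℝ)⁻¹ * ∑ k, b k k) := by
      rw [hNc, Complex.sub_im, Complex.im_ofReal_mul, Complex.im_sum, Complex.im_sum]
      simp only [Complex.im_sum, Complex.im_mul_ofReal, Complex.im_ofReal_mul, him, mul_sub,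
        Finset.mul_sum]
      congr 1
      · exact Finset.sum_congr rfl fun k _ => Finset.sum_congr rfl fun l _ => by ring
      · exact Finset.sum_congr rfl fun k _ => by ring
    have h1 := Complex.norm_le_abs_re_add_abs_im (∑ k, ∑ l, offRow (H ω) i k * X k l *
      offRow (H ω) i l - (N : ℂ)⁻¹ * ∑ k, X k k)
    rw [e1, e2] at h1
    have h2 := hscale ha2
    have h3 := hscale hb2
    nlinarith

theorem IsSparseMatrix.measure_not_rowConcentrated_le (hH : IsSparseMatrix P q K H) (hq : 1 ≤ q)
    {z : ℂ} (hz : 0 < z.im) (i : Fin N) {ε r : ℝ} (hqε : 1 / q ≤ ε) (hε1 : ε ≤ 1) (hr : 0 ≤ r)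
    (hV : r ^ 2 * Real.exp (r * (1 / q)) * (1 / N) * (64 * (1 / z.im) / (1 / q) ^ 2) ≤ 1) :
    P {ω | ¬ RowConcentrated (H ω) z ε i} ≤
      2 * ENNReal.ofReal (deviationBound N q r (ε / 8)) := by
  have hε : 0 < ε := (by positivity : 0 < 1 / q).trans_le hqε
  have h1 := measure_le_of_indepFun (measurable_pi_lambda _ (hH.boundedRow i).meas)
    (hH.measurable_minorRes z i) (hH.indepFun_minorRes z i) (measurableSet_deviationSet ε)
    (hH.measure_deviationSet_le hq hz i hε hε1 hr hV)
  refine le_trans (measure_mono_ae ?_) h1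
  filter_upwards [hH.ae_abs_le i i] with ω hω hbad
  by_contra hcon
  refine hbad ⟨hω.trans hqε, fun k => ?_, ?_⟩
  · by_contra h2
    exact hcon (Or.inl (Set.mem_iUnion.2 ⟨k, not_le.1 h2⟩))
  · by_contra h2
    exact hcon (Or.inr (not_le.1 h2))

end SparseLocalLaw

namespace SparseLocalLaw

/-! ### From the Stieltjes transform to the eigenvalue counting measure -/

open Matrix

theorem arctan_le_self {x : ℝ} (hx : 0 ≤ x) : Real.arctan x ≤ x := by
  rcases hx.eq_or_lt with rfl | hx
  · simp
  · have h := Real.lt_tan (Real.arctan_pos.2 hx) (Real.arctan_lt_pi_div_two x)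
    rw [Real.tan_arctan] at h
    exact h.le

theorem integral_poisson_kernel (a b x : ℝ) {η : ℝ} (hη : 0 < η) :
    ∫ E in a..b, η / ((x - E) ^ 2 + η ^ 2) =
      Real.arctan ((b - x) / η) - Real.arctan ((a - x) / η) := by
  have h : ∀ E ∈ Set.uIcc a b, HasDerivAt (fun E => Real.arctan ((E - x) / η))
      (η / ((x - E) ^ 2 + η ^ 2)) E := by
    intro E _
    have h1 : HasDerivAt (fun E => (E - x) / η) (1 / η) E :=
      ((hasDerivAt_id E).sub_const x).div_const η
    convert h1.arctan using 1
    have : (0 : ℝ) < (x - E) ^ 2 + η ^ 2 := by positivity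
    field_simp
    ring
  have hcont : Continuous fun E : ℝ => η / ((x - E) ^ 2 + η ^ 2) := by
    refine continuous_const.div (by fun_prop) fun E => ?_
    positivity
  exact intervalIntegral.integral_eq_sub_of_hasDerivAt h (hcont.intervalIntegrable _ _)

/-- The indicator function of `[a, b]`, smoothed at scale `η` by the Poisson kernel. -/
noncomputable def smoothIndicator (a b η x : ℝ) : ℝ :=
  (Real.arctan ((b - x) / η) - Real.arctan ((a - x) / η)) / Real.pi

/-- The Poisson kernel at scale `s`, normalized to have value one at zero. -/
noncomputable def poissonBump (s u : ℝ) : ℝ := s ^ 2 / (u ^ 2 + s ^ 2)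

theorem poissonBump_nonneg (s u : ℝ) : 0 ≤ poissonBump s u := by
  unfold poissonBump; positivity

theorem half_le_poissonBump {s u : ℝ} (hs : 0 < s) (hu : |u| ≤ s) : 1 / 2 ≤ poissonBump s u := by
  unfold poissonBump
  rw [div_le_div_iff₀ (by norm_num) (by positivity)]
  have := sq_le_sq' (by linarith [abs_nonneg u]) hu
  rw [sq_abs] at this
  linarith

theorem smoothIndicator_nonneg {a b η : ℝ} (hab : a ≤ b) (hη : 0 < η) (x : ℝ) :
    0 ≤ smoothIndicator a b η x := by
  refine div_nonneg (sub_nonneg.2 (Real.arctan_strictMono.monotone ?_)) Real.pi_pos.le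
  gcongr

theorem smoothIndicator_le_one (a b η x : ℝ) : smoothIndicator a b η x ≤ 1 := by
  unfold smoothIndicator
  rw [div_le_one Real.pi_pos]
  linarith [Real.arctan_lt_pi_div_two ((b - x) / η), Real.neg_pi_div_two_lt_arctan ((a - x) / η)]

/-- The addition formula turns the difference of arctangents into `arctan((p - r)/(1 + p r)) ≤ (p -
r)/(p r)`. The tail therefore decays like `η |I| / d²` far away, which makes it comparable to a
Poisson kernel of width `|I|`. -/
theorem smoothIndicator_le_of_gt {a b η x d : ℝ} (hab : a < b) (hη : 0 < η) (hd : 0 < d)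
    (hx : x = b + d ∨ x = a - d) :
    smoothIndicator a b η x ≤ η * (b - a) / (d * (d + (b - a))) := by
  have hab' : 0 < b - a := sub_pos.2 hab
  have key : Real.arctan ((d + (b - a)) / η) - Real.arctan (d / η) ≤
      η * (b - a) / (d * (d + (b - a))) := by
    set p := (d + (b - a)) / η with hp
    set r := d / η with hr
    have hp0 : 0 < p := by positivity
    have hr0 : 0 < r := by positivity
    have h1 : Real.arctan p - Real.arctan r = Real.arctan ((p + -r) / (1 - p * -r)) := by
      rw [← Real.arctan_add (by nlinarith [mul_pos hp0 hr0]), Real.arctan_neg, sub_eq_add_neg]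
    have hpr : 0 ≤ p + -r := by
      have : r ≤ p := by rw [hp, hr]; gcongr; linarith
      linarith
    have h2 : 0 ≤ (p + -r) / (1 - p * -r) := div_nonneg hpr (by nlinarith [mul_pos hp0 hr0])
    rw [h1]
    refine (arctan_le_self h2).trans ?_
    calc (p + -r) / (1 - p * -r) ≤ (p + -r) / (p * r) := by
          refine div_le_div_of_nonneg_left hpr (by positivity) ?_
          linarith
      _ = _ := by rw [hp, hr]; field_simp; ring
  have h0 : 0 ≤ η * (b - a) / (d * (d + (b - a))) := by positivity
  have hval : Real.arctan ((b - x) / η) - Real.arctan ((a - x) / η) =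
      Real.arctan ((d + (b - a)) / η) - Real.arctan (d / η) := by
    rcases hx with hx | hx
    · have e1 : (b - x) / η = -(d / η) := by rw [hx]; ring
      have e2 : (a - x) / η = -((d + (b - a)) / η) := by rw [hx]; ring
      rw [e1, e2, Real.arctan_neg, Real.arctan_neg]; ring
    · have e1 : (b - x) / η = (d + (b - a)) / η := by rw [hx]; ring
      have e2 : (a - x) / η = d / η := by rw [hx]; ring
      rw [e1, e2]
  unfold smoothIndicator
  rw [hval, div_le_iff₀ Real.pi_pos]
  exact key.trans (le_mul_of_one_le_right h0 (by linarith [Real.pi_gt_three]))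

theorem one_sub_smoothIndicator_le {a b η x κ : ℝ} (hη : 0 < η) (hκ : 0 < κ)
    (hxa : κ * η ≤ x - a) (hxb : κ * η ≤ b - x) :
    1 - smoothIndicator a b η x ≤ 2 / κ := by
  have key : ∀ w : ℝ, κ * η ≤ w → Real.pi / 2 - Real.arctan (w / η) ≤ 1 / κ := by
    intro w hw
    have hw0 : 0 < w := lt_of_lt_of_le (by positivity) hw
    rw [← Real.arctan_inv_of_pos (by positivity)]
    refine (arctan_le_self (by positivity)).trans ?_
    rw [inv_div, div_le_div_iff₀ hw0 hκ]
    linarith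
  have h1 := key _ hxa
  have h2 := key _ hxb
  have e1 : (a - x) / η = -((x - a) / η) := by ring
  unfold smoothIndicator
  rw [e1, Real.arctan_neg, sub_le_iff_le_add, ← sub_le_iff_le_add', le_div_iff₀ Real.pi_pos]
  have h3 : 2 / κ = 2 * (1 / κ) := by ring
  rw [h3]
  have h4 : 0 < 1 / κ := by positivity
  nlinarith [Real.pi_gt_three]

/-- Pointwise error of smoothing an indicator function, in terms of Poisson kernels. -/
theorem abs_indicator_sub_smoothIndicator_le {I : Set ℝ} {a b η κ : ℝ} (hab : a < b)
    (hI1 : Set.Ioo a b ⊆ I) (hI2 : I ⊆ Set.Icc a b) (hη : 0 < η) (hκ : 0 < κ)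
    (hκη : κ * η ≤ b - a) (x : ℝ) :
    |I.indicator 1 x - smoothIndicator a b η x| ≤ 2 * poissonBump (κ * η) (x - a) +
      2 * poissonBump (κ * η) (x - b) + 5 / κ * poissonBump (b - a) (x - a) := by
  have hab' : 0 < b - a := sub_pos.2 hab
  have hs : 0 < κ * η := by positivity
  have hg0 := smoothIndicator_nonneg hab.le hη x
  have hg1 := smoothIndicator_le_one a b η x
  have hA := poissonBump_nonneg (κ * η) (x - a)
  have hB := poissonBump_nonneg (κ * η) (x - b)
  have hC : 0 ≤ 5 / κ * poissonBump (b - a) (x - a) :=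
    mul_nonneg (by positivity) (poissonBump_nonneg _ _)
  have hi : I.indicator (1 : ℝ → ℝ) x = 0 ∨ I.indicator (1 : ℝ → ℝ) x = 1 := by
    by_cases hx : x ∈ I <;> simp [hx]
  have hle1 : |I.indicator 1 x - smoothIndicator a b η x| ≤ 1 := by
    rw [abs_le]
    rcases hi with h | h <;> rw [h] <;> constructor <;> linarith
  -- Near an endpoint the trivial error 1 is covered by twice a bump at scale `κη`. Elsewhere the
  -- smoothing error is of order `1/κ` times the bump of width `b - a`.
  by_cases hxa : |x - a| ≤ κ * η
  · have := half_le_poissonBump hs hxa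
    linarith
  by_cases hxb : |x - b| ≤ κ * η
  · have := half_le_poissonBump hs hxb
    linarith
  rw [not_le] at hxa hxb
  have hout : ∀ d, κ * η < d → (x = b + d ∨ x = a - d) → η * (b - a) / (d * (d + (b - a))) ≤
      5 / κ * poissonBump (b - a) (x - a) := by
    intro d hd hx
    have hd0 : 0 < d := hs.trans hd
    unfold poissonBump
    rw [div_mul_div_comm, div_le_div_iff₀ (by positivity) (by positivity)]
    set L := b - a with hL
    have hsq : (x - a) ^ 2 + L ^ 2 ≤ 2 * (d + L) ^ 2 := by
      rcases hx with hx | hx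
      · have : x - a = d + L := by rw [hx, hL]; ring
        rw [this]; nlinarith
      · have : x - a = -d := by rw [hx]; ring
        rw [this]; nlinarith [mul_pos hd0 hab']
    -- Uses `κη ≤ L` against `d` and `κη ≤ d` against `L`.
    have h1 : 2 * (κ * η) * (d + L) ≤ 4 * (L * d) := by nlinarith
    calc η * L * (κ * ((x - a) ^ 2 + L ^ 2)) = (κ * η * L) * ((x - a) ^ 2 + L ^ 2) := by ring
      _ ≤ (κ * η * L) * (2 * (d + L) ^ 2) := mul_le_mul_of_nonneg_left hsq (by positivity)
      _ = (L * (d + L)) * (2 * (κ * η) * (d + L)) := by ring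
      _ ≤ (L * (d + L)) * (4 * (L * d)) := mul_le_mul_of_nonneg_left h1 (by positivity)
      _ ≤ (L * (d + L)) * (5 * (L * d)) := by
          refine mul_le_mul_of_nonneg_left ?_ (by positivity)
          nlinarith [mul_pos hab' hd0]
      _ = _ := by ring
  rcases lt_or_ge x a with h1 | h1
  · have hx : x ∉ I := fun hx => absurd (hI2 hx).1 (not_le.2 h1)
    rw [abs_of_neg (sub_neg.2 h1)] at hxa
    rw [Set.indicator_of_notMem hx, zero_sub, abs_neg, abs_of_nonneg hg0]
    have h2 := smoothIndicator_le_of_gt hab hη (hs.trans hxa) (Or.inr (by ring : x = a - -(x - a)))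
    have h3 := hout _ hxa (Or.inr (by ring))
    linarith
  rcases lt_or_ge b x with h2 | h2
  · have hx : x ∉ I := fun hx => absurd (hI2 hx).2 (not_le.2 h2)
    rw [abs_of_pos (sub_pos.2 h2)] at hxb
    rw [Set.indicator_of_notMem hx, zero_sub, abs_neg, abs_of_nonneg hg0]
    have h3 := smoothIndicator_le_of_gt hab hη (hs.trans hxb) (Or.inl (by ring : x = b + (x - b)))
    have h4 := hout _ hxb (Or.inl (by ring))
    linarith
  · rw [abs_of_nonneg (sub_nonneg.2 h1)] at hxa
    rw [abs_of_nonpos (sub_nonpos.2 h2)] at hxb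
    have hx : x ∈ I := hI1 ⟨by linarith, by linarith⟩
    rw [Set.indicator_of_mem hx, Pi.one_apply, abs_of_nonneg (by linarith)]
    have h3 := one_sub_smoothIndicator_le hη hκ hxa.le (by linarith : κ * η ≤ b - x)
    have h4 : 1 / 2 ≤ poissonBump (b - a) (x - a) :=
      half_le_poissonBump hab' (by rw [abs_of_nonneg] <;> linarith)
    have h5 : 5 / κ * (1 / 2) ≤ 5 / κ * poissonBump (b - a) (x - a) :=
      mul_le_mul_of_nonneg_left h4 (by positivity)
    have h6 : 2 / κ ≤ 5 / κ * (1 / 2) := by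
      rw [div_mul_div_comm, div_le_div_iff₀ hκ (by positivity)]
      linarith
    linarith

variable {N : ℕ} {A : Matrix (Fin N) (Fin N) ℝ}

theorem empiricalMeasure_real (hA : A.IsHermitian) {I : Set ℝ} (hI : MeasurableSet I) :
    (empiricalMeasure hA).real I = (N : ℝ)⁻¹ * ∑ i, I.indicator (1 : ℝ → ℝ) (hA.eigenvalues i) := by
  rw [empiricalMeasure, Measure.real, Measure.smul_apply, Measure.finsetSum_apply, smul_eq_mul,
    ENNReal.toReal_mul, ENNReal.toReal_inv, ENNReal.toReal_natCast, ENNReal.toReal_sum]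
  · congr 1
    refine Finset.sum_congr rfl fun i _ => ?_
    rw [Measure.dirac_apply' _ hI]
    by_cases h : hA.eigenvalues i ∈ I <;> simp [h]
  · intro i _
    rw [Measure.dirac_apply' _ hI]
    by_cases h : hA.eigenvalues i ∈ I <;> simp [h]

theorem ae_eq_Ioc_of_subset {I : Set ℝ} {a b : ℝ} (hI1 : Set.Ioo a b ⊆ I)
    (hI2 : I ⊆ Set.Icc a b) : I =ᵐ[volume] Set.Ioc a b := by
  have h1 : Set.Ioo a b ≤ᵐ[volume] I := LE.le.eventuallyLE hI1
  have h2 : I ≤ᵐ[volume] Set.Icc a b := LE.le.eventuallyLE hI2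
  exact (h2.trans Ioc_ae_eq_Icc.symm.le).antisymm (Ioo_ae_eq_Ioc.symm.le.trans h1)

theorem semicircle_real {I : Set ℝ} {a b : ℝ} (hab : a ≤ b) (hI : MeasurableSet I)
    (hI1 : Set.Ioo a b ⊆ I) (hI2 : I ⊆ Set.Icc a b) :
    semicircle.real I = ∫ x in a..b, 1 / (2 * Real.pi) * √(max (4 - x ^ 2) 0) := by
  have hc : Continuous fun x : ℝ => 1 / (2 * Real.pi) * √(max (4 - x ^ 2) 0) := by fun_prop
  rw [intervalIntegral.integral_of_le hab, ← setIntegral_congr_set (ae_eq_Ioc_of_subset hI1 hI2),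
    semicircle, Measure.real, withDensity_apply _ hI, integral_eq_lintegral_of_nonneg_ae]
  · exact Filter.Eventually.of_forall fun x => by
      have := Real.pi_pos
      positivity
  · exact hc.aestronglyMeasurable

/-- This turns the smoothing errors into values of `Im m`, so the bootstrap bound on the resolvent
controls the number of eigenvalues near the endpoints. -/
theorem sum_poissonBump_eq (hA : A.IsHermitian) (E : ℝ) {s : ℝ} (hs : 0 < s) :
    (N : ℝ)⁻¹ * ∑ i, poissonBump s (hA.eigenvalues i - E) =
      s * (stieltjes A (E + s * Complex.I)).im := by
  rw [im_stieltjes_eq hA E hs.ne', mul_left_comm, Finset.mul_sum (s := Finset.univ) (a := s)]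
  congr 1
  refine Finset.sum_congr rfl fun i _ => ?_
  rw [poissonBump]
  ring

theorem sum_smoothIndicator_eq (hA : A.IsHermitian) (a b : ℝ) {η : ℝ} (hη : 0 < η) :
    (N : ℝ)⁻¹ * ∑ i, smoothIndicator a b η (hA.eigenvalues i) =
      (∫ E in a..b, (stieltjes A (E + η * Complex.I)).im) / Real.pi := by
  simp only [im_stieltjes_eq hA _ hη.ne']
  rw [intervalIntegral.integral_const_mul, intervalIntegral.integral_finsetSum]
  · simp only [integral_poisson_kernel _ _ _ hη, smoothIndicator]
    rw [← Finset.sum_div]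
    ring
  · intro i _
    refine Continuous.intervalIntegrable ?_ _ _
    refine continuous_const.div (by fun_prop) fun E => ?_
    positivity

theorem continuous_im_stieltjes (hA : A.IsHermitian) {η : ℝ} (hη : 0 < η) :
    Continuous fun E : ℝ => (stieltjes A (E + η * Complex.I)).im := by
  simp only [im_stieltjes_eq hA _ hη.ne']
  refine continuous_const.mul (continuous_finsetSum _ fun i _ => ?_)
  refine continuous_const.div (by fun_prop) fun E => ?_
  positivity

/-- Control of the Stieltjes transform at scale `η` gives control of the counting measure. -/
theorem abs_empiricalMeasure_sub_semicircle_le (hA : A.IsHermitian) {I : Set ℝ} {a b η κ τ C : ℝ}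
    (hI : MeasurableSet I) (hab : a < b) (hI1 : Set.Ioo a b ⊆ I) (hI2 : I ⊆ Set.Icc a b)
    (hη : 0 < η) (hκ : 0 < κ) (hκη : κ * η ≤ b - a)
    (hτ : ∀ E ∈ Set.Icc a b,
      |(stieltjes A (E + η * Complex.I)).im - √(max (4 - E ^ 2) 0) / 2| ≤ τ)
    (hCa : (stieltjes A (a + (κ * η : ℝ) * Complex.I)).im ≤ C)
    (hCb : (stieltjes A (b + (κ * η : ℝ) * Complex.I)).im ≤ C)
    (hCl : (stieltjes A (a + (b - a : ℝ) * Complex.I)).im ≤ C) :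
    |(empiricalMeasure hA).real I - semicircle.real I| ≤
      τ * (b - a) + 4 * (κ * η) * C + 5 / κ * (b - a) * C := by
  have hab' : 0 < b - a := sub_pos.2 hab
  have hs : 0 < κ * η := by positivity
  have hN0 : (0 : ℝ) ≤ (N : ℝ)⁻¹ := by positivity
  have h1 : |(empiricalMeasure hA).real I - (N : ℝ)⁻¹ * ∑ i, smoothIndicator a b η (hA.eigenvalues i)| ≤
      4 * (κ * η) * C + 5 / κ * (b - a) * C := by
    rw [empiricalMeasure_real hA hI, ← mul_sub, ← Finset.sum_sub_distrib, abs_mul, abs_of_nonneg hN0]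
    calc (N : ℝ)⁻¹ * |∑ i, (I.indicator 1 (hA.eigenvalues i) -
          smoothIndicator a b η (hA.eigenvalues i))|
        ≤ (N : ℝ)⁻¹ * ∑ i, (2 * poissonBump (κ * η) (hA.eigenvalues i - a) +
          2 * poissonBump (κ * η) (hA.eigenvalues i - b) +
            5 / κ * poissonBump (b - a) (hA.eigenvalues i - a)) :=
          mul_le_mul_of_nonneg_left ((Finset.abs_sum_le_sum_abs _ _).trans
            (Finset.sum_le_sum fun i _ =>
              abs_indicator_sub_smoothIndicator_le hab hI1 hI2 hη hκ hκη _)) hN0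
      _ = 2 * ((N : ℝ)⁻¹ * ∑ i, poissonBump (κ * η) (hA.eigenvalues i - a)) +
          2 * ((N : ℝ)⁻¹ * ∑ i, poissonBump (κ * η) (hA.eigenvalues i - b)) +
            5 / κ * ((N : ℝ)⁻¹ * ∑ i, poissonBump (b - a) (hA.eigenvalues i - a)) := by
          simp only [Finset.sum_add_distrib, ← Finset.mul_sum]; ring
      _ ≤ 2 * (κ * η * C) + 2 * (κ * η * C) + 5 / κ * ((b - a) * C) := by
          rw [sum_poissonBump_eq hA a hs, sum_poissonBump_eq hA b hs, sum_poissonBump_eq hA a hab']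
          gcongr
      _ = _ := by ring
  have h2 : |(N : ℝ)⁻¹ * ∑ i, smoothIndicator a b η (hA.eigenvalues i) - semicircle.real I| ≤
      τ * (b - a) := by
    have hc1 := (continuous_im_stieltjes hA hη).intervalIntegrable (μ := volume) a b
    have hc2 : IntervalIntegrable (fun E : ℝ => √(max (4 - E ^ 2) 0) / 2) volume a b :=
      Continuous.intervalIntegrable (by fun_prop) _ _
    have e1 : ∫ x in a..b, 1 / (2 * Real.pi) * √(max (4 - x ^ 2) 0) =
        (∫ E in a..b, √(max (4 - E ^ 2) 0) / 2) / Real.pi := by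
      rw [← intervalIntegral.integral_div]
      refine intervalIntegral.integral_congr fun x _ => ?_
      field_simp
    rw [sum_smoothIndicator_eq hA a b hη, semicircle_real hab.le hI hI1 hI2, e1, ← sub_div,
      ← intervalIntegral.integral_sub hc1 hc2, abs_div, abs_of_pos Real.pi_pos,
      div_le_iff₀ Real.pi_pos]
    have h3 := intervalIntegral.norm_integral_le_of_norm_le_const (a := a) (b := b) (C := τ)
      (f := fun E : ℝ => (stieltjes A (E + η * Complex.I)).im - √(max (4 - E ^ 2) 0) / 2)
      (fun E hE => by
        rw [Set.uIoc_of_le hab.le] at hE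
        exact hτ E ⟨hE.1.le, hE.2⟩)
    rw [abs_of_pos hab', Real.norm_eq_abs] at h3
    have hτ0 : 0 ≤ τ := (abs_nonneg _).trans (hτ a ⟨le_rfl, hab.le⟩)
    refine h3.trans (le_mul_of_one_le_right (by positivity) (by linarith [Real.pi_gt_three]))
  have h3 := abs_sub_le ((empiricalMeasure hA).real I)
    ((N : ℝ)⁻¹ * ∑ i, smoothIndicator a b η (hA.eigenvalues i)) (semicircle.real I)
  linarith

end SparseLocalLaw

namespace SparseLocalLaw

/-! ### Discretization of the spectral parameter and deterministic conclusion -/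

open Matrix

variable {N : ℕ}

/-- The kernel is the imaginary part of a resolvent `1/d(E)` with `|d| ≥ η`, so the Lipschitz
constant `1/η²` follows from the resolvent identity. -/
theorem abs_poisson_sub_le (x E E' : ℝ) {η : ℝ} (hη : 0 < η) :
    |η / ((x - E) ^ 2 + η ^ 2) - η / ((x - E') ^ 2 + η ^ 2)| ≤ |E - E'| / η ^ 2 := by
  set d : ℝ → ℂ := fun E => (x : ℂ) - (E + η * Complex.I) with hd
  have hnorm : ∀ E, η ≤ ‖d E‖ := by
    intro E
    have : |(d E).im| = η := by simp [hd, abs_of_pos hη]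
    rw [← this]
    exact Complex.abs_im_le_norm _
  have h0 : ∀ E, d E ≠ 0 := fun E h => by
    have := hnorm E
    rw [h, norm_zero] at this
    linarith
  have h1 : (d E)⁻¹ - (d E')⁻¹ = ((E - E' : ℝ) : ℂ) / (d E * d E') := by
    rw [inv_sub_inv (h0 E) (h0 E')]
    congr 1
    simp [hd]
  rw [← im_inv_ofReal_sub, ← im_inv_ofReal_sub, ← Complex.sub_im]
  refine (Complex.abs_im_le_norm _).trans ?_
  change ‖(d E)⁻¹ - (d E')⁻¹‖ ≤ _
  rw [h1, norm_div, norm_mul, Complex.norm_real, Real.norm_eq_abs]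
  refine div_le_div_of_nonneg_left (abs_nonneg _) (by positivity) ?_
  rw [sq]
  exact mul_le_mul (hnorm E) (hnorm E') hη.le (norm_nonneg _)

theorem abs_im_stieltjes_sub_le {A : Matrix (Fin N) (Fin N) ℝ} (hA : A.IsHermitian) (E E' : ℝ)
    {η : ℝ} (hη : 0 < η) :
    |(stieltjes A (E + η * Complex.I)).im - (stieltjes A (E' + η * Complex.I)).im| ≤
      |E - E'| / η ^ 2 := by
  rw [im_stieltjes_eq hA E hη.ne', im_stieltjes_eq hA E' hη.ne', ← mul_sub,
    ← Finset.sum_sub_distrib, abs_mul, abs_of_nonneg (by positivity)]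
  rcases Nat.eq_zero_or_pos N with h0 | h0
  · subst h0; simp; positivity
  · rw [inv_mul_le_iff₀ (by positivity)]
    refine (Finset.abs_sum_le_sum_abs _ _).trans ((Finset.sum_le_sum fun i _ =>
      abs_poisson_sub_le _ E E' hη).trans ?_)
    simp

theorem abs_max_four_sub_sq_sub_le (E E' : ℝ) :
    |max (4 - E ^ 2) 0 - max (4 - E' ^ 2) 0| ≤ 4 * |E - E'| := by
  have key : ∀ E E' : ℝ, max (4 - E ^ 2) 0 - max (4 - E' ^ 2) 0 ≤ 4 * |E - E'| := by
    intro E E'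
    rcases le_total (4 - E ^ 2) 0 with h | h
    · rw [max_eq_right h]
      have := le_max_right (4 - E' ^ 2) 0
      have := abs_nonneg (E - E')
      linarith
    · rw [max_eq_left h]
      have hE := abs_le_of_sq_le_sq' (by linarith : E ^ 2 ≤ 2 ^ 2) (by norm_num)
      have h1 := le_max_left (4 - E' ^ 2) 0
      have h2 := le_max_right (4 - E' ^ 2) 0
      rcases le_total 2 E' with h3 | h3
      · have := neg_abs_le (E - E')
        nlinarith
      rcases le_total E' (-2) with h4 | h4
      · have := le_abs_self (E - E')
        nlinarith
      · rcases le_total 0 (E - E') with h5 | h5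
        · rw [abs_of_nonneg h5]; nlinarith
        · rw [abs_of_nonpos h5]; nlinarith
  rw [abs_le]
  have h1 := key E E'
  have h2 := key E' E
  rw [abs_sub_comm] at h2
  constructor <;> linarith

theorem abs_sqrt_sub_sqrt_le {x y : ℝ} (hx : 0 ≤ x) (hy : 0 ≤ y) : |√x - √y| ≤ √|x - y| := by
  refine Real.le_sqrt_of_sq_le ?_
  have h1 : |√x - √y| ≤ √x + √y := by
    rw [abs_le]
    constructor <;> linarith [Real.sqrt_nonneg x, Real.sqrt_nonneg y]
  calc |√x - √y| ^ 2 ≤ |√x - √y| * (√x + √y) := by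
        rw [sq]; exact mul_le_mul_of_nonneg_left h1 (abs_nonneg _)
    _ = |x - y| := by
        have : x - y = (√x - √y) * (√x + √y) := by
          have := Real.sq_sqrt hx
          have := Real.sq_sqrt hy
          linarith
        rw [this, abs_mul, abs_of_nonneg (by positivity : 0 ≤ √x + √y)]

theorem abs_im_stieltjes_adjacencyMatrix_sub_le {H : Matrix (Fin N) (Fin N) ℝ}
    (hH : H.IsHermitian) {f : ℝ} (hf : 0 ≤ f) (E : ℝ) {η : ℝ} (hη : 0 < η) :
    |(stieltjes (adjacencyMatrix f H) (E + η * Complex.I)).im -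
      (stieltjes H (E + η * Complex.I)).im| ≤ 1 / (N * η) := by
  rw [← Complex.sub_im]
  refine (Complex.abs_im_le_norm _).trans ?_
  have him : ((E : ℂ) + η * Complex.I).im = η := by simp
  have h1 := norm_sum_res_add_rank_one_sub_le (z := E + η * Complex.I) hH
    (adjacencyMatrix_isHermitian f hH) (by rw [him]; exact hη) hf (unitVec N)
    (fun k l => by simp [adjacencyMatrix, Matrix.vecMulVec_apply])
  rw [him] at h1
  rw [stieltjes, stieltjes, ← mul_sub, norm_mul, norm_inv, Complex.norm_natCast]
  calc _ ≤ (N : ℝ)⁻¹ * (1 / η) := mul_le_mul_of_nonneg_left h1 (by positivity)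
    _ = _ := by field_simp

/-- The spectral parameters `(E, η)` at which the Stieltjes transform has to be controlled. -/
noncomputable def spectralPoints (N : ℕ) (a b κ η : ℝ) : Finset (ℝ × ℝ) :=
  {(a, κ * η), (b, κ * η), (a, b - a)} ∪
    (Finset.range (N ^ 4 + 1)).image fun j : ℕ => (a + (b - a) * ((j : ℝ) / (N : ℝ) ^ 4), η)

theorem card_spectralPoints_le (N : ℕ) (a b κ η : ℝ) :
    (spectralPoints N a b κ η).card ≤ N ^ 4 + 4 := by
  refine (Finset.card_union_le _ _).trans ?_
  have h1 : ({(a, κ * η), (b, κ * η), (a, b - a)} : Finset (ℝ × ℝ)).card ≤ 3 :=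
    Finset.card_le_three
  have h2 : ((Finset.range (N ^ 4 + 1)).image fun j : ℕ =>
      (a + (b - a) * ((j : ℝ) / (N : ℝ) ^ 4), η)).card ≤ N ^ 4 + 1 := by
    simpa using Finset.card_image_le (s := Finset.range (N ^ 4 + 1))
      (f := fun j : ℕ => (a + (b - a) * ((j : ℝ) / (N : ℝ) ^ 4), η))
  omega

theorem exists_grid_point {a b E : ℝ} (hab : a < b) (hE : E ∈ Set.Icc a b) {n : ℕ} (hn : 0 < n) :
    ∃ j ∈ Finset.range (n + 1), |E - (a + (b - a) * (j / n))| ≤ (b - a) / n := by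
  have hab' : 0 < b - a := sub_pos.2 hab
  have hn' : (0 : ℝ) < n := by exact_mod_cast hn
  set u := (E - a) / (b - a) * n with hu
  have hu0 : 0 ≤ u := mul_nonneg (div_nonneg (by linarith [hE.1]) hab'.le) hn'.le
  have hun : u ≤ n := by
    refine mul_le_of_le_one_left hn'.le ?_
    rw [div_le_one hab']
    linarith [hE.2]
  refine ⟨⌊u⌋₊, ?_, ?_⟩
  · rw [Finset.mem_range]
    have : (⌊u⌋₊ : ℝ) ≤ n := (Nat.floor_le hu0).trans hun
    have : ⌊u⌋₊ ≤ n := by exact_mod_cast this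
    omega
  · have h1 := Nat.floor_le hu0
    have h2 := Nat.lt_floor_add_one u
    have h3 : E - (a + (b - a) * (⌊u⌋₊ / n)) = (b - a) / n * (u - ⌊u⌋₊) := by
      rw [hu]; field_simp; ring
    rw [h3, abs_of_nonneg (mul_nonneg (by positivity) (by linarith))]
    exact mul_le_of_le_one_right (by positivity) (by linarith)

/-- Concentration of all rows at all the spectral points implies the local law on `[a, b]`. -/
theorem abs_empiricalMeasure_sub_semicircle_le_of_rowConcentrated
    {H : Matrix (Fin N) (Fin N) ℝ} (hH : H.IsHermitian) {f δ ε η a b : ℝ} (hf : 0 ≤ f)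
    (hδ0 : 0 < δ) (hδ1 : δ < 1) (hε : ε = δ ^ 2 / 10 ^ 7) (hN0 : 0 < N) (hNε : (N : ℝ)⁻¹ ≤ ε)
    (hab : a < b) (hbaN : b - a ≤ N) (hη : η = δ ^ 2 * min (b - a) 1 / 10 ^ 6)
    (hNη : 1 / (N * η) ≤ δ / 100) {I : Set ℝ} (hI : MeasurableSet I) (hI1 : Set.Ioo a b ⊆ I)
    (hI2 : I ⊆ Set.Icc a b)
    (h : ∀ p ∈ spectralPoints N a b (360 / δ) η, ∀ j ≤ N, ∀ i,
      RowConcentrated H (p.1 + (2 ^ j * p.2 : ℝ) * Complex.I) ε i) :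
    |(empiricalMeasure (adjacencyMatrix_isHermitian f hH)).real I - semicircle.real I| ≤
      δ * (b - a) := by
  have hab' : 0 < b - a := sub_pos.2 hab
  have hN : (0 : ℝ) < N := by exact_mod_cast hN0
  have hmin0 : 0 < min (b - a) 1 := lt_min hab' one_pos
  have hη0 : 0 < η := by rw [hη]; positivity
  have hδ2 : δ ^ 2 ≤ 1 := pow_le_one₀ hδ0.le hδ1.le
  have hδ2' : δ ^ 2 ≤ δ := by nlinarith
  have hηba : η ≤ δ ^ 2 * (b - a) / 10 ^ 6 := by
    rw [hη]
    have := min_le_left (b - a) 1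
    gcongr
  have hη1 : η ≤ δ ^ 2 / 10 ^ 6 := by
    rw [hη]
    have := min_le_right (b - a) 1
    calc δ ^ 2 * min (b - a) 1 / 10 ^ 6 ≤ δ ^ 2 * 1 / 10 ^ 6 := by gcongr
      _ = _ := by rw [mul_one]
  have hηlt1 : η < 1 := by linarith
  have hε7 : ε ≤ 1 / 10 ^ 7 := by
    rw [hε]; gcongr
  have hηN : 1 / η ≤ N := by
    have h1 : 1 / (N * η) ≤ 1 := hNη.trans (by linarith)
    rw [div_le_one (by positivity)] at h1
    rw [div_le_iff₀ hη0]; exact h1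
  -- Taking `J = N` dyadic scales is wasteful but costs only a factor `N + 1` in the union bound.
  have hJ : ∀ s, η ≤ s → 1 ≤ 2 ^ N * s := by
    intro s hs
    have h1 : (N : ℝ) ≤ 2 ^ N := by exact_mod_cast Nat.lt_two_pow_self.le
    rw [div_le_iff₀ hη0] at hηN
    calc 1 ≤ N * η := hηN
      _ ≤ 2 ^ N * s := by gcongr
  have hκ : 0 < 360 / δ := by positivity
  have hκη : 360 / δ * η ≤ b - a := by
    rw [div_mul_eq_mul_div, div_le_iff₀ hδ0]
    nlinarith
  have hκη' : η ≤ 360 / δ * η := le_mul_of_one_le_left hη0.le (by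
    rw [le_div_iff₀ hδ0]; linarith)
  have hηba' : η ≤ b - a := hκη'.trans hκη
  have hbound : ∀ E s, (E, s) ∈ spectralPoints N a b (360 / δ) η → η ≤ s →
      (stieltjes (adjacencyMatrix f H) (E + s * Complex.I)).im ≤ 9 := by
    intro E s hp hs
    have hs0 : 0 < s := hη0.trans_le hs
    have h1 := (im_stieltjes_bounds hH hε7 hN0 hNε hs0 (hJ s hs) (h _ hp)).1
    have h2 := (le_abs_self _).trans (abs_im_stieltjes_adjacencyMatrix_sub_le hH hf E hs0)
    have h3 : 1 / (N * s) ≤ 1 / (N * η) := by gcongr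
    linarith
  -- This fixes `ε` and `η` at order `δ²`: the self-consistency error is taken under a square root.
  have hsq : √(24576 * ε + 8 * η) ≤ 0.05 * δ := by
    refine Real.sqrt_le_iff.2 ⟨by positivity, ?_⟩
    rw [hε]
    nlinarith
  have hNδ : 1 / (N : ℝ) ≤ δ / 200 := by
    rw [one_div]
    refine hNε.trans ?_
    rw [hε]; nlinarith
  have hτ : ∀ E ∈ Set.Icc a b,
      |(stieltjes (adjacencyMatrix f H) (E + η * Complex.I)).im - √(max (4 - E ^ 2) 0) / 2| ≤
        0.07 * δ := by
    intro E hE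
    obtain ⟨j, hj, hjE⟩ := exists_grid_point hab hE (pow_pos hN0 4)
    push_cast at hjE
    set E' := a + (b - a) * ((j : ℝ) / (N : ℝ) ^ 4) with hE'
    have hp : (E', η) ∈ spectralPoints N a b (360 / δ) η :=
      Finset.mem_union_right _ (Finset.mem_image.2 ⟨j, hj, rfl⟩)
    -- Length at most `N` and `N⁴` cells give spacing `N⁻³`, enough to absorb the Lipschitz constant
    -- `1/η² ≤ N²`.
    have hdist : |E - E'| ≤ 1 / (N : ℝ) ^ 3 := by
      refine hjE.trans ?_
      rw [div_le_div_iff₀ (by positivity) (by positivity)]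
      calc (b - a) * (N : ℝ) ^ 3 ≤ N * (N : ℝ) ^ 3 := by gcongr
        _ = _ := by ring
    have h1 := (im_stieltjes_bounds hH hε7 hN0 hNε hη0 (hJ η le_rfl) (h _ hp)).2 hηlt1
    have h2 := abs_im_stieltjes_adjacencyMatrix_sub_le hH hf E' hη0
    have h3 := abs_im_stieltjes_sub_le (adjacencyMatrix_isHermitian f hH) E E' hη0
    have h4 : |E - E'| / η ^ 2 ≤ 1 / N := by
      calc |E - E'| / η ^ 2 = |E - E'| * (1 / η) ^ 2 := by field_simp
        _ ≤ 1 / (N : ℝ) ^ 3 * (N : ℝ) ^ 2 := by gcongr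
        _ = 1 / N := by field_simp
    have hN1 : (1 : ℝ) ≤ N := by exact_mod_cast hN0
    have h5 : |√(max (4 - E' ^ 2) 0) / 2 - √(max (4 - E ^ 2) 0) / 2| ≤ 1 / N := by
      rw [← sub_div, abs_div, abs_two, div_le_iff₀ two_pos]
      refine (abs_sqrt_sub_sqrt_le (le_max_right _ _) (le_max_right _ _)).trans ?_
      refine Real.sqrt_le_iff.2 ⟨by positivity, ?_⟩
      have h6 := abs_max_four_sub_sq_sub_le E' E
      rw [abs_sub_comm E' E] at h6
      have h7 : 1 / (N : ℝ) ^ 3 ≤ 1 / (N : ℝ) ^ 2 :=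
        one_div_le_one_div_of_le (by positivity) (pow_le_pow_right₀ hN1 (by norm_num))
      calc _ ≤ 4 * |E - E'| := h6
        _ ≤ 4 * (1 / (N : ℝ) ^ 2) := by linarith
        _ = _ := by ring
    have h6 := abs_sub_le (stieltjes (adjacencyMatrix f H) (E + η * Complex.I)).im
      (stieltjes (adjacencyMatrix f H) (E' + η * Complex.I)).im (√(max (4 - E ^ 2) 0) / 2)
    have h7 := abs_sub_le (stieltjes (adjacencyMatrix f H) (E' + η * Complex.I)).im
      (stieltjes H (E' + η * Complex.I)).im (√(max (4 - E ^ 2) 0) / 2)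
    have h8 := abs_sub_le (stieltjes H (E' + η * Complex.I)).im (√(max (4 - E' ^ 2) 0) / 2)
      (√(max (4 - E ^ 2) 0) / 2)
    simp only at h1
    linarith
  have hmain := abs_empiricalMeasure_sub_semicircle_le (adjacencyMatrix_isHermitian f hH) hI hab
    hI1 hI2 hη0 hκ hκη hτ
    (hbound a _ (Finset.mem_union_left _ (by simp)) hκη')
    (hbound b _ (Finset.mem_union_left _ (by simp)) hκη')
    (hbound a _ (Finset.mem_union_left _ (by simp)) hηba')
  refine hmain.trans ?_
  -- With `C = 9`, the wide bump costs `δ/8`, the endpoint bumps about `0.013 δ` and the integral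
  -- `0.07 δ`, each times `b - a`.
  have h1 : 5 / (360 / δ) = δ / 72 := by field_simp; norm_num
  have h2 : 360 / δ * η ≤ 360 * δ * (b - a) / 10 ^ 6 := by
    calc 360 / δ * η ≤ 360 / δ * (δ ^ 2 * (b - a) / 10 ^ 6) := by gcongr
      _ = _ := by field_simp
  rw [h1]
  have h3 : 0 < δ * (b - a) := mul_pos hδ0 hab'
  linarith

end SparseLocalLaw

namespace SparseLocalLaw

/-! ### Choice of parameters and proof of the local law -/

open Matrix

/-! ### Union bound over spectral points, scales and rows -/

section Union

variable {Ω : Type*} [MeasurableSpace Ω] {P : Measure Ω} [IsProbabilityMeasure P] {N : ℕ}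
  {q K : ℝ} {H : Ω → Matrix (Fin N) (Fin N) ℝ}

theorem IsSparseMatrix.measure_exists_not_rowConcentrated_le (hH : IsSparseMatrix P q K H)
    (hq : 1 ≤ q) {η ε r : ℝ} (hη : 0 < η) (S : Finset (ℝ × ℝ)) (hS : ∀ p ∈ S, η ≤ p.2)
    (hqε : 1 / q ≤ ε) (hε1 : ε ≤ 1) (hr : 0 ≤ r)
    (hV : r ^ 2 * Real.exp (r * (1 / q)) * (1 / N) * (64 * (1 / η) / (1 / q) ^ 2) ≤ 1) :
    P {ω | ¬ ∀ p ∈ S, ∀ j ≤ N, ∀ i,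
      RowConcentrated (H ω) (p.1 + (2 ^ j * p.2 : ℝ) * Complex.I) ε i} ≤
      ENNReal.ofReal (S.card * ((N + 1) * (N * (2 * deviationBound N q r (ε / 8))))) := by
  set B : ENNReal := 2 * ENNReal.ofReal (deviationBound N q r (ε / 8)) with hB
  set F : ℝ × ℝ → ℕ → Fin N → Set Ω := fun p j i =>
    {ω | ¬ RowConcentrated (H ω) (p.1 + (2 ^ j * p.2 : ℝ) * Complex.I) ε i} with hF
  have hsub : {ω | ¬ ∀ p ∈ S, ∀ j ≤ N, ∀ i,
      RowConcentrated (H ω) (p.1 + (2 ^ j * p.2 : ℝ) * Complex.I) ε i} ⊆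
      ⋃ p ∈ S, ⋃ j ∈ Finset.range (N + 1), ⋃ i ∈ (Finset.univ : Finset (Fin N)), F p j i := by
    intro ω hω
    by_contra hcon
    refine hω fun p hp j hj i => ?_
    by_contra h
    refine hcon ?_
    simp only [Set.mem_iUnion]
    exact ⟨p, hp, j, Finset.mem_range.2 (by omega), i, Finset.mem_univ i, h⟩
  have hone : ∀ p ∈ S, ∀ j i, P (F p j i) ≤ B := by
    intro p hp j i
    -- The variance condition is monotone in the scale, so checking it at the smallest scale `η`
    -- suffices.
    have hle : η ≤ 2 ^ j * p.2 := (hS p hp).trans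
      (le_mul_of_one_le_left (hη.le.trans (hS p hp)) (one_le_pow₀ one_le_two))
    have him : ((p.1 : ℂ) + (2 ^ j * p.2 : ℝ) * Complex.I).im = 2 ^ j * p.2 := by
      simp only [Complex.add_im, Complex.ofReal_im, Complex.im_ofReal_mul, Complex.I_im]; ring
    refine hH.measure_not_rowConcentrated_le hq (by rw [him]; linarith) i hqε hε1 hr ?_
    refine le_trans ?_ hV
    rw [him]
    gcongr
  calc _ ≤ _ := measure_mono hsub
    _ ≤ ∑ p ∈ S, ∑ j ∈ Finset.range (N + 1), ∑ i : Fin N, P (F p j i) := by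
        refine (measure_biUnion_finset_le _ _).trans (Finset.sum_le_sum fun p _ => ?_)
        refine (measure_biUnion_finset_le _ _).trans (Finset.sum_le_sum fun j _ => ?_)
        exact measure_biUnion_finset_le _ _
    _ ≤ ∑ p ∈ S, ∑ j ∈ Finset.range (N + 1), ∑ i : Fin N, B :=
        Finset.sum_le_sum fun p hp => Finset.sum_le_sum fun j _ => Finset.sum_le_sum fun i _ =>
          hone p hp j i
    _ = _ := by
        simp only [Finset.sum_const, Finset.card_univ, Finset.card_range, Fintype.card_fin,
          nsmul_eq_mul]
        have h0 : 0 ≤ deviationBound N q r (ε / 8) := by unfold deviationBound; positivity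
        rw [ENNReal.ofReal_mul (by positivity), ENNReal.ofReal_mul (by positivity),
          ENNReal.ofReal_mul (by positivity), ENNReal.ofReal_mul (by positivity), hB,
          ENNReal.ofReal_natCast, ENNReal.ofReal_natCast,
          show ((N : ℝ) + 1) = ((N + 1 : ℕ) : ℝ) by push_cast; rfl, ENNReal.ofReal_natCast]
        simp

end Union

/-! ### Intervals and trivial bounds -/

section Interval

theorem exists_Ioo_subset_of_ordConnected {I : Set ℝ} (hI : I.OrdConnected)
    (htop : volume I ≠ ⊤) (hpos : volume I ≠ 0) :
    ∃ a b, a < b ∧ Set.Ioo a b ⊆ I ∧ I ⊆ Set.Icc a b ∧ volume I = ENNReal.ofReal (b - a) := by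
  obtain ⟨x, hx⟩ : I.Nonempty := nonempty_of_measure_ne_zero hpos
  have hA : BddAbove I := by
    by_contra h
    refine htop (top_le_iff.1 ?_)
    rw [← Real.volume_Ici (a := x)]
    refine measure_mono fun y hy => ?_
    obtain ⟨w, hw, hyw⟩ := not_bddAbove_iff.1 h y
    exact hI.out hx hw ⟨hy, hyw.le⟩
  have hB : BddBelow I := by
    by_contra h
    refine htop (top_le_iff.1 ?_)
    rw [← Real.volume_Iic (a := x)]
    refine measure_mono fun y hy => ?_
    obtain ⟨w, hw, hyw⟩ := not_bddBelow_iff.1 h y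
    exact hI.out hw hx ⟨hyw.le, hy⟩
  have h1 : Set.Ioo (sInf I) (sSup I) ⊆ I := by
    intro y hy
    obtain ⟨u, hu, huy⟩ := exists_lt_of_csInf_lt ⟨x, hx⟩ hy.1
    obtain ⟨w, hw, hyw⟩ := exists_lt_of_lt_csSup ⟨x, hx⟩ hy.2
    exact hI.out hu hw ⟨huy.le, hyw.le⟩
  have h2 : I ⊆ Set.Icc (sInf I) (sSup I) := fun y hy => ⟨csInf_le hB hy, le_csSup hA hy⟩
  have h3 : volume I = ENNReal.ofReal (sSup I - sInf I) := by
    rw [measure_congr (ae_eq_Ioc_of_subset h1 h2), Real.volume_Ioc]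
  refine ⟨sInf I, sSup I, ?_, h1, h2, h3⟩
  by_contra h
  exact hpos (by rw [h3, ENNReal.ofReal_eq_zero]; linarith)

/-- The crude total mass 2, from density at most `1/2` on `[-2, 2]`, is enough: it only serves
intervals with `δ |I| ≥ 2`, where the claim is trivial. -/
theorem semicircle_real_le (I : Set ℝ) : semicircle.real I ≤ 2 := by
  have hdens : ∀ x : ℝ, ENNReal.ofReal (1 / (2 * Real.pi) * √(max (4 - x ^ 2) 0)) ≤
      (Set.Icc (-2 : ℝ) 2).indicator (fun _ => ENNReal.ofReal (1 / 2)) x := by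
    intro x
    by_cases hx : x ∈ Set.Icc (-2 : ℝ) 2
    · rw [Set.indicator_of_mem hx]
      refine ENNReal.ofReal_le_ofReal ?_
      have h1 : √(max (4 - x ^ 2) 0) ≤ 2 := by
        refine Real.sqrt_le_iff.2 ⟨by norm_num, max_le ?_ (by norm_num)⟩
        nlinarith [sq_nonneg x]
      have h2 := Real.pi_gt_three
      rw [div_mul_eq_mul_div, one_mul, div_le_div_iff₀ (by positivity) two_pos]
      linarith
    · rw [Set.indicator_of_notMem hx]
      have h1 : 4 - x ^ 2 ≤ 0 := by
        by_contra hcon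
        exact hx (abs_le_of_sq_le_sq' (by linarith : x ^ 2 ≤ 2 ^ 2) (by norm_num))
      rw [max_eq_right h1]; simp
  have h1 : semicircle I ≤ ENNReal.ofReal 2 := by
    calc semicircle I ≤ semicircle Set.univ := measure_mono (Set.subset_univ _)
      _ = ∫⁻ x : ℝ, ENNReal.ofReal (1 / (2 * Real.pi) * √(max (4 - x ^ 2) 0)) := by
          rw [semicircle, withDensity_apply _ MeasurableSet.univ, Measure.restrict_univ]
      _ ≤ ∫⁻ x : ℝ, (Set.Icc (-2 : ℝ) 2).indicator (fun _ => ENNReal.ofReal (1 / 2)) x :=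
          lintegral_mono hdens
      _ = ENNReal.ofReal 2 := by
          rw [lintegral_indicator measurableSet_Icc, setLIntegral_const, Real.volume_Icc,
            ← ENNReal.ofReal_mul (by norm_num)]
          norm_num
  have := ENNReal.toReal_mono ENNReal.ofReal_ne_top h1
  rwa [ENNReal.toReal_ofReal (by norm_num)] at this

theorem abs_empiricalMeasure_sub_semicircle_le_two {N : ℕ} {A : Matrix (Fin N) (Fin N) ℝ}
    (hA : A.IsHermitian) {I : Set ℝ} (hI : MeasurableSet I) :
    |(empiricalMeasure hA).real I - semicircle.real I| ≤ 2 := by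
  have h1 : (empiricalMeasure hA).real I ≤ 1 := by
    rw [empiricalMeasure_real hA hI]
    rcases Nat.eq_zero_or_pos N with h0 | h0
    · subst h0; simp
    · rw [inv_mul_le_iff₀ (by positivity), mul_one]
      calc ∑ i, I.indicator (1 : ℝ → ℝ) (hA.eigenvalues i) ≤ ∑ _i : Fin N, (1 : ℝ) :=
            Finset.sum_le_sum fun i _ => Set.indicator_le_self' (by simp) _
        _ = N := by simp
  have h2 : 0 ≤ (empiricalMeasure hA).real I := measureReal_nonneg
  have h3 := semicircle_real_le I
  have h4 : 0 ≤ semicircle.real I := measureReal_nonneg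
  rw [abs_le]
  constructor <;> linarith

end Interval

/-! ### Arithmetic of the parameters -/

section Parameters

/-- The arithmetic consequences of the hypotheses on `N` and `q` that are used in the proof; here
`s = √(log N)` and `L = 4 C⋆ e^{5+D} / δ`. -/
structure ParameterBounds (N : ℕ) (q δ D L s : ℝ) : Prop where
  N_pos : 0 < N
  s_ge : 300000 ≤ s
  log_N : Real.log N = s ^ 2
  L_le : L ≤ Real.exp (s / 20000)
  L_sq_ge : 16 * 10 ^ 12 * (1 + 2 * D) ≤ δ ^ 2 * L ^ 2
  L_ge : 4 * 10 ^ 6 / δ ≤ L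
  q_ge : L ^ 2 * s ≤ q
  q_le : q ≤ s ^ 20

theorem ParameterBounds.of_hyps {N : ℕ} {q δ D : ℝ} (hD : 0 < D) (hδ0 : 0 < δ) (hδ1 : δ < 1)
    (h1 : constC (10 ^ 6) δ D * √(Real.log N) ≤ q) (h2 : q ≤ Real.log N ^ 10)
    (h3 : constN₀ (10 ^ 6) δ D ≤ N) :
    ParameterBounds N q δ D (4 * 10 ^ 6 * Real.exp (5 + D) / δ) √(Real.log N) := by
  set L := 4 * 10 ^ 6 * Real.exp (5 + D) / δ with hL
  have hE1 : 1 ≤ Real.exp (5 + D) := Real.one_le_exp (by linarith)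
  have hL1 : 4 * 10 ^ 6 / δ ≤ L := by
    rw [hL]
    refine div_le_div_of_nonneg_right ?_ hδ0.le
    linarith
  have hL2 : 4 * 10 ^ 6 ≤ L := by
    refine le_trans ?_ hL1
    rw [le_div_iff₀ hδ0]
    linarith
  have hL0 : 0 < L := by linarith
  -- Since `e¹⁵ < 4 · 10⁶ ≤ L` and `e¹⁰ ≥ 20000`, the definition of `N₀` gives `s ≥ 20000 log L ≥
  -- 300000`.
  have hlogL : 15 ≤ Real.log L := by
    rw [Real.le_log_iff_exp_le hL0]
    refine le_trans ?_ hL2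
    have h4 : Real.exp 15 = Real.exp 1 ^ 15 := by rw [← Real.exp_nat_mul]; norm_num
    have h5 : Real.exp 1 ^ 15 ≤ 2.7182818286 ^ 15 :=
      pow_le_pow_left₀ (Real.exp_pos _).le Real.exp_one_lt_d9.le 15
    rw [h4]
    refine h5.trans ?_
    norm_num
  have he10 : 20000 ≤ Real.exp 10 := by
    have h4 : Real.exp 10 = Real.exp 1 ^ 10 := by rw [← Real.exp_nat_mul]; norm_num
    have h5 : (2.7 : ℝ) ^ 10 ≤ Real.exp 1 ^ 10 :=
      pow_le_pow_left₀ (by norm_num) (by linarith [Real.exp_one_gt_d9]) 10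
    rw [h4]
    refine le_trans ?_ h5
    norm_num
  have hN0 : (0 : ℝ) < N := (Real.exp_pos _).trans_le h3
  have hlogN : (Real.exp 10 * Real.log L) ^ 2 ≤ Real.log N := by
    rw [Real.le_log_iff_exp_le hN0]
    exact h3
  have hlog0 : 0 ≤ Real.log N := (sq_nonneg _).trans hlogN
  have hs : Real.exp 10 * Real.log L ≤ √(Real.log N) := Real.le_sqrt_of_sq_le hlogN
  have hs2 : 20000 * Real.log L ≤ √(Real.log N) := by
    refine le_trans ?_ hs
    exact mul_le_mul_of_nonneg_right he10 (by linarith)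
  refine ⟨by exact_mod_cast hN0, by linarith, (Real.sq_sqrt hlog0).symm, ?_, ?_, hL1, h1, ?_⟩
  · rw [← Real.log_le_iff_le_exp hL0]
    linarith
  · have h4 : δ ^ 2 * L ^ 2 = 16 * 10 ^ 12 * Real.exp (5 + D) ^ 2 := by
      rw [hL]; field_simp; norm_num
    rw [h4]
    refine mul_le_mul_of_nonneg_left ?_ (by norm_num)
    rw [← Real.exp_nat_mul]
    have := Real.add_one_le_exp ((2 : ℕ) * (5 + D))
    push_cast at this ⊢
    linarith
  · calc q ≤ Real.log N ^ 10 := h2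
      _ = (√(Real.log N) ^ 2) ^ 10 := by rw [Real.sq_sqrt hlog0]
      _ = _ := by rw [← pow_mul]

variable {N : ℕ} {q δ D L s : ℝ}

theorem ParameterBounds.N_eq (h : ParameterBounds N q δ D L s) : (N : ℝ) = Real.exp (s ^ 2) := by
  rw [← h.log_N, Real.exp_log]
  exact_mod_cast h.N_pos

theorem ParameterBounds.exp_le_N (h : ParameterBounds N q δ D L s) : Real.exp s ≤ N := by
  rw [h.N_eq]
  refine Real.exp_le_exp.2 ?_
  nlinarith [h.s_ge]

/-- The power 82 is what `q⁴ s²` becomes under `q ≤ s²⁰`. The step `s ≤ exp(s/328)` needs `s ≥ 2 ·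
328²`, which the lower bound on `s` covers. -/
theorem ParameterBounds.pow_le_exp (h : ParameterBounds N q δ D L s) :
    s ^ 82 ≤ Real.exp (s / 4) := by
  have hs := h.s_ge
  have h1 : s ≤ Real.exp (s / 328) := by
    have := Real.quadratic_le_exp_of_nonneg (x := s / 328) (by linarith)
    nlinarith
  calc s ^ 82 ≤ Real.exp (s / 328) ^ 82 := pow_le_pow_left₀ (by linarith) h1 82
    _ = Real.exp (s / 4) := by rw [← Real.exp_nat_mul]; congr 1; push_cast; ring

theorem ParameterBounds.L_pow_le (h : ParameterBounds N q δ D L s) (hδ0 : 0 < δ) :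
    L ^ 3 ≤ Real.exp (s / 4) := by
  have hs := h.s_ge
  have hL0 : 0 ≤ L := (by positivity : 0 ≤ 4 * 10 ^ 6 / δ).trans h.L_ge
  calc L ^ 3 ≤ Real.exp (s / 20000) ^ 3 := pow_le_pow_left₀ hL0 h.L_le 3
    _ = Real.exp (3 * (s / 20000)) := by rw [← Real.exp_nat_mul]; norm_num
    _ ≤ _ := Real.exp_le_exp.2 (by linarith)

theorem ParameterBounds.one_div_cube_le (h : ParameterBounds N q δ D L s) (hδ0 : 0 < δ) :
    10 ^ 19 / δ ^ 3 ≤ Real.exp (s / 4) := by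
  refine le_trans ?_ (h.L_pow_le hδ0)
  calc 10 ^ 19 / δ ^ 3 ≤ 64 * 10 ^ 18 / δ ^ 3 := by gcongr; norm_num
    _ = (4 * 10 ^ 6 / δ) ^ 3 := by rw [div_pow]; norm_num
    _ ≤ L ^ 3 := pow_le_pow_left₀ (by positivity) h.L_ge 3

/-- Here `q ≥ C(δ, D) √log N` enters: `q ε` exceeds a large multiple of `(1 + D) √log N`, because
the square `L²` in `C(δ, D)` beats both `δ⁻²` and a linear function of `D`. -/
theorem ParameterBounds.q_eps (h : ParameterBounds N q δ D L s) (hD : 0 < D) (hδ0 : 0 < δ) :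
    10 ^ 5 * (1 + D) * s ≤ q * (δ ^ 2 / 10 ^ 7) := by
  have hs := h.s_ge
  calc 10 ^ 5 * (1 + D) * s ≤ (16 * 10 ^ 12 * (1 + 2 * D)) / 10 ^ 7 * s := by
        refine mul_le_mul_of_nonneg_right ?_ (by linarith)
        linarith
    _ ≤ (δ ^ 2 * L ^ 2) / 10 ^ 7 * s := by
        refine mul_le_mul_of_nonneg_right ?_ (by linarith)
        exact div_le_div_of_nonneg_right h.L_sq_ge (by norm_num)
    _ = (L ^ 2 * s) * (δ ^ 2 / 10 ^ 7) := by ring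
    _ ≤ _ := mul_le_mul_of_nonneg_right h.q_ge (by positivity)

/-- With `r = q s/8` the Bennett exponent is `q ε s/64`, at least of order `(1 + D) s² = (1 + D) log
N`. The other two tails have exponents quadratic in `q`, at least of the same order. -/
theorem ParameterBounds.deviationBound_le (h : ParameterBounds N q δ D L s) (hD : 0 < D)
    (hδ0 : 0 < δ) (hδ1 : δ < 1) :
    deviationBound N q (q * s / 8) (δ ^ 2 / 10 ^ 7 / 8) ≤ 20 * N * (N : ℝ) ^ (-(D + 10)) := by
  have hs := h.s_ge
  have hqε := h.q_eps hD hδ0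
  have hN0 : (0 : ℝ) < N := by exact_mod_cast h.N_pos
  have hN1 : (1 : ℝ) ≤ N := by exact_mod_cast h.N_pos
  have hδ2 : δ ^ 2 ≤ 1 := pow_le_one₀ hδ0.le hδ1.le
  have hε0 : 0 < δ ^ 2 / 10 ^ 7 := by positivity
  have hε1 : δ ^ 2 / 10 ^ 7 ≤ 1 := by linarith
  have hq0 : 0 < q := by
    by_contra hcon
    have : q * (δ ^ 2 / 10 ^ 7) ≤ 0 := mul_nonpos_of_nonpos_of_nonneg (not_lt.1 hcon) hε0.le
    have : 0 < 10 ^ 5 * (1 + D) * s := by positivity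
    linarith
  set ε := δ ^ 2 / 10 ^ 7 with hε
  have hpow : (N : ℝ) ^ (-(D + 10)) = Real.exp (-((D + 10) * s ^ 2)) := by
    rw [Real.rpow_def_of_pos hN0, h.log_N]; congr 1; ring
  have hs2 : 1 ≤ s ^ 2 := one_le_pow₀ (by linarith)
  have hDs : 0 ≤ D * s ^ 2 := by positivity
  have hq2 : (10 ^ 5 * (1 + D) * s) ^ 2 ≤ (q * ε) ^ 2 := pow_le_pow_left₀ (by positivity) hqε 2
  have hsq : 10 ^ 10 * ((1 + D) * s ^ 2) ≤ (10 ^ 5 * (1 + D) * s) ^ 2 := by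
    have : (10 ^ 5 * (1 + D) * s) ^ 2 = 10 ^ 10 * ((1 + D) * s ^ 2) * (1 + D) := by ring
    rw [this]
    exact le_mul_of_one_le_right (by positivity) (by linarith)
  have e1 : Real.exp (1 - q * s / 8 * (ε / 8)) ≤ (N : ℝ) ^ (-(D + 10)) := by
    rw [hpow]
    refine Real.exp_le_exp.2 ?_
    have h1 : q * s / 8 * (ε / 8) = (q * ε) * s / 64 := by ring
    have h2 := mul_le_mul_of_nonneg_right hqε (by linarith : 0 ≤ s)
    rw [h1]
    nlinarith
  have e2 : Real.exp (-q ^ 2) ≤ (N : ℝ) ^ (-(D + 10)) := by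
    rw [hpow]
    refine Real.exp_le_exp.2 (neg_le_neg ?_)
    have h1 : (q * ε) ^ 2 ≤ q ^ 2 :=
      pow_le_pow_left₀ (by positivity) (mul_le_of_le_one_right hq0.le hε1) 2
    nlinarith
  have e3 : Real.exp (-((ε / 8) ^ 2 * q ^ 2 / 8)) ≤ (N : ℝ) ^ (-(D + 10)) := by
    rw [hpow]
    refine Real.exp_le_exp.2 (neg_le_neg ?_)
    have h1 : (ε / 8) ^ 2 * q ^ 2 / 8 = (q * ε) ^ 2 / 512 := by ring
    rw [h1]
    nlinarith
  unfold deviationBound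
  have h0 : 0 ≤ (N : ℝ) ^ (-(D + 10)) := by positivity
  generalize (N : ℝ) ^ (-(D + 10)) = X at *
  have h1 : (4 * (N : ℝ) + 2) * Real.exp (1 - q * s / 8 * (ε / 8)) ≤ (4 * N + 2) * X :=
    mul_le_mul_of_nonneg_left e1 (by positivity)
  have h2 : X ≤ N * X := le_mul_of_one_le_left h0 hN1
  linarith

/-- This is where subpolynomial factors compete. The choice `r = q s/8` makes `exp(r/q) = exp(s/8)`,
and `q⁴ s²` and the powers of `1/δ` each cost at most `exp(s/4)`. Together they stay below the `exp
s` coming from the minimal interval length. -/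
theorem ParameterBounds.quadratic_variation_le (h : ParameterBounds N q δ D L s) (hδ0 : 0 < δ)
    (hδ1 : δ < 1) {η : ℝ} (hη0 : 0 < η) (hη : δ ^ 2 * Real.exp s / 10 ^ 6 ≤ N * η) (hq : 0 < q) :
    (q * s / 8) ^ 2 * Real.exp (q * s / 8 * (1 / q)) * (1 / N) * (64 * (1 / η) / (1 / q) ^ 2) ≤
      1 := by
  have hs := h.s_ge
  have hN0 : (0 : ℝ) < N := by exact_mod_cast h.N_pos
  have e1 : q * s / 8 * (1 / q) = s / 8 := by field_simp
  have e2 : (q * s / 8) ^ 2 * Real.exp (s / 8) * (1 / N) * (64 * (1 / η) / (1 / q) ^ 2) =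
      (q ^ 4 * s ^ 2) * Real.exp (s / 8) / (N * η) := by
    field_simp; norm_num
  rw [e1, e2, div_le_one (by positivity)]
  refine le_trans ?_ hη
  have h1 : q ^ 4 * s ^ 2 ≤ Real.exp (s / 4) := by
    calc q ^ 4 * s ^ 2 ≤ (s ^ 20) ^ 4 * s ^ 2 := by
          have := pow_le_pow_left₀ hq.le h.q_le 4
          exact mul_le_mul_of_nonneg_right this (sq_nonneg s)
      _ = s ^ 82 := by ring
      _ ≤ _ := h.pow_le_exp
  have h2 : 1 ≤ δ ^ 2 * Real.exp (s / 4) / 10 ^ 6 := by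
    have h3 := h.one_div_cube_le hδ0
    rw [div_le_iff₀ (by positivity)] at h3
    rw [le_div_iff₀ (by norm_num)]
    have h4 : δ ^ 3 ≤ δ ^ 2 := pow_le_pow_of_le_one hδ0.le hδ1.le (by norm_num)
    have h5 := mul_le_mul_of_nonneg_left h4 (Real.exp_pos (s / 4)).le
    linarith
  calc q ^ 4 * s ^ 2 * Real.exp (s / 8) ≤ Real.exp (s / 4) * Real.exp (s / 8) :=
        mul_le_mul_of_nonneg_right h1 (Real.exp_pos _).le
    _ ≤ Real.exp (s / 4) * Real.exp (s / 8) * (δ ^ 2 * Real.exp (s / 4) / 10 ^ 6) :=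
        le_mul_of_one_le_right (by positivity) h2
    _ = δ ^ 2 * Real.exp (s / 4 + s / 8 + s / 4) / 10 ^ 6 := by
        rw [Real.exp_add, Real.exp_add]; ring
    _ ≤ _ := by
        gcongr
        linarith

theorem ParameterBounds.union_bound_le (h : ParameterBounds N q δ D L s) (hD : 0 < D)
    (hδ0 : 0 < δ) (hδ1 : δ < 1) {M : ℕ} (hM : M ≤ N ^ 4 + 4) :
    (M : ℝ) * ((N + 1) * (N * (2 * deviationBound N q (q * s / 8) (δ ^ 2 / 10 ^ 7 / 8)))) ≤
      (N : ℝ) ^ (-D) := by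
  have hs := h.s_ge
  have hN1 : (1 : ℝ) ≤ N := by exact_mod_cast h.N_pos
  have hN0 : (0 : ℝ) < N := by linarith
  have hN400 : 400 ≤ (N : ℝ) := by
    have := Real.add_one_le_exp s
    linarith [h.exp_le_N]
  have hM' : (M : ℝ) ≤ N ^ 4 + 4 := by exact_mod_cast hM
  have hN4 : (1 : ℝ) ≤ N ^ 4 := one_le_pow₀ hN1
  have hdev := h.deviationBound_le hD hδ0 hδ1
  have hdev0 : 0 ≤ deviationBound N q (q * s / 8) (δ ^ 2 / 10 ^ 7 / 8) := by
    unfold deviationBound; positivity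
  have hsplit : (N : ℝ) ^ (-D) = (N : ℝ) ^ (10 : ℕ) * (N : ℝ) ^ (-(D + 10)) := by
    rw [← Real.rpow_natCast, ← Real.rpow_add hN0]
    congr 1; push_cast; ring
  have h0 : 0 ≤ (N : ℝ) ^ (-(D + 10)) := by positivity
  rw [hsplit]
  calc _ ≤ (5 * (N : ℝ) ^ 4) * ((2 * N) * (N * (2 * (20 * N * (N : ℝ) ^ (-(D + 10)))))) := by
        gcongr
        · linarith
        · linarith
    _ = 400 * (N : ℝ) ^ 7 * (N : ℝ) ^ (-(D + 10)) := by ring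
    _ ≤ (N : ℝ) ^ (10 : ℕ) * (N : ℝ) ^ (-(D + 10)) := by
        refine mul_le_mul_of_nonneg_right ?_ h0
        calc 400 * (N : ℝ) ^ 7 ≤ N * (N : ℝ) ^ 7 := by gcongr
          _ = (N : ℝ) ^ 8 := by ring
          _ ≤ _ := pow_le_pow_right₀ hN1 (by norm_num)

end Parameters

/-- The local law on a bounded interval whose length is at most `2 / δ`. -/
theorem IsSparseMatrix.measureReal_compl_le {Ω : Type*} [MeasurableSpace Ω] {P : Measure Ω}
    [IsProbabilityMeasure P] {N : ℕ} {q K f δ D L s a b : ℝ} {H : Ω → Matrix (Fin N) (Fin N) ℝ}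
    (hH : IsSparseMatrix P q K H) (hf : 0 ≤ f) (hD : 0 < D) (hδ0 : 0 < δ) (hδ1 : δ < 1)
    (hp : ParameterBounds N q δ D L s) (hab : a < b) (hlen : δ * (b - a) < 2)
    (hlow : Real.exp s ≤ N * (b - a)) {I : Set ℝ} (hI : MeasurableSet I)
    (hI1 : Set.Ioo a b ⊆ I) (hI2 : I ⊆ Set.Icc a b) :
    P.real {ω | ¬ |(empiricalMeasure (adjacencyMatrix_isHermitian f (hH.isHermitian ω))).real I -
      semicircle.real I| ≤ δ * (b - a)} ≤ (N : ℝ) ^ (-D) := by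
  have hs := hp.s_ge
  have hN1 : (1 : ℝ) ≤ N := by exact_mod_cast hp.N_pos
  have hN0 : (0 : ℝ) < N := by linarith
  have hab' : 0 < b - a := sub_pos.2 hab
  have hδ2 : δ ^ 2 ≤ 1 := pow_le_one₀ hδ0.le hδ1.le
  have hδ3 : δ ^ 3 ≤ δ ^ 2 := pow_le_pow_of_le_one hδ0.le hδ1.le (by norm_num)
  have hexp : Real.exp (s / 4) ≤ Real.exp s := Real.exp_le_exp.2 (by linarith)
  have hcube : 10 ^ 19 ≤ Real.exp s * δ ^ 3 := by
    have h1 := (hp.one_div_cube_le hδ0).trans hexp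
    rwa [div_le_iff₀ (by positivity)] at h1
  have hcubeN : 10 ^ 19 ≤ N * δ ^ 3 := hcube.trans (by
    have := hp.exp_le_N
    gcongr)
  set ε := δ ^ 2 / 10 ^ 7 with hε
  set η := δ ^ 2 * min (b - a) 1 / 10 ^ 6 with hη
  have hmin0 : 0 < min (b - a) 1 := lt_min hab' one_pos
  have hη0 : 0 < η := by positivity
  have hNmin : Real.exp s ≤ N * min (b - a) 1 := by
    rw [mul_min_of_nonneg _ _ hN0.le, mul_one]
    exact le_min hlow hp.exp_le_N
  have hNη : δ ^ 2 * Real.exp s / 10 ^ 6 ≤ N * η := by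
    calc δ ^ 2 * Real.exp s / 10 ^ 6 ≤ δ ^ 2 * (N * min (b - a) 1) / 10 ^ 6 := by gcongr
      _ = _ := by rw [hη]; ring
  have hq1 : 1 ≤ q ∧ 1 / q ≤ ε := by
    have h1 := hp.q_eps hD hδ0
    have h2 : 1 ≤ 10 ^ 5 * (1 + D) * s := by nlinarith
    have h3 : 1 ≤ q * ε := h2.trans h1
    have hε0 : 0 < ε := by positivity
    have hε1 : ε ≤ 1 := by rw [hε]; linarith
    have hq0 : 0 < q := by
      by_contra hcon
      have := mul_nonpos_of_nonpos_of_nonneg (not_lt.1 hcon) hε0.le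
      linarith
    refine ⟨h3.trans (mul_le_of_le_one_right hq0.le hε1), ?_⟩
    rw [div_le_iff₀ hq0]
    linarith
  obtain ⟨hq1, hqε⟩ := hq1
  have hε1 : ε ≤ 1 := by rw [hε]; linarith
  have hNε : (N : ℝ)⁻¹ ≤ ε := by
    rw [inv_le_iff_one_le_mul₀ hN0, hε]
    have := mul_le_mul_of_nonneg_left hδ3 hN0.le
    linarith
  have hbaN : b - a ≤ N := by
    -- Intervals with `δ (b - a) < 2` are the only nontrivial ones; their length is at most `2/δ ≤
    -- N`, as the grid requires.
    have h1 : b - a ≤ 2 / δ := by rw [le_div_iff₀ hδ0]; linarith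
    refine h1.trans ?_
    rw [div_le_iff₀ hδ0]
    have : δ ^ 3 ≤ δ := by
      calc δ ^ 3 ≤ δ ^ 1 := pow_le_pow_of_le_one hδ0.le hδ1.le (by norm_num)
        _ = δ := pow_one δ
    have := mul_le_mul_of_nonneg_left this hN0.le
    linarith
  have hNη' : 1 / (N * η) ≤ δ / 100 := by
    rw [div_le_div_iff₀ (by positivity) (by norm_num)]
    have h1 := mul_le_mul_of_nonneg_left hNη hδ0.le
    have h2 : δ * (δ ^ 2 * Real.exp s / 10 ^ 6) = Real.exp s * δ ^ 3 / 10 ^ 6 := by ring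
    rw [h2] at h1
    linarith
  have hκη : η ≤ 360 / δ * η := le_mul_of_one_le_left hη0.le (by
    rw [le_div_iff₀ hδ0]; linarith)
  have hηba : η ≤ b - a := by
    rw [hη]
    have := min_le_left (b - a) 1
    calc δ ^ 2 * min (b - a) 1 / 10 ^ 6 ≤ 1 * (b - a) / 10 ^ 6 := by gcongr
      _ ≤ _ := by linarith
  have hpts : ∀ p ∈ spectralPoints N a b (360 / δ) η, η ≤ p.2 := by
    intro p hp
    rcases Finset.mem_union.1 hp with h | h
    · simp only [Finset.mem_insert, Finset.mem_singleton] at h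
      rcases h with h | h | h <;> rw [h]
      · exact hκη
      · exact hκη
      · exact hηba
    · obtain ⟨j, _, rfl⟩ := Finset.mem_image.1 h
      exact le_rfl
  have hbad := hH.measure_exists_not_rowConcentrated_le hq1 hη0 _ hpts hqε hε1
    (r := q * s / 8) (by positivity)
    (hp.quadratic_variation_le hδ0 hδ1 hη0 hNη (by linarith))
  have hunion := hp.union_bound_le hD hδ0 hδ1 (card_spectralPoints_le N a b (360 / δ) η)
  refine ENNReal.toReal_le_of_le_ofReal (by positivity) ?_
  refine le_trans (measure_mono ?_) (hbad.trans (ENNReal.ofReal_le_ofReal hunion))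
  intro ω hω hgood
  exact hω (abs_empiricalMeasure_sub_semicircle_le_of_rowConcentrated (hH.isHermitian ω) hf hδ0 hδ1
    hε hp.N_pos hNε hab hbaN hη hNη' hI hI1 hI2 hgood)

end SparseLocalLaw

/-! ### The local law -/

theorem theorem2p4 :
    ∃ Cstar : ℝ, 1 ≤ Cstar ∧
      ∀ D δ : ℝ, 0 < D → 0 < δ → δ < 1 →
      ∀ (Ω : Type*) [MeasurableSpace Ω] (P : Measure Ω) [IsProbabilityMeasure P]
        (N : ℕ) (q f K : ℝ) (H : Ω → Matrix (Fin N) (Fin N) ℝ)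
        (hH : SparseLocalLaw.IsSparseMatrix P q K H),
        0 ≤ f → f ≤ q →
        SparseLocalLaw.constC Cstar δ D * √(Real.log N) ≤ q →
        q ≤ Real.log N ^ 10 →
        SparseLocalLaw.constN₀ Cstar δ D ≤ N →
        ∀ I : Set ℝ, I.OrdConnected →
          ENNReal.ofReal ((N : ℝ) ^ (-1 + Real.log N ^ (-(1 / 2) : ℝ))) ≤ volume I →
          1 - (N : ℝ) ^ (-D) ≤
            P.real {ω |
              ENNReal.ofReal
                |(SparseLocalLaw.empiricalMeasure (SparseLocalLaw.adjacencyMatrix_isHermitian f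
                    (hH.isHermitian ω))).real I - SparseLocalLaw.semicircle.real I| ≤
                ENNReal.ofReal δ * volume I} := by
  -- Large enough that `δ² L²` dominates the `10⁷` in `ε = δ²/10⁷`, and that `L³` dominates
  -- `10¹⁹/δ³`.
  refine ⟨10 ^ 6, by norm_num, ?_⟩
  intro D δ hD hδ0 hδ1 Ω _ P _ N q f K H hH hf _ h1 h2 h3 I hI hlen
  have hp := SparseLocalLaw.ParameterBounds.of_hyps hD hδ0 hδ1 h1 h2 h3
  set s := √(Real.log N) with hs
  have hN0 : (0 : ℝ) < N := by exact_mod_cast hp.N_pos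
  have hpow : (0 : ℝ) ≤ (N : ℝ) ^ (-D) := by positivity
  have hs0 : 0 < s := by linarith [hp.s_ge]
  have huniv : ∀ G : Set Ω, (∀ ω, ω ∈ G) → 1 - (N : ℝ) ^ (-D) ≤ P.real G := fun G hG => by
    rw [Set.eq_univ_of_forall hG, probReal_univ]
    linarith
  -- For infinite length the right-hand side is infinite; for `δ |I| ≥ 2` both measures are too
  -- small to violate the bound.
  by_cases htop : volume I = ⊤
  · refine huniv _ fun ω => ?_
    simp [htop, ENNReal.mul_top, hδ0]
  have hpos : volume I ≠ 0 := fun h0 => by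
    rw [h0, nonpos_iff_eq_zero, ENNReal.ofReal_eq_zero] at hlen
    exact absurd hlen (not_le.2 (by positivity))
  obtain ⟨a, b, hab, hI1, hI2, hvol⟩ :=
    SparseLocalLaw.exists_Ioo_subset_of_ordConnected hI htop hpos
  have hImeas : MeasurableSet I := hI.measurableSet
  rw [hvol, ← ENNReal.ofReal_mul hδ0.le]
  by_cases hlarge : 2 ≤ δ * (b - a)
  · exact huniv _ fun ω => ENNReal.ofReal_le_ofReal
      ((SparseLocalLaw.abs_empiricalMeasure_sub_semicircle_le_two _ hImeas).trans hlarge)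
  -- With `s = √log N`, `N` times the minimal length `N^(-1 + 1/s)` is `exp(s² / s) = exp s`.
  have hlow : Real.exp s ≤ N * (b - a) := by
    rw [hvol, ENNReal.ofReal_le_ofReal_iff (sub_nonneg.2 hab.le)] at hlen
    have hrpow : Real.log N ^ (-(1 / 2) : ℝ) = s⁻¹ := by
      rw [hs, Real.sqrt_eq_rpow, Real.rpow_neg (Real.log_natCast_nonneg N)]
    rw [hrpow, Real.rpow_def_of_pos hN0, hp.log_N] at hlen
    calc Real.exp s = N * Real.exp (s ^ 2 * (-1 + s⁻¹)) := by
          rw [hp.N_eq, ← Real.exp_add]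
          congr 1
          field_simp
          ring
      _ ≤ N * (b - a) := mul_le_mul_of_nonneg_left hlen hN0.le
  have hbad := hH.measureReal_compl_le hf hD hδ0 hδ1 hp hab (not_le.1 hlarge) hlow hImeas hI1 hI2
  -- Passing to the complement through subadditivity avoids showing that the event is measurable.
  refine sub_le_iff_le_add.2 ?_
  refine le_trans ?_ (add_le_add_right hbad _)
  refine le_trans ?_ (measureReal_union_le _ _)
  rw [← probReal_univ (μ := P)]
  refine measureReal_mono fun ω _ => ?_
  by_cases hω : |(SparseLocalLaw.empiricalMeasure (SparseLocalLaw.adjacencyMatrix_isHermitian f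
      (hH.isHermitian ω))).real I - SparseLocalLaw.semicircle.real I| ≤ δ * (b - a)
  · exact Or.inl (ENNReal.ofReal_le_ofReal hω)
  · exact Or.inr hω
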